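/- **Setting.** A weighted graph $(G,\lambda)$ is a countably infinite, connected, locally finite simple graph $G$ with symmetric weights $\lambda_{x,y}\ge 0$ such that $\lambda_{x,y}>0$ if and only if $x\sim y$. Put $\lambda_x=\sum_{y\sim x}\lambda_{x,y}$ and $\lambda(A)=\sum_{x\in A}\lambda_x$ for $A\subset G$. Let $Z=(Z_n)_{n\ge 0}$ under $P_x$ be the Markov chain started at $x$ with transition probabilities $p_{x,y}=\lambda_{x,y}/\lambda_x$, with heat kernel $p_n(x,y)=\lambda_y^{-1}P_x(Z_n=y)$ and Green function $g(x,y)=\lambda_y^{-1}E_x\big[\sum_{k\ge 0}1_{\{Z_k=y\}}\big]\in[0,\infty]$. Let $d_G$ denote the graph distance. Consider the following conditions, where $d$ is a distance function on $G$: - $(p_0)$: there is $c_0>0$ with $p_{x,y}\ge c_0$ for all $x\sim y$ in $G$. - $(\mathrm{UHK}(\alpha,\beta))$ with respect to $d$: there is $C\in(0,\infty)$ such that for all $x,y\in G$ and all integers $n\ge 1$, $$p_n(x,y)\le C n^{-\alpha/\beta}\exp\Big\{-\Big(\frac{d(x,y)^\beta}{Cn}\Big)^{\frac1{\beta-1}}\Big\}.$$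 - $(\mathrm{LHK}(\alpha,\beta))$ with respect to $d$: there is $c>0$ such that for all $x,y\in G$ and all integers $n\ge 1$ with $n\ge d_G(x,y)$, $$p_n(x,y)+p_{n+1}(x,y)\ge c\, n^{-\alpha/\beta}\exp\Big\{-\Big(\frac{d(x,y)^\beta}{cn}\Big)^{\frac1{\beta-1}}\Big\}.$$ - $(V_\alpha)$ with respect to $d$: $\alpha>2$ and there are $0<c\le C<\infty$ such that $cL^\alpha\le\lambda(\{y: d(x,y)\le L\})\le CL^\alpha$ for all $x\in G$ and all real $L\ge 1$. - $(G_\beta)$ with respect to $d$, with $\alpha$ as in $(V_\alpha)$: $2\le\beta<\alpha$ and there are $0<c\le C<\infty$ such that $c\le g(x,x)\le C$ for all $x\in G$, and $c\,d(x,y)^{-(\alpha-\beta)}\le g(x,y)\le C\,d(x,y)^{-(\alpha-\beta)}$ for all $x\ne y$ in $G$. **Proposition.** Let $(G_i,\lambda^i)$, $i=1,2$, be weighted graphs that satisfy $(p_0)$, and $(\mathrm{UHK}(\alpha_i,\beta_i))$ and $(\mathrm{LHK}(\alpha_i,\beta_i))$ with respect to the graph distance $d_{G_i}$, where $\alpha_i\ge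 1$ and $2\le\beta_i\le 1+\alpha_i$ for $i=1,2$, and $\alpha_j>1$ or $\beta_j>2$ for some $j\in\{1,2\}$. Suppose that $\beta_1\le\beta_2$. Let $G=G_1\times G_2$ be the graph in which $(x_1,x_2)\sim(y_1,y_2)$ if and only if $x_1\sim y_1$ and $x_2=y_2$, or $x_1=y_1$ and $x_2\sim y_2$, and endow it with the weights $\lambda_{x,y}=\lambda^i_{x_i,y_i}$ for $x\sim y$, where $i$ is such that $x_i\ne y_i$. Put $$\alpha=\alpha_1\frac{\beta_2}{\beta_1}+\alpha_2,\qquad \beta=\beta_2,\qquad d(x,y)=\max\big(d_{G_1}(x_1,y_1)^{\beta_1/\beta_2},\,d_{G_2}(x_2,y_2)\big).$$ Then $d$ is a distance function on $G$, and $(G,\lambda)$ satisfies $(V_\alpha)$ and $(G_\beta)$ with respect to $d$ (in particular $\alpha>2$ and $2\le\beta<\alpha$). -/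

import Mathlib

open scoped ENNReal
open MeasureTheory ProbabilityTheory

/-- A connected, locally finite graph on the vertex set `V` with a symmetric non-negative weight
function on pairs of vertices that is positive exactly on the edges. -/
structure WeightedGraph (V : Type*) where
  /-- The underlying (simple, unoriented) graph. -/
  graph : SimpleGraph V
  /-- The weight `λ_{x,y}`. -/
  weight : V → V → ℝ
  weight_symm : ∀ x y, weight x y = weight y x
  weight_nonneg : ∀ x y, 0 ≤ weight x y
  weight_pos_iff : ∀ x y, 0 < weight x y ↔ graph.Adj x y
  finite_neighborSet : ∀ x, (graph.neighborSet x).Finite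
  connected : graph.Connected

namespace WeightedGraph

noncomputable section

variable {V : Type*}

/-- The finite set of neighbours of `x`. -/
def nbrs (W : WeightedGraph V) (x : V) : Finset V := (W.finite_neighborSet x).toFinset

/-- The weight `λ_x = ∑_{y ∼ x} λ_{x,y}` of a vertex. -/
def vertexWeight (W : WeightedGraph V) (x : V) : ℝ := ∑ y ∈ W.nbrs x, W.weight x y

/-- The weight `λ(A) = ∑_{x ∈ A} λ_x` of a set of vertices, with values in `[0, ∞]`. -/
def volume (W : WeightedGraph V) (A : Set V) : ℝ≥0∞ :=
  ∑' x : A, ENNReal.ofReal (W.vertexWeight x)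

/-- The transition probability `p_{x,y} = λ_{x,y} / λ_x`. -/
def transProb (W : WeightedGraph V) (x y : V) : ℝ := W.weight x y / W.vertexWeight x

/-- The graph distance, as a real number. -/
def graphDist (W : WeightedGraph V) (x y : V) : ℝ := (W.graph.dist x y : ℝ)

theorem vertexWeight_pos [Nontrivial V] (W : WeightedGraph V) (x : V) :
    0 < W.vertexWeight x := by
  obtain ⟨y, hy⟩ := W.connected.preconnected.exists_adj_of_nontrivial x
  refine Finset.sum_pos' (fun z _ => W.weight_nonneg x z) ⟨y, ?_, (W.weight_pos_iff x y).2 hy⟩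
  simpa [nbrs] using hy

/-- Condition `(p₀)`: the transition probabilities along edges are bounded from below. -/
def ControlledWeights (W : WeightedGraph V) : Prop :=
  ∃ c₀ : ℝ, 0 < c₀ ∧ ∀ x y, W.graph.Adj x y → c₀ ≤ W.transProb x y

section Walk

variable [MeasurableSpace V] [DiscreteMeasurableSpace V]

/-- The one-step transition kernel `x ↦ ∑_{y ∼ x} p_{x,y} δ_y` of the walk. -/
def stepKernel (W : WeightedGraph V) : Kernel V V where
  toFun x := ∑ y ∈ W.nbrs x, ENNReal.ofReal (W.transProb x y) • Measure.dirac y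
  measurable' := Measurable.of_discrete

instance [Nontrivial V] (W : WeightedGraph V) : IsMarkovKernel W.stepKernel where
  isProbabilityMeasure x := ⟨by
    change (∑ y ∈ W.nbrs x, ENNReal.ofReal (W.transProb x y) • Measure.dirac y :
      Measure V) Set.univ = 1
    simp only [Measure.coe_finsetSum, Measure.coe_smul, Finset.sum_apply, Pi.smul_apply,
      measure_univ, smul_eq_mul, mul_one]
    unfold transProb
    rw [← ENNReal.ofReal_sum_of_nonneg
      (fun y _ => div_nonneg (W.weight_nonneg x y) (W.vertexWeight_pos x).le)]
    rw [← Finset.sum_div, ← vertexWeight, div_self (W.vertexWeight_pos x).ne',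
      ENNReal.ofReal_one]⟩

/-- The transition from the history `(Z_0, …, Z_n)` to `Z_{n+1}`: one step from `Z_n`. -/
def historyKernel (W : WeightedGraph V) (n : ℕ) :
    Kernel (Π _ : Finset.Iic n, V) V :=
  W.stepKernel.comap (fun h => h ⟨n, Finset.mem_Iic.2 le_rfl⟩) (measurable_pi_apply _)

instance [Nontrivial V] (W : WeightedGraph V) (n : ℕ) : IsMarkovKernel (W.historyKernel n) := by
  unfold historyKernel; infer_instance

/-- The canonical law `P_x` of the discrete-time walk `Z = (Z_n)_{n ≥ 0}` started at `x`, on the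
space of trajectories `ℕ → V`, with `Z_n` the `n`-th coordinate. -/
def law [Nontrivial V] (W : WeightedGraph V) (x : V) : Measure (ℕ → V) :=
  Kernel.trajMeasure (X := fun _ => V) (Measure.dirac x) W.historyKernel

/-- The heat kernel `p_n(x,y) = P_x(Z_n = y) / λ_y`. -/
def heatKernel [Nontrivial V] (W : WeightedGraph V) (n : ℕ) (x y : V) : ℝ :=
  (W.law x).real {z | z n = y} / W.vertexWeight y

/-- The Green function `g(x,y) = λ_y⁻¹ E_x[∑_{k ≥ 0} 1_{Z_k = y}]`, with values in `[0, ∞]`. -/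
def green [Nontrivial V] (W : WeightedGraph V) (x y : V) : ℝ≥0∞ :=
  (ENNReal.ofReal (W.vertexWeight y))⁻¹ *
    ∫⁻ z, ∑' k : ℕ, Set.indicator {y} (fun _ => (1 : ℝ≥0∞)) (z k) ∂(W.law x)

/-- The sub-Gaussian upper heat kernel bound `UHK(α, β)` with respect to `d`. -/
def UHK [Nontrivial V] (W : WeightedGraph V) (d : V → V → ℝ) (α β : ℝ) : Prop :=
  ∃ C : ℝ, 0 < C ∧ ∀ (x y : V) (n : ℕ), 1 ≤ n →
    W.heatKernel n x y ≤
      C * (n : ℝ) ^ (-(α / β)) * Real.exp (-((d x y ^ β / (C * n)) ^ (1 / (β - 1))))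

/-- The sub-Gaussian lower heat kernel bound `LHK(α, β)` with respect to `d`. -/
def LHK [Nontrivial V] (W : WeightedGraph V) (d : V → V → ℝ) (α β : ℝ) : Prop :=
  ∃ c : ℝ, 0 < c ∧ ∀ (x y : V) (n : ℕ), 1 ≤ n → W.graph.dist x y ≤ n →
    c * (n : ℝ) ^ (-(α / β)) * Real.exp (-((d x y ^ β / (c * n)) ^ (1 / (β - 1)))) ≤
      W.heatKernel n x y + W.heatKernel (n + 1) x y

/-- Condition `(G_β)` with respect to `d`, where `α` is the exponent of the volume growth:
`2 ≤ β < α`, and `g(x,x)` and `g(x,y) d(x,y)^{α-β}`, `x ≠ y`, are bounded from above and below by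
positive constants. -/
def GreenDecay [Nontrivial V] (W : WeightedGraph V) (d : V → V → ℝ) (α β : ℝ) : Prop :=
  2 ≤ β ∧ β < α ∧ ∃ c C : ℝ, 0 < c ∧ c ≤ C ∧
    (∀ x, ENNReal.ofReal c ≤ W.green x x ∧ W.green x x ≤ ENNReal.ofReal C) ∧
    ∀ x y, x ≠ y →
      ENNReal.ofReal (c * d x y ^ (-(α - β))) ≤ W.green x y ∧
      W.green x y ≤ ENNReal.ofReal (C * d x y ^ (-(α - β)))

end Walk

/-- Condition `(V_α)` with respect to `d`: `α > 2`, and the closed balls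
`B(x, L) = {y : d(x,y) ≤ L}`, `L ≥ 1`, have volume comparable to `L ^ α`. -/
def VolumeGrowth (W : WeightedGraph V) (d : V → V → ℝ) (α : ℝ) : Prop :=
  2 < α ∧ ∃ c C : ℝ, 0 < c ∧ c ≤ C ∧ ∀ (x : V) (L : ℝ), 1 ≤ L →
    ENNReal.ofReal (c * L ^ α) ≤ W.volume {y | d x y ≤ L} ∧
    W.volume {y | d x y ≤ L} ≤ ENNReal.ofReal (C * L ^ α)

open Classical in
/-- The product `G₁ × G₂`: two vertices are neighbours if they agree in one coordinate and are
neighbours in the other, and the edge carries the weight of the corresponding edge of the factor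
in which the two vertices differ. -/
def prod {V₁ V₂ : Type*} (W₁ : WeightedGraph V₁) (W₂ : WeightedGraph V₂) :
    WeightedGraph (V₁ × V₂) where
  graph := W₁.graph.boxProd W₂.graph
  weight x y :=
    if x.2 = y.2 then W₁.weight x.1 y.1 else if x.1 = y.1 then W₂.weight x.2 y.2 else 0
  weight_symm x y := by
    simp only [eq_comm (a := y.2), eq_comm (a := y.1), W₁.weight_symm y.1, W₂.weight_symm y.2]
  weight_nonneg x y := by
    split_ifs
    exacts [W₁.weight_nonneg _ _, W₂.weight_nonneg _ _, le_rfl]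
  weight_pos_iff x y := by
    rw [SimpleGraph.boxProd_adj]
    split_ifs with h₂ h₁
    · rw [W₁.weight_pos_iff]
      simp [h₂]
    · rw [W₂.weight_pos_iff]
      simp [h₁, h₂]
    · simp [h₁, h₂]
  finite_neighborSet x := by
    rw [SimpleGraph.neighborSet_boxProd]
    exact ((W₁.finite_neighborSet x.1).prod (Set.finite_singleton _)).union
      ((Set.finite_singleton _).prod (W₂.finite_neighborSet x.2))
  connected := W₁.connected.boxProd W₂.connected

end

end WeightedGraph

/-- `d` is a distance function on `X`. -/
structure IsDistance {X : Type*} (d : X → X → ℝ) : Prop where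
  eq_zero_iff : ∀ x y, d x y = 0 ↔ x = y
  symm : ∀ x y, d x y = d y x
  triangle : ∀ x y z, d x z ≤ d x y + d y z

/-- The function `d(x,y) = max(d_{G₁}(x₁,y₁)^{β₁/β₂}, d_{G₂}(x₂,y₂))` on `G₁ × G₂`. -/
noncomputable def productDist {V₁ V₂ : Type*} (W₁ : WeightedGraph V₁) (W₂ : WeightedGraph V₂)
    (β₁ β₂ : ℝ) (x y : V₁ × V₂) : ℝ :=
  max (W₁.graphDist x.1 y.1 ^ (β₁ / β₂)) (W₂.graphDist x.2 y.2)

/-! In continuous time the coordinates of a product walk are independent, so its Green function is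
an integral over time of a product of heat kernels. Put `ρᵢ = d_{Gᵢ} ^ βᵢ` and `aᵢ = αᵢ / βᵢ`. If
`pᵢ(t)` is of order `t ^ (-aᵢ)` for `t` above `ρᵢ` and negligible below, then `∫ p₁(t) p₂(t) dt` is
of order `D ^ (1 - a₁ - a₂)` with `D = max ρ₁ ρ₂ = d ^ β₂`, which is the required `d ^ (-(α - β))`.
This needs `a₁ + a₂ > 1`, which is what the conditions on `αᵢ, βᵢ` provide.

The vertex weights lie between positive constants, but need not be constant, so the coordinates are
independent only for chains whose jump rate at `x` is proportional to `λ_x`. With a common bound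
`Λ`, the chain that moves with probability `λ_x / Λ` is symmetric, and the average of the two factor
chains is a lazy version of the product walk (`lazy_prod`). Green functions of lazy and original
chains are comparable (`geom_lazy_le`, `geom_le_geom_lazy`), which gives `green_prod_bounds`.

The heat kernel hypotheses concern the original chain `P`, and laziness that varies with the vertex
does not act simply on powers of `P`. It does act well on resolvents. Laplace transforms of the
continuous-time kernel are powers of resolvents, so they inherit bounds from `P` (`laplace_upper`,
`laplace_lower`). Monotonicity of the diagonal in time turns these into diagonal heat kernel bounds,
and positivity of the semigroup gives an upper bound off the diagonal.

For the upper Green bound, one kernel is replaced by `(1 + t) ^ (-a)`; writing this weight as a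
mixture of exponentials transfers the integral of the other kernel to `P`
(`lintegral_rpow_mul_heat_upper`). For the lower bound, one factor needs a pointwise near-diagonal
bound (`heat_lower`). The heat kernel is almost harmonic for the resolvent because its time
increments are small (`heat_sub_resolvent`), and a Doeblin minorisation contracts its oscillation
from scale to scale (`oscillation_step`, `heat_equicontinuous`). The other factor enters only
through a time integral.

Volumes also come from the heat kernels: the lower bound allows few points in a ball since the total
mass is one, and the upper bounds force the mass at a suitable time to spread over many points
(`ballCard_upper`, `ballCard_lower`). -/

/-! ### Matrices over `[0, ∞]`: tensor products, power series, geometric series -/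

/-- Matrices indexed by an arbitrary set, with entries in `[0, ∞]`. -/
@[ext] structure InfMatrix (V : Type*) where
  /-- The entries of the matrix. -/
  entry : V → V → ℝ≥0∞

namespace InfMatrix

noncomputable section

variable {V V₁ V₂ : Type*}

instance : CoeFun (InfMatrix V) (fun _ => V → V → ℝ≥0∞) := ⟨entry⟩

instance : Add (InfMatrix V) := ⟨fun A B => ⟨fun x y => A x y + B x y⟩⟩
instance : Zero (InfMatrix V) := ⟨⟨fun _ _ => 0⟩⟩
instance : Mul (InfMatrix V) := ⟨fun A B => ⟨fun x y => ∑' z, A x z * B z y⟩⟩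
open Classical in
instance : One (InfMatrix V) := ⟨⟨fun x y => if x = y then 1 else 0⟩⟩

@[simp] theorem add_apply (A B : InfMatrix V) (x y : V) : (A + B) x y = A x y + B x y := rfl
@[simp] theorem zero_apply (x y : V) : (0 : InfMatrix V) x y = 0 := rfl
theorem mul_apply (A B : InfMatrix V) (x y : V) : (A * B) x y = ∑' z, A x z * B z y := rfl
open Classical in
theorem one_apply (x y : V) : (1 : InfMatrix V) x y = if x = y then 1 else 0 := rfl
@[simp] theorem one_apply_self (x : V) : (1 : InfMatrix V) x x = 1 := by simp [one_apply]
theorem one_apply_ne {x y : V} (h : x ≠ y) : (1 : InfMatrix V) x y = 0 := by simp [one_apply, h]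

theorem one_apply_comm (x y : V) : (1 : InfMatrix V) x y = (1 : InfMatrix V) y x := by
  by_cases h : x = y
  · rw [h]
  · rw [one_apply_ne h, one_apply_ne (Ne.symm h)]

theorem tsum_one_mul (f : V → ℝ≥0∞) (x : V) : ∑' z, (1 : InfMatrix V) x z * f z = f x := by
  rw [tsum_eq_single x]
  · simp
  · intro z hz
    simp [one_apply_ne hz.symm]

theorem tsum_mul_one (f : V → ℝ≥0∞) (x : V) : ∑' z, f z * (1 : InfMatrix V) z x = f x := by
  simp_rw [mul_comm (f _), one_apply_comm _ x, tsum_one_mul]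

instance : Semiring (InfMatrix V) where
  add_assoc A B C := by ext; simp [add_assoc]
  zero_add A := by ext; simp
  add_zero A := by ext; simp
  add_comm A B := by ext; simp [add_comm]
  nsmul := nsmulRec
  left_distrib A B C := by
    ext x y; simp [mul_apply, mul_add, ENNReal.tsum_add]
  right_distrib A B C := by
    ext x y; simp [mul_apply, add_mul, ENNReal.tsum_add]
  zero_mul A := by ext; simp [mul_apply]
  mul_zero A := by ext; simp [mul_apply]
  mul_assoc A B C := by
    ext x y
    simp only [mul_apply, ← ENNReal.tsum_mul_right, ← ENNReal.tsum_mul_left]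
    rw [ENNReal.tsum_comm]
    simp only [mul_assoc]
  one_mul A := by ext x y; exact tsum_one_mul (fun z => A z y) x
  mul_one A := by ext x y; exact tsum_mul_one (fun z => A x z) y

theorem sum_apply {ι : Type*} (s : Finset ι) (A : ι → InfMatrix V) (x y : V) :
    (∑ i ∈ s, A i) x y = ∑ i ∈ s, A i x y := by
  classical
  induction s using Finset.induction_on with
  | empty => simp
  | insert i s hi ih => simp [Finset.sum_insert hi, ih]

theorem natCast_mul_apply (n : ℕ) (A : InfMatrix V) (x y : V) :
    ((n : InfMatrix V) * A) x y = n * A x y := by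
  induction n with
  | zero => simp
  | succ n ih => simp [add_mul, ih]

theorem mul_le_mul_apply {A B C D : InfMatrix V} (h₁ : ∀ x y, A x y ≤ B x y)
    (h₂ : ∀ x y, C x y ≤ D x y) (x y : V) : (A * C) x y ≤ (B * D) x y :=
  ENNReal.tsum_le_tsum fun z => mul_le_mul' (h₁ x z) (h₂ z y)

theorem pow_le_pow_apply {A B : InfMatrix V} (h : ∀ x y, A x y ≤ B x y) (n : ℕ) (x y : V) :
    (A ^ n) x y ≤ (B ^ n) x y := by
  induction n generalizing x y with
  | zero => simp
  | succ n ih => rw [pow_succ, pow_succ]; exact mul_le_mul_apply ih h x y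

/-- Multiplication of all entries by a constant. -/
def scale (c : ℝ≥0∞) (A : InfMatrix V) : InfMatrix V := ⟨fun x y => c * A x y⟩

@[simp] theorem scale_apply (c : ℝ≥0∞) (A : InfMatrix V) (x y : V) : scale c A x y = c * A x y :=
  rfl

theorem scale_mul_scale (c d : ℝ≥0∞) (A B : InfMatrix V) :
    scale c A * scale d B = scale (c * d) (A * B) := by
  ext x y
  simp only [mul_apply, scale_apply, ← ENNReal.tsum_mul_left]
  exact tsum_congr fun z => by ring

theorem scale_pow (c : ℝ≥0∞) (A : InfMatrix V) (n : ℕ) : scale c A ^ n = scale (c ^ n) (A ^ n) := by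
  induction n with
  | zero => ext; simp
  | succ n ih => rw [pow_succ, ih, scale_mul_scale, pow_succ, pow_succ]

/-- The transpose is the matrix itself. -/
def IsSymm (A : InfMatrix V) : Prop := ∀ x y, A x y = A y x

theorem IsSymm.mul_apply_comm {A B : InfMatrix V} (hA : A.IsSymm) (hB : B.IsSymm) (x y : V) :
    (A * B) x y = (B * A) y x := by
  simp only [mul_apply]
  exact tsum_congr fun z => by rw [hA x z, hB z y, mul_comm]

theorem IsSymm.pow {A : InfMatrix V} (hA : A.IsSymm) (n : ℕ) : (A ^ n).IsSymm := by
  induction n with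
  | zero => intro x y; simpa using one_apply_comm x y
  | succ n ih => intro x y; rw [pow_succ, ih.mul_apply_comm hA, ← pow_succ', pow_succ]

/-- All rows sum to one. -/
def IsStochastic (A : InfMatrix V) : Prop := ∀ x, ∑' y, A x y = 1

theorem IsStochastic.mul {A B : InfMatrix V} (hA : A.IsStochastic) (hB : B.IsStochastic) :
    (A * B).IsStochastic := by
  intro x
  simp only [mul_apply]
  rw [ENNReal.tsum_comm]
  simp_rw [ENNReal.tsum_mul_left, hB _, mul_one, hA x]

theorem isStochastic_one : (1 : InfMatrix V).IsStochastic := by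
  intro x
  simpa using tsum_one_mul (fun _ => 1) x

theorem IsStochastic.pow {A : InfMatrix V} (hA : A.IsStochastic) (n : ℕ) :
    (A ^ n).IsStochastic := by
  induction n with
  | zero => simpa using isStochastic_one
  | succ n ih => rw [pow_succ]; exact ih.mul hA

theorem IsStochastic.apply_le_one {A : InfMatrix V} (hA : A.IsStochastic) (x y : V) :
    A x y ≤ 1 := hA x ▸ ENNReal.le_tsum y

/-- The matrix `A ⊗ B`. -/
def kron (A : InfMatrix V₁) (B : InfMatrix V₂) : InfMatrix (V₁ × V₂) :=
  ⟨fun x y => A x.1 y.1 * B x.2 y.2⟩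

theorem kron_apply (A : InfMatrix V₁) (B : InfMatrix V₂) (x y : V₁ × V₂) :
    kron A B x y = A x.1 y.1 * B x.2 y.2 := rfl

theorem kron_mul_kron (A C : InfMatrix V₁) (B D : InfMatrix V₂) :
    kron A B * kron C D = kron (A * C) (B * D) := by
  ext x y
  simp only [mul_apply, kron_apply]
  rw [ENNReal.tsum_prod', ← ENNReal.tsum_mul_right]
  refine tsum_congr fun a => ?_
  rw [← ENNReal.tsum_mul_left]
  exact tsum_congr fun b => by ring

theorem kron_one_one : kron (1 : InfMatrix V₁) (1 : InfMatrix V₂) = 1 := by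
  ext x y
  by_cases h₁ : x.1 = y.1 <;> by_cases h₂ : x.2 = y.2 <;>
    simp [kron_apply, one_apply, Prod.ext_iff, h₁, h₂]

theorem kron_pow (A : InfMatrix V₁) (B : InfMatrix V₂) (n : ℕ) :
    kron A B ^ n = kron (A ^ n) (B ^ n) := by
  induction n with
  | zero => simp [kron_one_one]
  | succ n ih => rw [pow_succ, ih, kron_mul_kron, pow_succ, pow_succ]

/-- The moves of the two coordinates commute, so the binomial theorem applies. -/
theorem kron_add_pow_apply (A : InfMatrix V₁) (B : InfMatrix V₂) (n : ℕ) (x y : V₁ × V₂) :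
    ((kron A 1 + kron 1 B) ^ n : InfMatrix (V₁ × V₂)) x y =
      ∑ ij ∈ Finset.HasAntidiagonal.antidiagonal n,
      (n.choose ij.1 : ℝ≥0∞) * ((A ^ ij.1) x.1 y.1 * (B ^ ij.2) x.2 y.2) := by
  have hc : Commute (kron A (1 : InfMatrix V₂)) (kron (1 : InfMatrix V₁) B) := by
    rw [Commute, SemiconjBy, kron_mul_kron, kron_mul_kron]
    simp
  rw [hc.add_pow', sum_apply]
  refine Finset.sum_congr rfl fun ij _ => ?_
  rw [kron_pow, kron_pow, kron_mul_kron, one_pow, one_pow, one_mul, mul_one, nsmul_eq_mul,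
    natCast_mul_apply]
  rfl

/-- The matrix `∑ₙ cₙ Aⁿ`. -/
def series (c : ℕ → ℝ≥0∞) (A : InfMatrix V) : InfMatrix V := ⟨fun x y => ∑' n, c n * (A ^ n) x y⟩

theorem series_apply (c : ℕ → ℝ≥0∞) (A : InfMatrix V) (x y : V) :
    series c A x y = ∑' n, c n * (A ^ n) x y := rfl

theorem _root_.ENNReal.tsum_mul_tsum_antidiagonal (f : ℕ → ℕ → ℝ≥0∞) :
    ∑' i, ∑' j, f i j = ∑' n, ∑ ij ∈ Finset.HasAntidiagonal.antidiagonal n, f ij.1 ij.2 := by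
  rw [← ENNReal.tsum_prod, ← Finset.HasAntidiagonal.sigmaAntidiagonalEquivProd.tsum_eq,
    ENNReal.tsum_sigma']
  refine tsum_congr fun n => ?_
  rw [tsum_fintype]
  exact (Finset.sum_coe_sort (Finset.HasAntidiagonal.antidiagonal n) (fun ij => f ij.1 ij.2))

theorem series_mul_series (c d : ℕ → ℝ≥0∞) (A : InfMatrix V) :
    series c A * series d A =
      series (fun n => ∑ ij ∈ Finset.HasAntidiagonal.antidiagonal n, c ij.1 * d ij.2) A := by
  ext x y
  simp only [mul_apply, series_apply]
  have h : ∀ z, (∑' n, c n * (A ^ n) x z) * (∑' n, d n * (A ^ n) z y) =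
      ∑' i, ∑' j, c i * d j * ((A ^ i) x z * (A ^ j) z y) := by
    intro z
    rw [← ENNReal.tsum_mul_right]
    refine tsum_congr fun i => ?_
    rw [← ENNReal.tsum_mul_left]
    exact tsum_congr fun j => by ring
  simp_rw [h]
  rw [ENNReal.tsum_comm]
  have h₂ : ∀ i, ∑' z, ∑' j, c i * d j * ((A ^ i) x z * (A ^ j) z y) =
      ∑' j, c i * d j * (A ^ (i + j)) x y := by
    intro i
    rw [ENNReal.tsum_comm]
    refine tsum_congr fun j => ?_
    rw [ENNReal.tsum_mul_left, pow_add, mul_apply]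
  simp_rw [h₂]
  rw [ENNReal.tsum_mul_tsum_antidiagonal (fun i j => c i * d j * (A ^ (i + j)) x y)]
  refine tsum_congr fun n => ?_
  rw [Finset.sum_mul]
  refine Finset.sum_congr rfl fun ij hij => ?_
  rw [Finset.HasAntidiagonal.mem_antidiagonal.1 hij]

theorem IsSymm.symm_series {A : InfMatrix V} (hA : A.IsSymm) (c : ℕ → ℝ≥0∞) :
    (series c A).IsSymm := fun x y => by
  simp only [series_apply]
  exact tsum_congr fun n => by rw [hA.pow n x y]

theorem IsStochastic.tsum_series {A : InfMatrix V} (hA : A.IsStochastic) (c : ℕ → ℝ≥0∞) (x : V) :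
    ∑' y, series c A x y = ∑' n, c n := by
  simp only [series_apply]
  rw [ENNReal.tsum_comm]
  exact tsum_congr fun n => by rw [ENNReal.tsum_mul_left, hA.pow n x, mul_one]

/-- The geometric series `∑ₙ θⁿ Aⁿ`. -/
def geom (θ : ℝ≥0∞) (A : InfMatrix V) : InfMatrix V := series (fun n => θ ^ n) A

theorem geom_apply (θ : ℝ≥0∞) (A : InfMatrix V) (x y : V) :
    geom θ A x y = ∑' n, θ ^ n * (A ^ n) x y := rfl

theorem geom_eq (θ : ℝ≥0∞) (A : InfMatrix V) (x y : V) :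
    geom θ A x y = (1 : InfMatrix V) x y + θ * (A * geom θ A) x y := by
  rw [geom_apply, tsum_eq_zero_add' ENNReal.summable, pow_zero, pow_zero, one_mul, mul_apply]
  congr 1
  simp only [geom_apply, ← ENNReal.tsum_mul_left]
  rw [ENNReal.tsum_comm]
  refine tsum_congr fun n => ?_
  rw [pow_succ' A, mul_apply, ← ENNReal.tsum_mul_left]
  exact tsum_congr fun z => by rw [pow_succ]; ring

/-- The geometric series is the smallest solution of the resolvent equation. -/
theorem geom_le_of_supersolution {θ : ℝ≥0∞} {A S : InfMatrix V}
    (h : ∀ x y, (1 : InfMatrix V) x y + θ * (A * S) x y ≤ S x y) (x y : V) :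
    geom θ A x y ≤ S x y := by
  -- One use of the inequality for `S` adds one term to the partial sum. Nothing is inverted or
  -- subtracted, so infinite entries are harmless.
  have key : ∀ N : ℕ, ∀ x y, ∑ n ∈ Finset.range N, θ ^ n * (A ^ n) x y ≤ S x y := by
    intro N
    induction N with
    | zero => simp
    | succ N ih =>
      intro x y
      refine le_trans ?_ (h x y)
      rw [Finset.sum_range_succ', pow_zero, pow_zero, one_mul, add_comm]
      gcongr
      rw [mul_apply]
      calc ∑ n ∈ Finset.range N, θ ^ (n + 1) * (A ^ (n + 1)) x y
          = θ * ∑' z, A x z * ∑ n ∈ Finset.range N, θ ^ n * (A ^ n) z y := by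
            simp only [pow_succ' A, mul_apply, Finset.mul_sum]
            rw [Summable.tsum_finsetSum (fun _ _ => ENNReal.summable), Finset.mul_sum]
            refine Finset.sum_congr rfl fun n _ => ?_
            rw [← ENNReal.tsum_mul_left, ← ENNReal.tsum_mul_left]
            exact tsum_congr fun z => by rw [pow_succ]; ring
        _ ≤ _ := by
            gcongr with z
            exact ih z y
  rw [geom_apply, ENNReal.tsum_eq_iSup_nat]
  exact iSup_le fun N => key N x y

/-- Negative binomial expansion; the coefficients follow from the hockey-stick identity. The power
`k + 1` puts weight of order `n ^ k` on time `n`. -/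
theorem geom_pow_succ (θ : ℝ≥0∞) (A : InfMatrix V) (k : ℕ) :
    geom θ A ^ (k + 1) = series (fun n => ((n + k).choose k : ℝ≥0∞) * θ ^ n) A := by
  induction k with
  | zero => simp [geom]
  | succ k ih =>
    rw [pow_succ, ih, geom, series_mul_series]
    congr 1
    funext n
    have : ∀ ij ∈ Finset.HasAntidiagonal.antidiagonal n,
        ((ij.1 + k).choose k : ℝ≥0∞) * θ ^ ij.1 * θ ^ ij.2 =
        ((ij.1 + k).choose k : ℝ≥0∞) * θ ^ n := by
      intro ij hij
      rw [mul_assoc, ← pow_add, Finset.HasAntidiagonal.mem_antidiagonal.1 hij]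
    rw [Finset.sum_congr rfl this, ← Finset.sum_mul]
    congr 1
    rw [Finset.Nat.sum_antidiagonal_eq_sum_range_succ_mk, ← Nat.cast_sum]
    congr 1
    simpa [add_assoc, add_comm, add_left_comm] using Nat.sum_range_add_choose n k

end

end InfMatrix

/-! ### Lazy chains and the continuous-time semigroup -/

namespace InfMatrix

noncomputable section

variable {V V₁ V₂ : Type*}

/-- The chain that follows `P` with probability `ℓ x` and stays at `x` otherwise. -/
def lazy (ℓ : V → ℝ) (P : InfMatrix V) : InfMatrix V :=
  ⟨fun x y => ENNReal.ofReal (1 - ℓ x) * (1 : InfMatrix V) x y + ENNReal.ofReal (ℓ x) * P x y⟩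

theorem lazy_mul_apply (ℓ : V → ℝ) (P S : InfMatrix V) (x y : V) :
    (lazy ℓ P * S) x y =
      ENNReal.ofReal (1 - ℓ x) * S x y + ENNReal.ofReal (ℓ x) * (P * S) x y := by
  simp only [mul_apply, lazy, add_mul, ENNReal.tsum_add, mul_assoc, ENNReal.tsum_mul_left]
  rw [tsum_one_mul (fun z => S z y) x]

theorem IsStochastic.lazy {P : InfMatrix V} (hP : P.IsStochastic) {ℓ : V → ℝ}
    (h0 : ∀ x, 0 ≤ ℓ x) (h1 : ∀ x, ℓ x ≤ 1) : (lazy ℓ P).IsStochastic := by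
  intro x
  simp only [InfMatrix.lazy, ENNReal.tsum_add, ENNReal.tsum_mul_left, hP x, isStochastic_one x]
  rw [mul_one, mul_one, ← ENNReal.ofReal_add (by linarith [h1 x]) (h0 x)]
  simp

/-- The right-hand side is a supersolution of the resolvent equation of the lazy chain: `θ ≤ 1`
absorbs the staying part, and `ℓ x * c⁻¹ ≥ 1` the identity. Minimality of the geometric series
concludes. -/
theorem geom_lazy_le {ℓ : V → ℝ} {P : InfMatrix V} {c : ℝ} (hc : 0 < c) (hcl : ∀ x, c ≤ ℓ x)
    (h1 : ∀ x, ℓ x ≤ 1) {θ : ℝ≥0∞} (hθ : θ ≤ 1) (x y : V) :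
    geom θ (lazy ℓ P) x y ≤ ENNReal.ofReal c⁻¹ * geom θ P x y := by
  rw [← scale_apply]
  refine geom_le_of_supersolution (fun x y => ?_) x y
  rw [lazy_mul_apply]
  have hS : scale (ENNReal.ofReal c⁻¹) (geom θ P) x y = ENNReal.ofReal c⁻¹ * (1 : InfMatrix V) x y
      + θ * (P * scale (ENNReal.ofReal c⁻¹) (geom θ P)) x y := by
    have : (P * scale (ENNReal.ofReal c⁻¹) (geom θ P)) x y =
        ENNReal.ofReal c⁻¹ * (P * geom θ P) x y := by
      simp only [mul_apply, scale_apply, ← ENNReal.tsum_mul_left]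
      exact tsum_congr fun z => by ring
    rw [this, scale_apply, geom_eq, mul_add]
    ring
  have hsplit : scale (ENNReal.ofReal c⁻¹) (geom θ P) x y =
      ENNReal.ofReal (1 - ℓ x) * scale (ENNReal.ofReal c⁻¹) (geom θ P) x y +
      ENNReal.ofReal (ℓ x) * scale (ENNReal.ofReal c⁻¹) (geom θ P) x y := by
    rw [← add_mul, ← ENNReal.ofReal_add (by linarith [h1 x]) (by linarith [hcl x])]
    simp
  have hle : 1 ≤ ENNReal.ofReal (ℓ x) * ENNReal.ofReal c⁻¹ := by
    rw [← ENNReal.ofReal_mul (by linarith [hcl x]), ← ENNReal.ofReal_one]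
    refine ENNReal.ofReal_le_ofReal ?_
    rw [← div_eq_mul_inv, le_div_iff₀ hc]
    linarith [hcl x]
  set S := scale (ENNReal.ofReal c⁻¹) (geom θ P)
  calc (1 : InfMatrix V) x y + θ * (ENNReal.ofReal (1 - ℓ x) * S x y +
        ENNReal.ofReal (ℓ x) * (P * S) x y)
      ≤ ENNReal.ofReal (ℓ x) * ENNReal.ofReal c⁻¹ * (1 : InfMatrix V) x y +
        (1 * (ENNReal.ofReal (1 - ℓ x) * S x y) +
          ENNReal.ofReal (ℓ x) * (θ * (P * S) x y)) := by
        rw [mul_add, mul_left_comm θ (ENNReal.ofReal (ℓ x))]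
        gcongr
        exact le_mul_of_one_le_left' hle
    _ = ENNReal.ofReal (1 - ℓ x) * S x y + ENNReal.ofReal (ℓ x) *
        (ENNReal.ofReal c⁻¹ * (1 : InfMatrix V) x y + θ * (P * S) x y) := by ring
    _ = S x y := by rw [← hS, ← hsplit]

/-- Solving the lazy resolvent equation for its diagonal part gives an equation for `P` with the
vertex-dependent parameter `θ ℓ / (1 - θ + θ ℓ)`. This increases in `ℓ`, so replacing `ℓ` by `c`
leaves a supersolution. For `θ = T / (1 + T)` the effect is to replace `T` by `c T`. -/
theorem geom_le_geom_lazy {ℓ : V → ℝ} {P : InfMatrix V} {c : ℝ} (hc : 0 < c)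
    (hcl : ∀ x, c ≤ ℓ x) (h1 : ∀ x, ℓ x ≤ 1) {θ : ℝ} (hθ : 0 < θ) (hθ1 : θ ≤ 1) (x y : V) :
    geom (ENNReal.ofReal (θ * c / (1 - θ + θ * c))) P x y ≤
      geom (ENNReal.ofReal θ) (lazy ℓ P) x y := by
  refine geom_le_of_supersolution (fun x y => ?_) x y
  set U := geom (ENNReal.ofReal θ) (lazy ℓ P) with hU
  have hθc : 0 < θ * c := mul_pos hθ hc
  have hℓ : 0 < ℓ x := hc.trans_le (hcl x)
  have heq := geom_eq (ENNReal.ofReal θ) (lazy ℓ P) x y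
  rw [← hU, lazy_mul_apply] at heq
  -- Where `U` is finite, the resolvent equation makes every term finite and can be solved over the
  -- reals.
  by_cases htop : U x y = ∞
  · rw [htop]; exact le_top
  have hPU : (P * U) x y ≠ ∞ := by
    intro h
    apply htop
    rw [heq, h, ENNReal.mul_top (by simpa using hℓ), add_top, ENNReal.mul_top (by simpa using hθ),
      add_top]
  have hone : (1 : InfMatrix V) x y ≠ ∞ := by
    rw [one_apply]; split_ifs <;> simp
  obtain ⟨u, hu⟩ : ∃ u : NNReal, U x y = u := ⟨_, (ENNReal.coe_toNNReal htop).symm⟩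
  obtain ⟨b, hb⟩ : ∃ u : NNReal, (P * U) x y = u := ⟨_, (ENNReal.coe_toNNReal hPU).symm⟩
  obtain ⟨e, he⟩ : ∃ u : NNReal, (1 : InfMatrix V) x y = u :=
    ⟨_, (ENNReal.coe_toNNReal hone).symm⟩
  rw [hu, hb, he] at heq
  rw [hu, hb, he]
  simp only [← ENNReal.ofReal_coe_nnreal] at heq ⊢
  have hu0 := u.coe_nonneg
  have hb0 := b.coe_nonneg
  have he0 := e.coe_nonneg
  generalize (u : ℝ) = u at *
  generalize (b : ℝ) = b at *
  generalize (e : ℝ) = e at *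
  have h1' : 0 ≤ 1 - ℓ x := by linarith [h1 x]
  rw [← ENNReal.ofReal_mul h1', ← ENNReal.ofReal_mul hℓ.le, ← ENNReal.ofReal_add (by positivity)
    (by positivity), ← ENNReal.ofReal_mul hθ.le, ← ENNReal.ofReal_add (by positivity)
    (by positivity), ENNReal.ofReal_eq_ofReal_iff hu0 (by positivity)] at heq
  have hd : 0 < 1 - θ + θ * c := by linarith
  have hd' : 0 < 1 - θ + θ * ℓ x := by nlinarith
  rw [← ENNReal.ofReal_mul (by positivity), ← ENNReal.ofReal_add he0 (by positivity)]
  refine ENNReal.ofReal_le_ofReal ?_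
  have hu' : u = e / (1 - θ + θ * ℓ x) + θ * ℓ x / (1 - θ + θ * ℓ x) * b := by
    field_simp
    linear_combination heq
  rw [hu']
  gcongr ?_ + ?_ * b
  · rw [le_div_iff₀ hd']
    have : θ * ℓ x ≤ θ := by nlinarith [h1 x]
    nlinarith
  · rw [div_le_div_iff₀ hd hd']
    have := hcl x
    have h2 : θ * c ≤ θ * ℓ x := by gcongr
    nlinarith

/-- The continuous-time semigroup `e^{t(A - 1)}`. -/
def heat (A : InfMatrix V) (t : ℝ) : InfMatrix V :=
  series (fun n => ENNReal.ofReal (Real.exp (-t) * t ^ n / n.factorial)) A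

theorem heat_apply (A : InfMatrix V) (t : ℝ) (x y : V) : heat A t x y =
    ∑' n : ℕ, ENNReal.ofReal (Real.exp (-t) * t ^ n / n.factorial) * (A ^ n) x y := rfl

theorem measurable_heat (A : InfMatrix V) (x y : V) : Measurable fun t => heat A t x y := by
  simp only [heat_apply]
  refine Measurable.tsum fun n => ?_
  exact Measurable.mul_const (by fun_prop) _

/-- The Poisson weights convolve, by the binomial theorem. -/
theorem heat_add (A : InfMatrix V) {s t : ℝ} (hs : 0 ≤ s) (ht : 0 ≤ t) :
    heat A (s + t) = heat A s * heat A t := by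
  rw [heat, heat, heat, series_mul_series]
  congr 1
  funext n
  have : ∀ ij ∈ Finset.HasAntidiagonal.antidiagonal n,
      ENNReal.ofReal (Real.exp (-s) * s ^ ij.1 / ij.1.factorial) *
        ENNReal.ofReal (Real.exp (-t) * t ^ ij.2 / ij.2.factorial) =
      ENNReal.ofReal (Real.exp (-(s + t)) / n.factorial * (n.choose ij.1 • (s ^ ij.1 * t ^ ij.2)))
      := by
    intro ij hij
    rw [← ENNReal.ofReal_mul (by positivity)]
    congr 1
    have h := Finset.HasAntidiagonal.mem_antidiagonal.1 hij
    have h₂ : ((n.choose ij.1 : ℕ) : ℝ) * ij.1.factorial * ij.2.factorial = n.factorial := by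
      rw [← h, ← Nat.cast_mul, ← Nat.cast_mul, Nat.choose_symm_add,
        Nat.add_choose_mul_factorial_mul_factorial]
    rw [neg_add, Real.exp_add, ← h₂, nsmul_eq_mul]
    have : ((n.choose ij.1 : ℕ) : ℝ) ≠ 0 := by
      rw [Nat.cast_ne_zero]
      exact (Nat.choose_pos (by omega)).ne'
    field_simp
  rw [Finset.sum_congr rfl this, ← ENNReal.ofReal_sum_of_nonneg (fun _ _ => by positivity),
    ← Finset.mul_sum, ← (Commute.all s t).add_pow']
  congr 1
  ring

theorem IsSymm.heat {A : InfMatrix V} (hA : A.IsSymm) (t : ℝ) : (heat A t).IsSymm :=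
  hA.symm_series _

theorem tsum_poisson {t : ℝ} (ht : 0 ≤ t) :
    ∑' n : ℕ, ENNReal.ofReal (Real.exp (-t) * t ^ n / n.factorial) = 1 := by
  have h : HasSum (fun n : ℕ => Real.exp (-t) * t ^ n / n.factorial) 1 := by
    have := (NormedSpace.expSeries_div_hasSum_exp t).mul_left (Real.exp (-t))
    rw [← Real.exp_eq_exp_ℝ, ← Real.exp_add, neg_add_cancel, Real.exp_zero] at this
    simpa [mul_div_assoc] using this
  rw [← ENNReal.ofReal_tsum_of_nonneg (fun n => by positivity) h.summable, h.tsum_eq,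
    ENNReal.ofReal_one]

theorem IsStochastic.heat {A : InfMatrix V} (hA : A.IsStochastic) {t : ℝ} (ht : 0 ≤ t) :
    (heat A t).IsStochastic := fun x => by
  rw [InfMatrix.heat, hA.tsum_series, tsum_poisson ht]

theorem _root_.Real.lintegral_rpow_mul_exp_neg_mul_Ioi {a r : ℝ} (ha : 0 < a) (hr : 0 < r) :
    ∫⁻ t in Set.Ioi (0 : ℝ), ENNReal.ofReal (t ^ (a - 1) * Real.exp (-(r * t))) =
      ENNReal.ofReal ((1 / r) ^ a * Real.Gamma a) := by
  have h := Real.integral_rpow_mul_exp_neg_mul_Ioi ha hr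
  rw [← h, ofReal_integral_eq_lintegral_ofReal]
  · refine Integrable.of_integral_ne_zero ?_
    rw [h]
    have := Real.Gamma_pos_of_pos ha
    positivity
  · filter_upwards [self_mem_ae_restrict measurableSet_Ioi] with t ht
    have : 0 < t := ht
    positivity

theorem _root_.Real.lintegral_pow_mul_exp_neg_mul_Ioi (k : ℕ) {r : ℝ} (hr : 0 < r) :
    ∫⁻ t in Set.Ioi (0 : ℝ), ENNReal.ofReal (t ^ k * Real.exp (-(r * t))) =
      ENNReal.ofReal (k.factorial * (1 / r) ^ (k + 1)) := by
  have h := Real.lintegral_rpow_mul_exp_neg_mul_Ioi (a := k + 1) (by positivity) hr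
  rw [Real.Gamma_nat_eq_factorial] at h
  simp only [add_sub_cancel_right, Real.rpow_natCast] at h
  rw [h, mul_comm]
  norm_cast

/-- Integrating the Poisson weights term by term produces `(n + k)! / n!`, hence the coefficients of
`geom_pow_succ`. This is the bridge from continuous time to resolvents, where laziness can be
compared. -/
theorem lintegral_pow_mul_exp_mul_heat (A : InfMatrix V) (k : ℕ) {s : ℝ} (hs : 0 ≤ s) (x y : V) :
    ∫⁻ t in Set.Ioi (0 : ℝ), ENNReal.ofReal (t ^ k * Real.exp (-(s * t))) * heat A t x y =
      ENNReal.ofReal (k.factorial * (1 / (1 + s)) ^ (k + 1)) *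
        (geom (ENNReal.ofReal (1 / (1 + s))) A ^ (k + 1)) x y := by
  simp only [heat_apply, ← ENNReal.tsum_mul_left, geom_pow_succ, series_apply]
  rw [lintegral_tsum (fun n => by fun_prop)]
  refine tsum_congr fun n => ?_
  have : ∀ t ∈ Set.Ioi (0 : ℝ), ENNReal.ofReal (t ^ k * Real.exp (-(s * t))) *
      (ENNReal.ofReal (Real.exp (-t) * t ^ n / n.factorial) * (A ^ n) x y) =
      ENNReal.ofReal (t ^ (n + k) * Real.exp (-((1 + s) * t))) *
        (ENNReal.ofReal (n.factorial : ℝ)⁻¹ * (A ^ n) x y) := by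
    intro t ht
    have ht : 0 < t := ht
    rw [← mul_assoc, ← mul_assoc, ← ENNReal.ofReal_mul (by positivity),
      ← ENNReal.ofReal_mul (by positivity)]
    congr 2
    rw [add_mul, one_mul, neg_add, Real.exp_add, pow_add]
    field_simp
  rw [setLIntegral_congr_fun measurableSet_Ioi this, lintegral_mul_const _ (by fun_prop),
    Real.lintegral_pow_mul_exp_neg_mul_Ioi _ (by linarith), ← mul_assoc, ← mul_assoc]
  congr 1
  rw [← ENNReal.ofReal_natCast ((n + k).choose k), ← ENNReal.ofReal_pow (by positivity),
    ← ENNReal.ofReal_mul (by positivity), ← ENNReal.ofReal_mul (by positivity),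
    ← ENNReal.ofReal_mul (by positivity)]
  congr 1
  have h : (((n + k).choose k : ℕ) : ℝ) * n.factorial * k.factorial = (n + k).factorial := by
    rw [← Nat.cast_mul, ← Nat.cast_mul,
      Nat.add_choose_mul_factorial_mul_factorial]
  rw [← h]
  field_simp
  ring

theorem lintegral_exp_mul_heat_add [Countable V] (A : InfMatrix V) {t s : ℝ} (ht : 0 ≤ t)
    (hs : 0 ≤ s)
    (x y : V) :
    ∫⁻ u in Set.Ioi (0 : ℝ), ENNReal.ofReal (Real.exp (-(s * u))) * heat A (t + u) x y =
      ∑' z, heat A t x z * (ENNReal.ofReal (1 / (1 + s)) *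
        geom (ENNReal.ofReal (1 / (1 + s))) A z y) := by
  have h : ∀ u ∈ Set.Ioi (0 : ℝ), ENNReal.ofReal (Real.exp (-(s * u))) * heat A (t + u) x y =
      ∑' z, heat A t x z * (ENNReal.ofReal (u ^ 0 * Real.exp (-(s * u))) * heat A u z y) := by
    intro u hu
    rw [heat_add A ht (le_of_lt hu), mul_apply, ← ENNReal.tsum_mul_left]
    exact tsum_congr fun z => by rw [pow_zero, one_mul]; ring
  rw [setLIntegral_congr_fun measurableSet_Ioi h, lintegral_tsum]
  · refine tsum_congr fun z => ?_
    rw [lintegral_const_mul, lintegral_pow_mul_exp_mul_heat A 0 hs]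
    · simp
    · exact Measurable.mul (by fun_prop) (measurable_heat A z y)
  · intro z
    exact (Measurable.const_mul (Measurable.mul (by fun_prop) (measurable_heat A z y))
      _).aemeasurable

/-- Two independent rate-one clocks form a clock of rate two whose rings are assigned to the
coordinates by fair coins. Analytically, `∫ t ^ (i + j) e ^ (-2t) dt` turns `1 / (i! j!)` into a
binomial coefficient over `2 ^ (i + j + 1)`. -/
theorem lintegral_heat_mul_heat (A : InfMatrix V₁) (B : InfMatrix V₂) (x y : V₁ × V₂) :
    ∫⁻ t in Set.Ioi (0 : ℝ), heat A t x.1 y.1 * heat B t x.2 y.2 =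
      ENNReal.ofReal (1 / 2) * geom 1 (scale (ENNReal.ofReal (1 / 2)) (kron A 1 + kron 1 B)) x y
      := by
  have h : ∀ t ∈ Set.Ioi (0 : ℝ), heat A t x.1 y.1 * heat B t x.2 y.2 =
      ∑' i : ℕ, ∑' j : ℕ, ENNReal.ofReal (t ^ (i + j) * Real.exp (-(2 * t))) *
        (ENNReal.ofReal ((i.factorial : ℝ)⁻¹ * (j.factorial : ℝ)⁻¹) *
          ((A ^ i) x.1 y.1 * (B ^ j) x.2 y.2)) := by
    intro t ht
    have ht : 0 < t := ht
    rw [heat_apply, heat_apply, ← ENNReal.tsum_mul_right]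
    refine tsum_congr fun i => ?_
    rw [← ENNReal.tsum_mul_left]
    refine tsum_congr fun j => ?_
    rw [mul_mul_mul_comm, ← mul_assoc (ENNReal.ofReal (t ^ (i + j) * _)),
      ← ENNReal.ofReal_mul (by positivity), ← ENNReal.ofReal_mul (by positivity)]
    congr 2
    rw [two_mul, neg_add, Real.exp_add, pow_add]
    field_simp
  rw [setLIntegral_congr_fun measurableSet_Ioi h,
    lintegral_tsum (fun i => (Measurable.tsum fun j => by fun_prop).aemeasurable)]
  have h' : ∀ i, _ := fun i => lintegral_tsum (μ := volume.restrict (Set.Ioi (0 : ℝ)))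
    (f := fun (j : ℕ) t => ENNReal.ofReal (t ^ (i + j) * Real.exp (-(2 * t))) *
        (ENNReal.ofReal ((i.factorial : ℝ)⁻¹ * (j.factorial : ℝ)⁻¹) *
          ((A ^ i) x.1 y.1 * (B ^ j) x.2 y.2))) (fun j => by fun_prop)
  simp_rw [h']
  rw [geom_apply, ENNReal.tsum_mul_tsum_antidiagonal, ← ENNReal.tsum_mul_left]
  refine tsum_congr fun n => ?_
  rw [one_pow, one_mul, scale_pow, scale_apply, kron_add_pow_apply, Finset.mul_sum, Finset.mul_sum]
  refine Finset.sum_congr rfl fun ij hij => ?_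
  rw [lintegral_mul_const _ (by fun_prop), Real.lintegral_pow_mul_exp_neg_mul_Ioi _ two_pos]
  generalize (A ^ ij.1) x.1 y.1 * (B ^ ij.2) x.2 y.2 = z
  rw [← mul_assoc, ← mul_assoc, ← mul_assoc, ← ENNReal.ofReal_natCast, ← ENNReal.ofReal_pow
    (by norm_num), ← ENNReal.ofReal_mul (by positivity), ← ENNReal.ofReal_mul (by positivity),
    ← ENNReal.ofReal_mul (by positivity)]
  congr 2
  have h := Finset.HasAntidiagonal.mem_antidiagonal.1 hij
  have h₂ : ((n.choose ij.1 : ℕ) : ℝ) * ij.1.factorial * ij.2.factorial = n.factorial := by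
    rw [← h, ← Nat.cast_mul, ← Nat.cast_mul, Nat.choose_symm_add,
        Nat.add_choose_mul_factorial_mul_factorial]
  rw [h, ← h₂]
  field_simp
  ring

end

end InfMatrix

/-! ### Cardinality of balls and tails from discrete heat kernel bounds -/

theorem ENNReal.le_ofReal_div_of_mul_le {u v : ℝ} (hu : 0 < u) {X : ℝ≥0∞}
    (h : ENNReal.ofReal u * X ≤ ENNReal.ofReal v) : X ≤ ENNReal.ofReal (v / u) := by
  rw [ENNReal.ofReal_div_of_pos hu]
  rw [ENNReal.le_div_iff_mul_le (Or.inl (by simpa using hu)) (Or.inl ENNReal.ofReal_ne_top),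
    mul_comm]
  exact h

theorem ENNReal.ofReal_div_le_of_le_mul {u v : ℝ} (hu : 0 < u) {X : ℝ≥0∞}
    (h : ENNReal.ofReal v ≤ ENNReal.ofReal u * X) : ENNReal.ofReal (v / u) ≤ X := by
  rw [ENNReal.ofReal_div_of_pos hu]
  refine ENNReal.div_le_of_le_mul ?_
  rwa [mul_comm]

theorem Real.lintegral_Ioi_rpow_of_lt {p c : ℝ} (hp : p < -1) (hc : 0 < c) :
    ∫⁻ t in Set.Ioi c, ENNReal.ofReal (t ^ p) = ENNReal.ofReal (c ^ (p + 1) / (-(p + 1))) := by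
  rw [← ofReal_integral_eq_lintegral_ofReal (integrableOn_Ioi_rpow_of_lt hp hc),
    integral_Ioi_rpow_of_lt hp hc, neg_div, div_neg]
  filter_upwards [self_mem_ae_restrict measurableSet_Ioi] with t ht
  have : 0 < t := hc.trans ht
  positivity

namespace InfMatrix

noncomputable section

variable {V V₁ V₂ : Type*}

/-- Two-sided heat kernel bounds for the chain `P` of polynomial order `n ^ (-a)`, where `ρ x y` is
the time that the chain needs to get from `x` to `y`. -/
structure PowerBounds (P : InfMatrix V) (ρ : V → V → ℝ) (a : ℝ) : Prop where
  pos : 0 < a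
  stochastic : P.IsStochastic
  rho_self : ∀ x, ρ x x = 0
  rho_nonneg : ∀ x y, 0 ≤ ρ x y
  rho_symm : ∀ x y, ρ x y = ρ y x
  quasi : ∃ K : ℝ, 1 ≤ K ∧ ∀ x y z, ρ x z ≤ K * (ρ x y + ρ y z)
  upper : ∀ b : ℝ, 0 ≤ b → ∃ C : ℝ, 0 < C ∧ ∀ (n : ℕ) (x y : V), 1 ≤ n →
    ENNReal.ofReal (ρ x y ^ b) * (P ^ n) x y ≤ ENNReal.ofReal (C * (n : ℝ) ^ (b - a))
  lower : ∃ c : ℝ, 0 < c ∧ ∀ (n : ℕ) (x y : V), 1 ≤ n → ρ x y ≤ n →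
    ENNReal.ofReal (c * (n : ℝ) ^ (-a)) ≤ (P ^ n) x y + (P ^ (n + 1)) x y

namespace PowerBounds

variable {P : InfMatrix V} {ρ : V → V → ℝ} {a : ℝ}

theorem exists_pow_le (h : PowerBounds P ρ a) : ∃ C : ℝ, 0 < C ∧ ∀ (n : ℕ) (x y : V),
    (P ^ n) x y ≤ ENNReal.ofReal (C * ((n : ℝ) + 1) ^ (-a)) := by
  obtain ⟨C, hC, hb⟩ := h.upper 0 le_rfl
  refine ⟨C * 2 ^ a + 1, by positivity, fun n x y => ?_⟩
  rcases Nat.eq_zero_or_pos n with rfl | hn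
  · refine ((h.stochastic.pow 0).apply_le_one x y).trans ?_
    rw [← ENNReal.ofReal_one]
    refine ENNReal.ofReal_le_ofReal ?_
    simp only [Nat.cast_zero, zero_add, Real.one_rpow, mul_one]
    have : 0 ≤ C * 2 ^ a := by positivity
    linarith
  · have h1 := hb n x y hn
    rw [Real.rpow_zero, ENNReal.ofReal_one, one_mul, zero_sub] at h1
    refine h1.trans (ENNReal.ofReal_le_ofReal ?_)
    have hn' : (1 : ℝ) ≤ n := by exact_mod_cast hn
    have h2 : (n : ℝ) ^ (-a) ≤ 2 ^ a * ((n : ℝ) + 1) ^ (-a) := by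
      rw [Real.rpow_neg (by positivity), Real.rpow_neg (by positivity), ← div_eq_mul_inv,
        le_div_iff₀ (by positivity), inv_mul_le_iff₀ (by positivity),
        ← Real.mul_rpow (by positivity) (by positivity)]
      exact Real.rpow_le_rpow (by positivity) (by linarith) h.pos.le
    calc C * (n : ℝ) ^ (-a) ≤ C * (2 ^ a * ((n : ℝ) + 1) ^ (-a)) := by gcongr
      _ ≤ (C * 2 ^ a + 1) * ((n : ℝ) + 1) ^ (-a) := by
        have : 0 ≤ ((n : ℝ) + 1) ^ (-a) := by positivity
        nlinarith

/-- The number of points of a ball. -/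
def ballCard (ρ : V → V → ℝ) (x : V) (R : ℝ) : ℝ≥0∞ := ∑' y, Set.indicator {y | ρ x y ≤ R} 1 y

/-- At `n = ⌈R⌉`, each point of the ball carries mass at least `c n ^ (-a)` at times `n` and `n + 1`
together, and the total mass is two. -/
theorem ballCard_upper (h : PowerBounds P ρ a) : ∃ C : ℝ, 0 < C ∧ ∀ (x : V) (R : ℝ), 1 ≤ R →
    ballCard ρ x R ≤ ENNReal.ofReal (C * R ^ a) := by
  obtain ⟨c, hc, hl⟩ := h.lower
  refine ⟨2 / c * 2 ^ a, by positivity, fun x R hR => ?_⟩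
  have hRn : R ≤ (⌈R⌉₊ : ℝ) := Nat.le_ceil R
  have hnR : (⌈R⌉₊ : ℝ) ≤ 2 * R := by
    have := Nat.ceil_lt_add_one (zero_le_one.trans hR)
    linarith
  have hn : 1 ≤ ⌈R⌉₊ := Nat.one_le_ceil_iff.2 (by linarith)
  generalize ⌈R⌉₊ = n at *
  have hn0 : (0 : ℝ) < n := by exact_mod_cast hn
  have h1 : ENNReal.ofReal (c * (n : ℝ) ^ (-a)) * ballCard ρ x R ≤ ENNReal.ofReal 2 := by
    rw [ballCard, ← ENNReal.tsum_mul_left]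
    calc ∑' y, ENNReal.ofReal (c * (n : ℝ) ^ (-a)) * Set.indicator {y | ρ x y ≤ R} 1 y
        ≤ ∑' y, ((P ^ n) x y + (P ^ (n + 1)) x y) := by
          refine ENNReal.tsum_le_tsum fun y => ?_
          by_cases hy : ρ x y ≤ R
          · simpa [hy] using hl n x y hn (hy.trans hRn)
          · simp [hy]
      _ = ENNReal.ofReal 2 := by
          rw [ENNReal.tsum_add, h.stochastic.pow n x, h.stochastic.pow (n + 1) x]
          norm_num
  refine (ENNReal.le_ofReal_div_of_mul_le (by positivity) h1).trans (ENNReal.ofReal_le_ofReal ?_)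
  rw [Real.rpow_neg hn0.le, mul_assoc, ← Real.mul_rpow (by norm_num) (by linarith)]
  calc 2 / (c * ((n : ℝ) ^ a)⁻¹) = 2 / c * (n : ℝ) ^ a := by field_simp
    _ ≤ 2 / c * (2 * R) ^ a := by
      have := Real.rpow_le_rpow hn0.le hnR h.pos.le
      gcongr

/-- Layer-cake formula: `ρ ^ (-(a + 1))` is the integral of `(a + 1) u ^ (-a - 2)` over `u > ρ`.
Exchanging sum and integral and counting balls leaves `∫ u ^ (-2)` beyond `R`. -/
theorem tsum_rpow_le [Countable V] (h : PowerBounds P ρ a) :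
    ∃ C : ℝ, 0 < C ∧ ∀ (x : V) (R : ℝ), 1 ≤ R →
    ∑' y, Set.indicator {y | R < ρ x y} (fun y => ENNReal.ofReal (ρ x y ^ (-(a + 1)))) y ≤
      ENNReal.ofReal (C / R) := by
  obtain ⟨C, hC, hN⟩ := h.ballCard_upper
  have ha := h.pos
  refine ⟨(a + 1) * C, by positivity, fun x R hR => ?_⟩
  have hR0 : 0 < R := by linarith
  have hlayer : ∀ y, Set.indicator {y | R < ρ x y} (fun y => ENNReal.ofReal (ρ x y ^ (-(a + 1)))) y
      ≤ ∫⁻ u in Set.Ioi R, ENNReal.ofReal ((a + 1) * u ^ (-(a + 1) - 1)) *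
        Set.indicator (Set.Ici (ρ x y)) 1 u := by
    intro y
    by_cases hy : R < ρ x y
    · have hy0 : 0 < ρ x y := hR0.trans hy
      have h1 := Real.lintegral_Ioi_rpow_of_lt (p := -(a + 1) - 1) (by linarith) hy0
      calc Set.indicator {y | R < ρ x y} (fun y => ENNReal.ofReal (ρ x y ^ (-(a + 1)))) y
          = ENNReal.ofReal (a + 1) * ∫⁻ u in Set.Ioi (ρ x y),
              ENNReal.ofReal (u ^ (-(a + 1) - 1)) := by
            rw [h1, ← ENNReal.ofReal_mul (by positivity)]
            simp only [Set.mem_ofPred_eq, hy, Set.indicator_of_mem]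
            congr 1
            rw [sub_add_cancel, neg_neg]
            field_simp
        _ = ∫⁻ u in Set.Ioi (ρ x y), ENNReal.ofReal ((a + 1) * u ^ (-(a + 1) - 1)) *
              Set.indicator (Set.Ici (ρ x y)) 1 u := by
            rw [← lintegral_const_mul _ (by fun_prop)]
            refine setLIntegral_congr_fun measurableSet_Ioi fun u hu => ?_
            have : u ∈ Set.Ici (ρ x y) := Set.mem_Ici.2 (Set.mem_Ioi.1 hu).le
            simp only [this, Set.indicator_of_mem, Pi.one_apply, mul_one]
            rw [ENNReal.ofReal_mul (by positivity)]
        _ ≤ _ := lintegral_mono_set (Set.Ioi_subset_Ioi hy.le)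
    · simp [hy]
  calc ∑' y, Set.indicator {y | R < ρ x y} (fun y => ENNReal.ofReal (ρ x y ^ (-(a + 1)))) y
      ≤ ∑' y, ∫⁻ u in Set.Ioi R, ENNReal.ofReal ((a + 1) * u ^ (-(a + 1) - 1)) *
        Set.indicator (Set.Ici (ρ x y)) 1 u := ENNReal.tsum_le_tsum hlayer
    _ = ∫⁻ u in Set.Ioi R, ∑' y, ENNReal.ofReal ((a + 1) * u ^ (-(a + 1) - 1)) *
        Set.indicator (Set.Ici (ρ x y)) 1 u := by
        rw [lintegral_tsum]
        intro y
        refine (Measurable.mul (by fun_prop) ?_).aemeasurable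
        exact measurable_one.indicator measurableSet_Ici
    _ ≤ ∫⁻ u in Set.Ioi R, ENNReal.ofReal ((a + 1) * C) * ENNReal.ofReal (u ^ (-2 : ℝ)) := by
        refine setLIntegral_mono (by fun_prop) fun u hu => ?_
        have hu : R < u := hu
        have hu0 : 0 < u := hR0.trans hu
        rw [ENNReal.tsum_mul_left]
        have h2 : ∑' y, Set.indicator (Set.Ici (ρ x y)) 1 u = ballCard ρ x u := by
          refine tsum_congr fun y => ?_
          by_cases hy : ρ x y ≤ u <;> simp [hy]
        rw [h2]
        refine (mul_le_mul' le_rfl (hN x u (by linarith))).trans ?_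
        rw [← ENNReal.ofReal_mul (by positivity), ← ENNReal.ofReal_mul (by positivity)]
        refine le_of_eq (congrArg _ ?_)
        have : u ^ (-(a + 1) - 1) * u ^ a = u ^ (-2 : ℝ) := by
          rw [← Real.rpow_add hu0]
          congr 1
          ring
        rw [← this]
        ring
    _ = _ := by
        rw [lintegral_const_mul _ (by fun_prop), Real.lintegral_Ioi_rpow_of_lt (by norm_num) hR0,
          ← ENNReal.ofReal_mul (by positivity)]
        congr 1
        norm_num [Real.rpow_neg_one]
        field_simp

/-- The moment of order `a + 1` is chosen so that the bound on `P ^ n` is linear in `n` and summable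
over space. -/
theorem tail_le [Countable V] (h : PowerBounds P ρ a) :
    ∃ C : ℝ, 0 < C ∧ ∀ (n : ℕ) (x : V) (R : ℝ), 1 ≤ R →
    ∑' y, Set.indicator {y | R < ρ x y} (fun y => (P ^ n) x y) y ≤
      ENNReal.ofReal (C * n / R) := by
  obtain ⟨C₁, hC₁, h₁⟩ := h.tsum_rpow_le
  obtain ⟨C₂, hC₂, h₂⟩ := h.upper (a + 1) (by linarith [h.pos])
  refine ⟨C₂ * C₁, by positivity, fun n x R hR => ?_⟩
  have hR0 : 0 < R := by linarith
  rcases Nat.eq_zero_or_pos n with rfl | hn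
  · refine le_of_eq_of_le (ENNReal.tsum_eq_zero.2 fun y => ?_) zero_le
    by_cases hy : R < ρ x y
    · have : x ≠ y := by
        rintro rfl
        rw [h.rho_self] at hy
        linarith
      simp [one_apply_ne this]
    · simp [hy]
  · calc ∑' y, Set.indicator {y | R < ρ x y} (fun y => (P ^ n) x y) y
        ≤ ∑' y, ENNReal.ofReal (C₂ * n) *
          Set.indicator {y | R < ρ x y} (fun y => ENNReal.ofReal (ρ x y ^ (-(a + 1)))) y := by
          refine ENNReal.tsum_le_tsum fun y => ?_
          by_cases hy : R < ρ x y
          · have hy0 : 0 < ρ x y := hR0.trans hy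
            have h3 := h₂ n x y hn
            simp only [add_sub_cancel_left, Real.rpow_one] at h3
            have h4 := ENNReal.le_ofReal_div_of_mul_le (by positivity) h3
            simp only [Set.mem_ofPred_eq, hy, Set.indicator_of_mem]
            rw [← ENNReal.ofReal_mul (by positivity), Real.rpow_neg hy0.le, ← div_eq_mul_inv]
            exact h4
          · simp [hy]
      _ ≤ ENNReal.ofReal (C₂ * n) * ENNReal.ofReal (C₁ / R) := by
          rw [ENNReal.tsum_mul_left]
          gcongr
          exact h₁ x R hR
      _ = _ := by
          rw [← ENNReal.ofReal_mul (by positivity)]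
          congr 1
          field_simp

/-- At time `⌊R / (2 C₂)⌋` at least half of the mass is still in the ball, while no point carries
more than `C₁ (n + 1) ^ (-a)`. For small `R` the centre alone suffices. -/
theorem ballCard_lower [Countable V] (h : PowerBounds P ρ a) :
    ∃ c : ℝ, 0 < c ∧ ∀ (x : V) (R : ℝ), 1 ≤ R →
    ENNReal.ofReal (c * R ^ a) ≤ ballCard ρ x R := by
  obtain ⟨C₁, hC₁, h₁⟩ := h.exists_pow_le
  obtain ⟨C₂, hC₂, h₂⟩ := h.tail_le
  refine ⟨min ((1 / (2 * C₁)) * (1 / (2 * C₂)) ^ a) ((1 / (2 * C₂)) ^ a), by positivity,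
    fun x R hR => ?_⟩
  have hR0 : 0 < R := by linarith
  rcases lt_or_ge R (2 * C₂) with hlt | hge
  · calc ENNReal.ofReal (_ * R ^ a) ≤ ENNReal.ofReal ((1 / (2 * C₂)) ^ a * R ^ a) := by
          gcongr
          exact min_le_right _ _
      _ ≤ 1 := by
          rw [← Real.mul_rpow (by positivity) hR0.le, ENNReal.ofReal_le_one]
          refine Real.rpow_le_one (by positivity) ?_ h.pos.le
          rw [one_div_mul_eq_div, div_le_one (by positivity)]
          exact hlt.le
      _ ≤ ballCard ρ x R := by
          refine le_trans ?_ (ENNReal.le_tsum x)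
          have : x ∈ {y | ρ x y ≤ R} := by
            simp only [Set.mem_ofPred_eq, h.rho_self]; exact hR0.le
          rw [Set.indicator_of_mem this, Pi.one_apply]
  · set n := ⌊R / (2 * C₂)⌋₊ with hn
    have hq : 1 ≤ R / (2 * C₂) := by rwa [one_le_div (by positivity)]
    have hnR : (n : ℝ) ≤ R / (2 * C₂) := Nat.floor_le (by positivity)
    have hRn : R / (2 * C₂) ≤ (n : ℝ) + 1 := (Nat.lt_floor_add_one _).le
    have htail : ∑' y, Set.indicator {y | R < ρ x y} (fun y => (P ^ n) x y) y ≤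
        ENNReal.ofReal (1 / 2) := by
      refine (h₂ n x R hR).trans (ENNReal.ofReal_le_ofReal ?_)
      rw [le_div_iff₀ (by positivity)] at hnR
      rw [div_le_div_iff₀ hR0 two_pos]
      linarith
    have hball : ∑' y, Set.indicator {y | ρ x y ≤ R} (fun y => (P ^ n) x y) y ≤
        ENNReal.ofReal (C₁ * ((n : ℝ) + 1) ^ (-a)) * ballCard ρ x R := by
      rw [ballCard, ← ENNReal.tsum_mul_left]
      refine ENNReal.tsum_le_tsum fun y => ?_
      by_cases hy : ρ x y ≤ R
      · simpa [hy] using h₁ n x y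
      · simp [hy]
    have hsum : ENNReal.ofReal (1 / 2) + ENNReal.ofReal (1 / 2) ≤
        ENNReal.ofReal (C₁ * ((n : ℝ) + 1) ^ (-a)) * ballCard ρ x R + ENNReal.ofReal (1 / 2) := by
      calc ENNReal.ofReal (1 / 2) + ENNReal.ofReal (1 / 2) = 1 := by
            rw [← ENNReal.ofReal_add (by norm_num) (by norm_num)]
            norm_num
        _ = ∑' y, (P ^ n) x y := (h.stochastic.pow n x).symm
        _ = ∑' y, (Set.indicator {y | ρ x y ≤ R} (fun y => (P ^ n) x y) y +
            Set.indicator {y | R < ρ x y} (fun y => (P ^ n) x y) y) := by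
            refine tsum_congr fun y => ?_
            by_cases hy : ρ x y ≤ R
            · simp [hy, not_lt.2 hy]
            · simp [hy, not_le.1 hy]
        _ ≤ _ := by
            rw [ENNReal.tsum_add]
            gcongr
    have h3 := ENNReal.ofReal_div_le_of_le_mul (by positivity)
      ((ENNReal.add_le_add_iff_right ENNReal.ofReal_ne_top).1 hsum)
    refine le_trans (ENNReal.ofReal_le_ofReal ?_) h3
    calc _ ≤ 1 / (2 * C₁) * (1 / (2 * C₂)) ^ a * R ^ a := by
          gcongr
          exact min_le_left _ _
      _ = 1 / (2 * C₁) * (R / (2 * C₂)) ^ a := by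
          rw [mul_assoc, ← Real.mul_rpow (by positivity) hR0.le]
          congr 2
          ring
      _ ≤ 1 / (2 * C₁) * ((n : ℝ) + 1) ^ a := by
          have := Real.rpow_le_rpow (by positivity) hRn h.pos.le
          gcongr
      _ = 1 / 2 / (C₁ * ((n : ℝ) + 1) ^ (-a)) := by
          rw [Real.rpow_neg (by positivity)]
          field_simp

end PowerBounds

end

end InfMatrix

/-! ### Laplace transforms of the lazy semigroup -/

namespace InfMatrix

noncomputable section

variable {V V₁ V₂ : Type*}

/-- The lazy chain `(1 - ℓ) + ℓ P` is symmetric, and `ℓ` is bounded away from zero. -/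
structure Reversible (P : InfMatrix V) (ℓ : V → ℝ) : Prop where
  exists_le : ∃ c : ℝ, 0 < c ∧ ∀ x, c ≤ ℓ x
  le_one : ∀ x, ℓ x ≤ 1
  symm : (lazy ℓ P).IsSymm

theorem Reversible.pos {P : InfMatrix V} {ℓ : V → ℝ} (hℓ : Reversible P ℓ) (x : V) : 0 < ℓ x := by
  obtain ⟨c, hc, hcl⟩ := hℓ.exists_le
  exact hc.trans_le (hcl x)

namespace PowerBounds

variable {P : InfMatrix V} {ρ : V → V → ℝ} {a : ℝ} {ℓ : V → ℝ}

/-- The first term covers `n + 1 ≤ T`, where `n ^ (k - a)` is increasing because `a ≤ k`; the second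
covers later times. Both sum exactly against geometric weights. -/
theorem choose_mul_rpow_le (ha : 0 ≤ a) (k : ℕ) (hk : a ≤ k) (n : ℕ) {T : ℝ} (hT : 1 ≤ T) :
    ((n + k).choose k : ℝ) * ((n : ℝ) + 1) ^ (-a) ≤
      ((k : ℝ) + 1) ^ k * T ^ ((k : ℝ) - a) + T ^ (-a) * ((n + k).choose k : ℝ) := by
  have hT0 : 0 < T := by linarith
  have hch : ((n + k).choose k : ℝ) ≤ ((k : ℝ) + 1) ^ k * ((n : ℝ) + 1) ^ k := by
    have h1 := Nat.choose_le_pow_div (α := ℝ) k (n + k)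
    refine h1.trans ((div_le_self (by positivity) ?_).trans ?_)
    · exact_mod_cast Nat.one_le_iff_ne_zero.2 k.factorial_ne_zero
    · rw [← mul_pow]
      gcongr
      push_cast
      nlinarith [(Nat.cast_nonneg n : (0 : ℝ) ≤ n), (Nat.cast_nonneg k : (0 : ℝ) ≤ k)]
  rcases le_total ((n : ℝ) + 1) T with hn | hn
  · refine le_add_of_le_of_nonneg ?_ (by positivity)
    calc ((n + k).choose k : ℝ) * ((n : ℝ) + 1) ^ (-a)
        ≤ ((k : ℝ) + 1) ^ k * ((n : ℝ) + 1) ^ k * ((n : ℝ) + 1) ^ (-a) := by gcongr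
      _ = ((k : ℝ) + 1) ^ k * ((n : ℝ) + 1) ^ ((k : ℝ) - a) := by
        rw [mul_assoc, ← Real.rpow_natCast ((n : ℝ) + 1) k, ← Real.rpow_add (by positivity),
          sub_eq_add_neg]
      _ ≤ _ := by
        have := Real.rpow_le_rpow (by positivity) hn (sub_nonneg.2 hk)
        gcongr
  · refine le_add_of_nonneg_of_le (by positivity) ?_
    rw [mul_comm]
    have := Real.rpow_le_rpow_of_nonpos hT0 hn (neg_nonpos.2 ha)
    gcongr

theorem tsum_choose_mul_pow {T : ℝ} (hT : 0 < T) (k : ℕ) :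
    ∑' n : ℕ, ENNReal.ofReal (((n + k).choose k : ℝ) * (T / (1 + T)) ^ n) =
      ENNReal.ofReal ((1 + T) ^ (k + 1)) := by
  have hθ : ‖T / (1 + T)‖ < 1 := by
    rw [Real.norm_of_nonneg (by positivity), div_lt_one (by positivity)]
    linarith
  have h := hasSum_choose_mul_geometric_of_norm_lt_one k hθ
  rw [← ENNReal.ofReal_tsum_of_nonneg (fun n => by positivity) h.summable, h.tsum_eq]
  congr 1
  have : 1 - T / (1 + T) = 1 / (1 + T) := by field_simp; ring
  rw [this, one_div_pow, one_div_one_div]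

/-- The extra weight `n ^ k` with `k ≥ a` makes times of order `T` dominate; without it, small times
would dominate when `a > 1`. -/
theorem geom_pow_succ_le (h : PowerBounds P ρ a) (k : ℕ) (hk : a ≤ k) :
    ∃ C : ℝ, 0 < C ∧ ∀ (T : ℝ) (x y : V), 1 ≤ T →
      (geom (ENNReal.ofReal (T / (1 + T))) P ^ (k + 1)) x y ≤
        ENNReal.ofReal (C * T ^ ((k : ℝ) + 1 - a)) := by
  obtain ⟨C, hC, hb⟩ := h.exists_pow_le
  refine ⟨C * (((k : ℝ) + 1) ^ k * 2 + 2 ^ (k + 1)), by positivity, fun T x y hT => ?_⟩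
  have hT0 : 0 < T := by linarith
  rw [geom_pow_succ, series_apply]
  calc ∑' n : ℕ, ((n + k).choose k : ℝ≥0∞) * ENNReal.ofReal (T / (1 + T)) ^ n * (P ^ n) x y
      ≤ ∑' n : ℕ, (ENNReal.ofReal (C * (((k : ℝ) + 1) ^ k * T ^ ((k : ℝ) - a))) *
          ENNReal.ofReal (((n + 0).choose 0 : ℝ) * (T / (1 + T)) ^ n) +
          ENNReal.ofReal (C * T ^ (-a)) *
          ENNReal.ofReal (((n + k).choose k : ℝ) * (T / (1 + T)) ^ n)) := by
        refine ENNReal.tsum_le_tsum fun n => ?_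
        rw [← ENNReal.ofReal_natCast, ← ENNReal.ofReal_pow (by positivity),
          ← ENNReal.ofReal_mul (by positivity), ← ENNReal.ofReal_mul (by positivity),
          ← ENNReal.ofReal_mul (by positivity), ← ENNReal.ofReal_add (by positivity)
          (by positivity)]
        refine (mul_le_mul' le_rfl (hb n x y)).trans ?_
        rw [← ENNReal.ofReal_mul (by positivity)]
        refine ENNReal.ofReal_le_ofReal ?_
        have h1 := choose_mul_rpow_le h.pos.le k hk n hT
        have h2 : 0 ≤ C * (T / (1 + T)) ^ n := by positivity
        simp only [add_zero, Nat.choose_zero_right, Nat.cast_one, one_mul]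
        nlinarith [mul_le_mul_of_nonneg_left h1 h2]
    _ = ENNReal.ofReal (C * (((k : ℝ) + 1) ^ k * T ^ ((k : ℝ) - a)) * (1 + T) ^ (0 + 1) +
          C * T ^ (-a) * (1 + T) ^ (k + 1)) := by
        rw [ENNReal.tsum_add, ENNReal.tsum_mul_left, ENNReal.tsum_mul_left,
          tsum_choose_mul_pow hT0, tsum_choose_mul_pow hT0, ← ENNReal.ofReal_mul (by positivity),
          ← ENNReal.ofReal_mul (by positivity), ← ENNReal.ofReal_add (by positivity)
          (by positivity)]
    _ ≤ _ := by
        refine ENNReal.ofReal_le_ofReal ?_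
        have e1 : T ^ ((k : ℝ) + 1 - a) = T ^ ((k : ℝ) - a) * T := by
          rw [← Real.rpow_add_one hT0.ne']
          congr 1; ring
        have e2 : T ^ ((k : ℝ) + 1 - a) = T ^ (-a) * T ^ (k + 1) := by
          rw [← Real.rpow_natCast T (k + 1), ← Real.rpow_add hT0]
          congr 1; push_cast; ring
        have h2T : 1 + T ≤ 2 * T := by linarith
        have h₁ : C * (((k : ℝ) + 1) ^ k * T ^ ((k : ℝ) - a)) * (1 + T) ^ (0 + 1) ≤
            C * (((k : ℝ) + 1) ^ k * 2) * T ^ ((k : ℝ) + 1 - a) := by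
          rw [e1, zero_add, pow_one]
          calc C * (((k : ℝ) + 1) ^ k * T ^ ((k : ℝ) - a)) * (1 + T)
              ≤ C * (((k : ℝ) + 1) ^ k * T ^ ((k : ℝ) - a)) * (2 * T) := by gcongr
            _ = _ := by ring
        have h₂ : C * T ^ (-a) * (1 + T) ^ (k + 1) ≤
            C * 2 ^ (k + 1) * T ^ ((k : ℝ) + 1 - a) := by
          rw [e2]
          calc C * T ^ (-a) * (1 + T) ^ (k + 1) ≤ C * T ^ (-a) * (2 * T) ^ (k + 1) := by gcongr
            _ = _ := by rw [mul_pow]; ring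
        rw [mul_add, add_mul]
        exact add_le_add h₁ h₂

/-- Times between `N = ⌈κ T⌉` and `2 N + 1` suffice. The parameter `b T` anticipates the loss of
scale in `geom_le_geom_lazy`. -/
theorem le_geom_pow_succ (h : PowerBounds P ρ a) (k : ℕ) {κ : ℝ} (hκ : 1 ≤ κ) {b : ℝ}
    (hb : 0 < b) :
    ∃ c : ℝ, 0 < c ∧ ∀ (T : ℝ) (x y : V), 1 ≤ T → ρ x y ≤ κ * T →
      ENNReal.ofReal (c * T ^ ((k : ℝ) + 1 - a)) ≤
        (geom (ENNReal.ofReal (b * T / (1 + b * T))) P ^ (k + 1)) x y := by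
  obtain ⟨c, hc, hl⟩ := h.lower
  have ha := h.pos
  refine ⟨(κ ^ k / k.factorial) * Real.exp (-(5 * κ / b)) * (c * (4 * κ) ^ (-a)) * κ / 2,
    by positivity, fun T x y hT hxy => ?_⟩
  have hT0 : 0 < T := by linarith
  have hκT : 1 ≤ κ * T := by nlinarith
  rw [geom_pow_succ, series_apply]
  set N := ⌈κ * T⌉₊ with hN
  have hN1 : κ * T ≤ (N : ℝ) := Nat.le_ceil _
  have hN2 : (N : ℝ) ≤ 2 * (κ * T) := by
    have := Nat.ceil_lt_add_one (zero_le_one.trans hκT)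
    linarith
  have hNpos : 1 ≤ N := Nat.one_le_ceil_iff.2 (by linarith)
  -- Here `w` bounds the coefficients from below: `n ≤ 2 N + 1 ≤ 5 κ T`, and `b T / (1 + b T) ≥ exp
  -- (-1 / (b T))`.
  set w : ℝ := (κ ^ k / k.factorial) * Real.exp (-(5 * κ / b)) * T ^ k with hw
  set v : ℝ := c * (4 * κ * T) ^ (-a) with hv
  have hcoef : ∀ n : ℕ, N ≤ n → n ≤ 2 * N + 1 → ENNReal.ofReal w ≤
      ((n + k).choose k : ℝ≥0∞) * ENNReal.ofReal (b * T / (1 + b * T)) ^ n := by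
    intro n hn hn'
    rw [← ENNReal.ofReal_natCast, ← ENNReal.ofReal_pow (by positivity),
      ← ENNReal.ofReal_mul (by positivity)]
    refine ENNReal.ofReal_le_ofReal ?_
    have h1 : (κ * T) ^ k / k.factorial ≤ ((n + k).choose k : ℝ) := by
      rw [div_le_iff₀ (by positivity)]
      have h2 : (n + 1) ^ k ≤ (n + k).choose k * k.factorial := by
        rw [mul_comm, ← Nat.ascFactorial_eq_factorial_mul_choose]
        exact Nat.pow_succ_le_ascFactorial _ _
      have h3 : ((n : ℝ) + 1) ^ k ≤ (n + k).choose k * k.factorial := by exact_mod_cast h2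
      refine le_trans ?_ h3
      have : (N : ℝ) ≤ n := by exact_mod_cast hn
      gcongr
      linarith
    have h2 : Real.exp (-(5 * κ / b)) ≤ (b * T / (1 + b * T)) ^ n := by
      have h3 : Real.exp (-(1 / (b * T))) ≤ b * T / (1 + b * T) := by
        rw [Real.exp_neg, inv_le_comm₀ (Real.exp_pos _) (by positivity), inv_div]
        have := Real.add_one_le_exp (1 / (b * T))
        refine le_trans (le_of_eq ?_) this
        field_simp
      calc Real.exp (-(5 * κ / b)) ≤ Real.exp (-(1 / (b * T))) ^ n := by
            rw [← Real.exp_nat_mul]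
            refine Real.exp_le_exp.2 ?_
            rw [mul_neg, neg_le_neg_iff, mul_one_div, div_le_div_iff₀ (by positivity) hb]
            have h4 : (n : ℝ) ≤ 2 * N + 1 := by exact_mod_cast hn'
            have h5 : (n : ℝ) ≤ 5 * κ * T := by linarith
            nlinarith
        _ ≤ _ := pow_le_pow_left₀ (Real.exp_pos _).le h3 n
    calc w = (κ * T) ^ k / k.factorial * Real.exp (-(5 * κ / b)) := by
          rw [hw, mul_pow]; ring
      _ ≤ _ := by gcongr
  have hpow : ∀ n : ℕ, N ≤ n → n ≤ 2 * N → ENNReal.ofReal v ≤ (P ^ n) x y + (P ^ (n + 1)) x y := by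
    intro n hn hn'
    have h1 : (N : ℝ) ≤ n := by exact_mod_cast hn
    have h2 : (n : ℝ) ≤ 2 * N := by exact_mod_cast hn'
    refine le_trans (ENNReal.ofReal_le_ofReal ?_) (hl n x y (hNpos.trans hn) (by linarith))
    rw [hv]
    have := Real.rpow_le_rpow_of_nonpos (x := (n : ℝ)) (y := 4 * κ * T) (by linarith) (by linarith)
      (neg_nonpos.2 ha.le)
    gcongr
  set f : ℕ → ℝ≥0∞ := fun n => ((n + k).choose k : ℝ≥0∞) *
    ENNReal.ofReal (b * T / (1 + b * T)) ^ n * (P ^ n) x y with hf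
  -- The lower bound concerns two consecutive times together, because of parity; each term of the
  -- series is therefore used at most twice.
  have hsum : ∑ i ∈ Finset.range (N + 1), ENNReal.ofReal (w * v) ≤ ∑' n, f n + ∑' n, f n := by
    calc ∑ i ∈ Finset.range (N + 1), ENNReal.ofReal (w * v)
        ≤ ∑ i ∈ Finset.range (N + 1), (f (i + N) + f (i + (N + 1))) := by
          refine Finset.sum_le_sum fun i hi => ?_
          have hi : i < N + 1 := Finset.mem_range.1 hi
          rw [ENNReal.ofReal_mul (by positivity)]
          refine (mul_le_mul' le_rfl (hpow (i + N) (by omega) (by omega))).trans ?_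
          rw [mul_add]
          gcongr
          · exact mul_le_mul' (hcoef _ (by omega) (by omega)) le_rfl
          · exact mul_le_mul' (hcoef (i + (N + 1)) (by omega) (by omega)) le_rfl
      _ ≤ ∑' i, f (i + N) + ∑' i, f (i + (N + 1)) := by
          rw [Finset.sum_add_distrib]
          exact add_le_add (ENNReal.sum_le_tsum _) (ENNReal.sum_le_tsum _)
      _ ≤ _ := add_le_add (ENNReal.tsum_comp_le_tsum_of_injective (add_left_injective _) f)
          (ENNReal.tsum_comp_le_tsum_of_injective (add_left_injective _) f)
  rw [Finset.sum_const, Finset.card_range, nsmul_eq_mul, ← two_mul, ← ENNReal.ofReal_natCast,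
    ← ENNReal.ofReal_mul (by positivity)] at hsum
  have h2 : (2 : ℝ≥0∞) = ENNReal.ofReal 2 := by norm_num
  rw [h2] at hsum
  refine le_trans (ENNReal.ofReal_le_ofReal ?_) (ENNReal.ofReal_div_le_of_le_mul two_pos hsum)
  have e1 : T ^ ((k : ℝ) + 1 - a) = T ^ k * T * T ^ (-a) := by
    rw [← pow_succ, ← Real.rpow_natCast T (k + 1), ← Real.rpow_add hT0]
    congr 1; push_cast; ring
  rw [e1, hv, hw, Real.mul_rpow (by positivity) hT0.le]
  push_cast
  rw [div_mul_eq_mul_div]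
  gcongr ?_ / 2
  calc _ = (κ * T) * (κ ^ k / k.factorial * Real.exp (-(5 * κ / b)) * T ^ k *
        (c * ((4 * κ) ^ (-a) * T ^ (-a)))) := by ring
    _ ≤ _ := by
      gcongr
      linarith

theorem laplace_upper (h : PowerBounds P ρ a) (hℓ : Reversible P ℓ) (k : ℕ) (hk : a ≤ k) :
    ∃ C : ℝ, 0 < C ∧ ∀ (T : ℝ) (x y : V), 1 ≤ T →
      ∫⁻ t in Set.Ioi (0 : ℝ), ENNReal.ofReal (t ^ k * Real.exp (-(T⁻¹ * t))) *
        heat (lazy ℓ P) t x y ≤ ENNReal.ofReal (C * T ^ ((k : ℝ) + 1 - a)) := by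
  obtain ⟨C, hC, hb⟩ := h.geom_pow_succ_le k hk
  obtain ⟨c, hc, hcl⟩ := hℓ.exists_le
  refine ⟨k.factorial * (c⁻¹ ^ (k + 1) * C), by positivity, fun T x y hT => ?_⟩
  have hT0 : 0 < T := by linarith
  have hθ : 1 / (1 + T⁻¹) = T / (1 + T) := by field_simp; ring
  have hθ1 : T / (1 + T) ≤ 1 := by rw [div_le_one (by positivity)]; linarith
  rw [lintegral_pow_mul_exp_mul_heat _ _ (by positivity), hθ]
  have h1 : (geom (ENNReal.ofReal (T / (1 + T))) (lazy ℓ P) ^ (k + 1)) x y ≤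
      ENNReal.ofReal (c⁻¹ ^ (k + 1)) * (geom (ENNReal.ofReal (T / (1 + T))) P ^ (k + 1)) x y := by
    rw [ENNReal.ofReal_pow (by positivity), ← scale_apply, ← scale_pow]
    refine pow_le_pow_apply (fun x y => ?_) _ x y
    exact geom_lazy_le hc hcl hℓ.le_one (ENNReal.ofReal_le_one.2 hθ1) x y
  calc _ ≤ ENNReal.ofReal (k.factorial * 1 ^ (k + 1)) * (ENNReal.ofReal (c⁻¹ ^ (k + 1)) *
        ENNReal.ofReal (C * T ^ ((k : ℝ) + 1 - a))) := by
        refine mul_le_mul' ?_ (h1.trans (mul_le_mul' le_rfl (hb T x y hT)))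
        gcongr
    _ = _ := by
        rw [one_pow, mul_one, ← ENNReal.ofReal_mul (by positivity),
          ← ENNReal.ofReal_mul (by positivity)]
        congr 1
        ring

theorem laplace_lower (h : PowerBounds P ρ a) (hℓ : Reversible P ℓ) (k : ℕ) {κ : ℝ}
    (hκ : 1 ≤ κ) :
    ∃ c : ℝ, 0 < c ∧ ∀ (T : ℝ) (x y : V), 1 ≤ T → ρ x y ≤ κ * T →
      ENNReal.ofReal (c * T ^ ((k : ℝ) + 1 - a)) ≤
      ∫⁻ t in Set.Ioi (0 : ℝ), ENNReal.ofReal (t ^ k * Real.exp (-(T⁻¹ * t))) *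
        heat (lazy ℓ P) t x y := by
  obtain ⟨b, hb, hbl⟩ := hℓ.exists_le
  obtain ⟨c, hc, hl⟩ := h.le_geom_pow_succ k hκ hb
  refine ⟨(1 / 2) ^ (k + 1) * c, by positivity, fun T x y hT hxy => ?_⟩
  have hT0 : 0 < T := by linarith
  have hθ : 1 / (1 + T⁻¹) = T / (1 + T) := by field_simp; ring
  have hθ1 : T / (1 + T) ≤ 1 := by rw [div_le_one (by positivity)]; linarith
  have hθ2 : 1 / 2 ≤ T / (1 + T) := by
    rw [div_le_div_iff₀ two_pos (by positivity)]; linarith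
  rw [lintegral_pow_mul_exp_mul_heat _ _ (by positivity), hθ, mul_assoc,
    ENNReal.ofReal_mul (by positivity)]
  refine mul_le_mul' (ENNReal.ofReal_le_ofReal ?_) ((hl T x y hT hxy).trans ?_)
  · refine (pow_le_pow_left₀ (by norm_num) hθ2 _).trans (le_mul_of_one_le_left (by positivity) ?_)
    exact_mod_cast Nat.one_le_iff_ne_zero.2 k.factorial_ne_zero
  · refine pow_le_pow_apply (fun x y => ?_) _ x y
    have := geom_le_geom_lazy (P := P) hb hbl hℓ.le_one (θ := T / (1 + T)) (by positivity) hθ1 x y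
    have e : T / (1 + T) * b / (1 - T / (1 + T) + T / (1 + T) * b) = b * T / (1 + b * T) := by
      have : 1 - T / (1 + T) = 1 / (1 + T) := by field_simp; ring
      rw [this]
      field_simp
    rwa [e] at this

end PowerBounds

end

end InfMatrix

/-! ### Convexity in time and regularity of the heat kernel -/

/-- The decrements of a bounded midpoint convex function on `[0, ∞)` are nonnegative. -/
theorem antitone_of_midpoint_convex {F : ℝ → ℝ} {B : ℝ} (h0 : ∀ t, 0 ≤ t → 0 ≤ F t)
    (hB : ∀ t, 0 ≤ t → F t ≤ B)
    (hmid : ∀ t u, 0 ≤ t → 0 ≤ u → 2 * F (t + u) ≤ F t + F (t + 2 * u)) {t u : ℝ} (ht : 0 ≤ t)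
    (hu : 0 ≤ u) : F (t + u) ≤ F t := by
  have hstep : ∀ n : ℕ, ∀ t, 0 ≤ t → F (t + n * u) - F (t + (n + 1) * u) ≤ F t - F (t + u) := by
    intro n
    induction n with
    | zero => intro t _; simp
    | succ n ih =>
      intro t ht
      have h1 := ih (t + u) (by positivity)
      have h2 := hmid t u ht hu
      push_cast
      rw [show t + u + n * u = t + (n + 1) * u by ring,
        show t + u + (n + 1) * u = t + (n + 1 + 1) * u by ring,
        show t + u + u = t + 2 * u by ring] at h1
      linarith
  have hsum : ∀ n : ℕ, F t - F (t + n * u) ≤ n * (F t - F (t + u)) := by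
    intro n
    induction n with
    | zero => simp
    | succ n ih =>
      have := hstep n t ht
      push_cast at this ⊢
      linarith
  by_contra hlt
  push Not at hlt
  -- A single increase would propagate by convexity to linear growth, contradicting the bound `B`.
  obtain ⟨n, hn⟩ := exists_nat_gt (B / (F (t + u) - F t))
  rw [div_lt_iff₀ (by linarith)] at hn
  have h1 := hsum n
  have h2 := h0 t ht
  have h3 := hB (t + n * u) (by positivity)
  linarith

/-- Decrements decrease in time, so the one after `t` is at most the mean of those over `[t / 2,
t]`, which telescope to at most `F (t / 2)`. If `u > t / 2`, the right-hand side already exceeds `F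
t`. -/
theorem sub_le_of_midpoint_convex {F : ℝ → ℝ} {B : ℝ} (h0 : ∀ t, 0 ≤ t → 0 ≤ F t)
    (hB : ∀ t, 0 ≤ t → F t ≤ B)
    (hmid : ∀ t u, 0 ≤ t → 0 ≤ u → 2 * F (t + u) ≤ F t + F (t + 2 * u)) {t u : ℝ} (ht : 0 < t)
    (hu : 0 ≤ u) : F t - F (t + u) ≤ 4 * (u / t) * F (t / 2) := by
  have hanti : ∀ s u, 0 ≤ s → 0 ≤ u → F (s + u) ≤ F s := fun s u hs hu =>
    antitone_of_midpoint_convex h0 hB hmid hs hu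
  rcases hu.eq_or_lt with rfl | hu
  · simp
  have hF := h0 (t / 2) (by positivity)
  rcases lt_or_ge (t / 2) u with hlt | hge
  · have h1 : F t ≤ F (t / 2) := by
      have := hanti (t / 2) (t / 2) (by positivity) (by positivity)
      rwa [add_halves] at this
    have h2 := h0 (t + u) (by positivity)
    have h3 : 1 ≤ 4 * (u / t) := by
      rw [← mul_div_assoc, le_div_iff₀ ht]
      linarith
    nlinarith
  · have hstep : ∀ n : ℕ, (n : ℝ) * u ≤ t →
        F t - F (t + u) ≤ F (t - n * u) - F (t - n * u + u) := by
      intro n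
      induction n with
      | zero => intro _; simp
      | succ n ih =>
        intro hn
        push_cast at hn ⊢
        have h1 := ih (by linarith)
        have h2 := hmid (t - (n + 1) * u) u (by linarith) hu.le
        rw [show t - (n + 1) * u + u = t - n * u by ring,
          show t - (n + 1) * u + 2 * u = t - n * u + u by ring] at h2
        rw [show t - (n + 1) * u + u = t - n * u by ring]
        linarith
    have hsum : ∀ n : ℕ, (n : ℝ) * u ≤ t → n * (F t - F (t + u)) ≤ F (t - n * u) - F t := by
      intro n
      induction n with
      | zero => intro _; simp
      | succ n ih =>
        intro hn
        have h2 := hstep (n + 1) hn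
        push_cast at hn h2 ⊢
        have h1 := ih (by linarith)
        rw [show t - (n + 1) * u + u = t - n * u by ring] at h2
        linarith
    have hm1 : (⌊t / (2 * u)⌋₊ : ℝ) ≤ t / (2 * u) := Nat.floor_le (by positivity)
    have hm2 : t / (2 * u) < ⌊t / (2 * u)⌋₊ + 1 := Nat.lt_floor_add_one _
    have hm3 : 1 ≤ ⌊t / (2 * u)⌋₊ := by
      rw [Nat.one_le_floor_iff, one_le_div (by positivity)]
      linarith
    generalize ⌊t / (2 * u)⌋₊ = m at hm1 hm2 hm3
    have hm3 : (1 : ℝ) ≤ m := by exact_mod_cast hm3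
    rw [le_div_iff₀ (by positivity)] at hm1
    rw [div_lt_iff₀ (by positivity)] at hm2
    have h1 := hsum m (by linarith)
    have h2 : F (t - m * u) ≤ F (t / 2) := by
      have := hanti (t / 2) (t - m * u - t / 2) (by positivity) (by linarith)
      rwa [add_sub_cancel] at this
    have h3 := h0 t ht.le
    -- Since `m ≥ 1`, rounding `t / (2 u)` down loses at most a factor of two.
    have h4 : t ≤ 4 * u * m := by nlinarith
    have h5 : 0 ≤ F t - F (t + u) := by linarith [hanti t u ht.le hu.le]
    rw [← mul_div_assoc, div_mul_eq_mul_div, le_div_iff₀ ht]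
    calc (F t - F (t + u)) * t ≤ (F t - F (t + u)) * (4 * u * m) := by gcongr
      _ = 4 * u * (m * (F t - F (t + u))) := by ring
      _ ≤ 4 * u * F (t / 2) := by gcongr; linarith

namespace InfMatrix

noncomputable section

variable {V V₁ V₂ : Type*}

section

variable {A : InfMatrix V}

theorem heat_ne_top (hA : A.IsStochastic) {t : ℝ} (ht : 0 ≤ t) (x y : V) : heat A t x y ≠ ∞ :=
  ((hA.heat ht).apply_le_one x y).trans_lt ENNReal.one_lt_top |>.ne

theorem hasSum_heat_mul_heat (hA : A.IsStochastic) (hs : A.IsSymm) {s t : ℝ} (h1 : 0 ≤ s)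
    (h2 : 0 ≤ t) (x y : V) :
    HasSum (fun z => (heat A s x z).toReal * (heat A t y z).toReal)
      (heat A (s + t) x y).toReal := by
  have h := heat_ne_top hA (add_nonneg h1 h2) x y
  rw [heat_add A h1 h2, mul_apply] at h ⊢
  rw [ENNReal.tsum_toReal_eq (fun z => (ENNReal.lt_top_of_tsum_ne_top h z).ne)]
  convert ENNReal.hasSum_toReal h using 2 with z
  rw [ENNReal.toReal_mul, hs.heat t y z]

/-- The quadratic form of `e^{t(A - 1)}` at `δ_x + σ δ_y`. -/
def heatForm (A : InfMatrix V) (x y : V) (σ t : ℝ) : ℝ :=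
  (heat A t x x).toReal + σ ^ 2 * (heat A t y y).toReal + 2 * σ * (heat A t x y).toReal

/-- By symmetry and the semigroup law, the form at time `s + t` is the inner product of `δ_x + σ
δ_y` evolved for times `s` and `t`. -/
theorem hasSum_heatForm (hA : A.IsStochastic) (hs : A.IsSymm) (σ : ℝ) {s t : ℝ} (h1 : 0 ≤ s)
    (h2 : 0 ≤ t) (x y : V) :
    HasSum (fun z => ((heat A s x z).toReal + σ * (heat A s y z).toReal) *
      ((heat A t x z).toReal + σ * (heat A t y z).toReal)) (heatForm A x y σ (s + t)) := by
  have hxx := hasSum_heat_mul_heat hA hs h1 h2 x x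
  have hyy := (hasSum_heat_mul_heat hA hs h1 h2 y y).mul_left (σ ^ 2)
  have hxy := (hasSum_heat_mul_heat hA hs h1 h2 x y).mul_left σ
  have hyx := (hasSum_heat_mul_heat hA hs h1 h2 y x).mul_left σ
  rw [hs.heat _ y x] at hyx
  convert ((hxx.add hyy).add hxy).add hyx using 1
  · funext z; ring
  · rw [heatForm]; ring

theorem heatForm_nonneg (hA : A.IsStochastic) (hs : A.IsSymm) (σ : ℝ) {t : ℝ} (ht : 0 ≤ t)
    (x y : V) : 0 ≤ heatForm A x y σ t := by
  have h := hasSum_heatForm hA hs σ (t := t / 2) (s := t / 2) (by positivity)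
    (by positivity) x y
  rw [add_halves] at h
  exact h.nonneg fun z => mul_self_nonneg _

/-- Expand the squared norm of the difference of the vectors evolved for times `t / 2` and `t / 2 +
u`. -/
theorem heatForm_midpoint (hA : A.IsStochastic) (hs : A.IsSymm) (σ : ℝ) {t u : ℝ} (ht : 0 ≤ t)
    (hu : 0 ≤ u) (x y : V) : 2 * heatForm A x y σ (t + u) ≤
      heatForm A x y σ t + heatForm A x y σ (t + 2 * u) := by
  have ht2 : 0 ≤ t / 2 := by positivity
  have htu : 0 ≤ t / 2 + u := by positivity
  have h1 := hasSum_heatForm hA hs σ ht2 ht2 x y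
  have h2 := hasSum_heatForm hA hs σ htu htu x y
  have h3 := (hasSum_heatForm hA hs σ ht2 htu x y).mul_left 2
  have h4 := ((h1.add h2).sub h3).nonneg fun z => by
    nlinarith [sq_nonneg (((heat A (t / 2) x z).toReal + σ * (heat A (t / 2) y z).toReal) -
      ((heat A (t / 2 + u) x z).toReal + σ * (heat A (t / 2 + u) y z).toReal))]
  rw [show t / 2 + t / 2 = t by ring, show t / 2 + u + (t / 2 + u) = t + 2 * u by ring,
    show t / 2 + (t / 2 + u) = t + u by ring] at h4
  linarith

theorem toReal_heat_le_one (hA : A.IsStochastic) {t : ℝ} (ht : 0 ≤ t) (x y : V) :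
    (heat A t x y).toReal ≤ 1 :=
  ENNReal.toReal_le_of_le_ofReal zero_le_one (by simpa using (hA.heat ht).apply_le_one x y)

theorem heatForm_le (hA : A.IsStochastic) (σ : ℝ) {t : ℝ} (ht : 0 ≤ t)
    (x y : V) : heatForm A x y σ t ≤ 1 + σ ^ 2 + 2 * |σ| := by
  have h1 := toReal_heat_le_one hA ht x x
  have h2 := toReal_heat_le_one hA ht y y
  have h3 := toReal_heat_le_one hA ht x y
  have h4 : 0 ≤ (heat A t x y).toReal := ENNReal.toReal_nonneg
  have h5 : σ * (heat A t x y).toReal ≤ |σ| := by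
    have := le_abs_self σ
    have := abs_nonneg σ
    nlinarith
  rw [heatForm]
  nlinarith [sq_nonneg σ]

theorem toReal_heat_antitone (hA : A.IsStochastic) (hs : A.IsSymm) {t u : ℝ} (ht : 0 ≤ t)
    (hu : 0 ≤ u) (x : V) : (heat A (t + u) x x).toReal ≤ (heat A t x x).toReal := by
  have := antitone_of_midpoint_convex (F := heatForm A x x 0)
    (fun t ht => heatForm_nonneg hA hs 0 ht x x) (fun t ht => heatForm_le hA 0 ht x x)
    (fun t u ht hu => heatForm_midpoint hA hs 0 ht hu x x) ht hu
  simpa [heatForm] using this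

theorem heat_self_antitone (hA : A.IsStochastic) (hs : A.IsSymm) {s t : ℝ} (hs0 : 0 ≤ s)
    (hst : s ≤ t) (x : V) : heat A t x x ≤ heat A s x x := by
  have := toReal_heat_antitone hA hs hs0 (sub_nonneg.2 hst) x
  rw [add_sub_cancel] at this
  exact (ENNReal.toReal_le_toReal (heat_ne_top hA (hs0.trans hst) x x)
    (heat_ne_top hA hs0 x x)).1 this

theorem two_mul_toReal_heat_le (hA : A.IsStochastic) (hs : A.IsSymm) {t : ℝ} (ht : 0 ≤ t)
    (x y : V) : 2 * (heat A t x y).toReal ≤ (heat A t x x).toReal + (heat A t y y).toReal := by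
  have := heatForm_nonneg hA hs (-1) ht x y
  rw [heatForm] at this
  linarith

/-- The time regularity of the heat kernel. -/
theorem abs_toReal_heat_sub_le (hA : A.IsStochastic) (hs : A.IsSymm) {t u : ℝ} (ht : 0 < t)
    (hu : 0 ≤ u) (x y : V) :
    |(heat A t x y).toReal - (heat A (t + u) x y).toReal| ≤
      4 * (u / t) * ((heat A (t / 2) x x).toReal + (heat A (t / 2) y y).toReal) := by
  -- Polarisation: `σ = 1` and `σ = -1` bound the off-diagonal increment from the two sides, since
  -- the diagonal decrements are nonnegative.
  have key := fun σ : ℝ => sub_le_of_midpoint_convex (F := heatForm A x y σ)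
    (fun t ht => heatForm_nonneg hA hs σ ht x y) (fun t ht => heatForm_le hA σ ht x y)
    (fun t u ht hu => heatForm_midpoint hA hs σ ht hu x y) ht hu
  have h1 := key 1
  have h2 := key (-1)
  have h3 := two_mul_toReal_heat_le hA hs (half_pos ht).le x y
  have hx := toReal_heat_antitone hA hs ht.le hu x
  have hy := toReal_heat_antitone hA hs ht.le hu y
  have h4 : 0 ≤ (heat A (t / 2) x y).toReal := ENNReal.toReal_nonneg
  have h5 : 0 ≤ 4 * (u / t) := by positivity
  simp only [heatForm] at h1 h2
  rw [abs_le]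
  constructor <;> nlinarith

end

end

end InfMatrix

/-! ### Continuous-time bounds: diagonal decay and weighted time integrals -/

/-- Powers are dominated by the exponential. -/
theorem Real.rpow_le_rpow_mul_exp {p x : ℝ} (hp : 0 < p) (hx : 0 ≤ x) :
    x ^ p ≤ p ^ p * Real.exp x := by
  have h1 : x / p ≤ Real.exp (x / p) := by linarith [Real.add_one_le_exp (x / p)]
  have h2 := Real.rpow_le_rpow (by positivity) h1 hp.le
  rw [Real.div_rpow hx hp.le, ← Real.exp_mul, div_mul_cancel₀ _ hp.ne',
    div_le_iff₀ (by positivity)] at h2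
  linarith

namespace InfMatrix

noncomputable section

variable {V V₁ V₂ : Type*}

namespace PowerBounds

variable {P : InfMatrix V} {ρ : V → V → ℝ} {a : ℝ} {ℓ : V → ℝ}

theorem lazy_stochastic (h : PowerBounds P ρ a) (hℓ : Reversible P ℓ) :
    (lazy ℓ P).IsStochastic :=
  h.stochastic.lazy (fun x => (hℓ.pos x).le) hℓ.le_one

/-- The diagonal decreases in time, so the part of the Laplace integral over `(t / 2, t]` controls
its value at `t`. -/
theorem heat_self_upper (h : PowerBounds P ρ a) (hℓ : Reversible P ℓ) :
    ∃ C : ℝ, 0 < C ∧ ∀ (t : ℝ) (x : V), 1 ≤ t →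
      heat (lazy ℓ P) t x x ≤ ENNReal.ofReal (C * t ^ (-a)) := by
  obtain ⟨k, hk⟩ := exists_nat_ge a
  obtain ⟨C, hC, hb⟩ := h.laplace_upper hℓ k hk
  refine ⟨C * (2 ^ (k + 1) * Real.exp 1), by positivity, fun t x ht => ?_⟩
  have ht0 : 0 < t := by linarith
  have h1 : ENNReal.ofReal ((t / 2) ^ k * Real.exp (-1) * (t / 2)) * heat (lazy ℓ P) t x x ≤
      ENNReal.ofReal (C * t ^ ((k : ℝ) + 1 - a)) := by
    refine le_trans ?_ (hb t x x ht)
    calc ENNReal.ofReal ((t / 2) ^ k * Real.exp (-1) * (t / 2)) * heat (lazy ℓ P) t x x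
        = ∫⁻ s in Set.Ioc (t / 2) t, ENNReal.ofReal ((t / 2) ^ k * Real.exp (-1)) *
            heat (lazy ℓ P) t x x := by
          rw [setLIntegral_const, Real.volume_Ioc, ENNReal.ofReal_mul (by positivity), sub_half]
          ring
      _ ≤ ∫⁻ s in Set.Ioc (t / 2) t, ENNReal.ofReal (s ^ k * Real.exp (-(t⁻¹ * s))) *
            heat (lazy ℓ P) s x x := by
          refine setLIntegral_mono' measurableSet_Ioc fun s hs => ?_
          have hs0 : 0 < s := (half_pos ht0).trans hs.1
          refine mul_le_mul' (ENNReal.ofReal_le_ofReal ?_)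
            (heat_self_antitone (h.lazy_stochastic hℓ) hℓ.symm hs0.le hs.2 x)
          have := hs.1.le
          have : t⁻¹ * s ≤ 1 := by rw [inv_mul_le_one₀ ht0]; exact hs.2
          gcongr
      _ ≤ _ := lintegral_mono_set fun s hs => (half_pos ht0).trans hs.1
  refine (ENNReal.le_ofReal_div_of_mul_le (by positivity) h1).trans (ENNReal.ofReal_le_ofReal ?_)
  refine le_of_eq ?_
  have e2 : t ^ ((k : ℝ) + 1 - a) = t ^ (-a) * t ^ (k + 1) := by
    rw [← Real.rpow_natCast t (k + 1), ← Real.rpow_add ht0]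
    congr 1; push_cast; ring
  rw [e2, Real.exp_neg, div_pow]
  field_simp
  ring

theorem heat_upper (h : PowerBounds P ρ a) (hℓ : Reversible P ℓ) :
    ∃ C : ℝ, 0 < C ∧ ∀ (t : ℝ) (x y : V), 0 ≤ t →
      heat (lazy ℓ P) t x y ≤ ENNReal.ofReal (C * (1 + t) ^ (-a)) := by
  obtain ⟨C, hC, hb⟩ := h.heat_self_upper hℓ
  have ha := h.pos
  have hQ := h.lazy_stochastic hℓ
  refine ⟨2 ^ a * (C + 1), by positivity, fun t x y ht => ?_⟩
  have hpow : (2 : ℝ) ^ a * (1 + t) ^ (-a) = ((1 + t) / 2) ^ (-a) := by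
    rw [Real.div_rpow (by positivity) (by norm_num), Real.rpow_neg two_pos.le, div_inv_eq_mul,
      mul_comm]
  rcases lt_or_ge t 1 with hlt | hge
  · refine ((hQ.heat ht).apply_le_one x y).trans ?_
    rw [← ENNReal.ofReal_one]
    refine ENNReal.ofReal_le_ofReal ?_
    rw [mul_right_comm, hpow]
    have : 1 ≤ ((1 + t) / 2) ^ (-a) :=
      Real.one_le_rpow_of_pos_of_le_one_of_nonpos (by positivity) (by linarith) (by linarith)
    nlinarith
  · have ht0 : 0 < t := by linarith
    have h1 := two_mul_toReal_heat_le hQ hℓ.symm ht x y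
    have hx := ENNReal.toReal_le_of_le_ofReal (by positivity) (hb t x hge)
    have hy := ENNReal.toReal_le_of_le_ofReal (by positivity) (hb t y hge)
    rw [ENNReal.le_ofReal_iff_toReal_le (heat_ne_top hQ ht x y) (by positivity)]
    have h2 : t ^ (-a) ≤ 2 ^ a * (1 + t) ^ (-a) := by
      rw [hpow]
      exact Real.rpow_le_rpow_of_nonpos (by positivity) (by linarith) (by linarith)
    have h3 : 0 ≤ (2 : ℝ) ^ a * (1 + t) ^ (-a) := by positivity
    nlinarith

/-- At scale `K T` the full Laplace integral is at least of order `(K T) ^ (k + 1 - a)`, whereas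
times up to `T` contribute at most `C' T ^ (k + 1 - a)`, uniformly in `K`. Since `k + 1 - a ≥ 1`, a
large `K` makes the tail dominate. -/
theorem laplace_tail_lower (h : PowerBounds P ρ a) (hℓ : Reversible P ℓ) (k : ℕ) (hk : a ≤ k) :
    ∃ K c : ℝ, 1 ≤ K ∧ 0 < c ∧ ∀ (T : ℝ) (x y : V), 1 ≤ T → ρ x y ≤ T →
      ENNReal.ofReal (c * T ^ ((k : ℝ) + 1 - a)) ≤
      ∫⁻ t in Set.Ioi T, ENNReal.ofReal (t ^ k * Real.exp (-((K * T)⁻¹ * t))) *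
        heat (lazy ℓ P) t x y := by
  obtain ⟨C, hC, hb⟩ := h.heat_upper hℓ
  obtain ⟨c, hc, hl⟩ := h.laplace_lower hℓ k le_rfl
  set C' : ℝ := C * 2 ^ ((k : ℝ) - a) with hC'
  have hC'0 : 0 < C' := by positivity
  set K : ℝ := max 1 (2 * C' / c) with hK
  have hK1 : 1 ≤ K := le_max_left _ _
  refine ⟨K, C', hK1, hC'0, fun T x y hT hxy => ?_⟩
  have hT0 : 0 < T := by linarith
  have hK0 : 0 < K := by linarith
  have htot := hl (K * T) x y (by nlinarith) (by nlinarith)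
  rw [← Set.Ioc_union_Ioi_eq_Ioi hT0.le, lintegral_union measurableSet_Ioi
    (Set.Ioc_disjoint_Ioi le_rfl)] at htot
  have hsmall : ∫⁻ t in Set.Ioc 0 T, ENNReal.ofReal (t ^ k * Real.exp (-((K * T)⁻¹ * t))) *
        heat (lazy ℓ P) t x y ≤ ENNReal.ofReal (C' * T ^ ((k : ℝ) + 1 - a)) := by
    calc _ ≤ ∫⁻ t in Set.Ioc 0 T, ENNReal.ofReal (C' * T ^ ((k : ℝ) - a)) := by
          refine setLIntegral_mono' measurableSet_Ioc fun t ht => ?_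
          have ht0 : 0 < t := ht.1
          refine (mul_le_mul' le_rfl (hb t x y ht0.le)).trans ?_
          rw [← ENNReal.ofReal_mul (by positivity)]
          refine ENNReal.ofReal_le_ofReal ?_
          have h1 : Real.exp (-((K * T)⁻¹ * t)) ≤ 1 := by
            rw [Real.exp_le_one_iff, neg_nonpos]; positivity
          have h2 : t ^ k ≤ (1 + t) ^ (k : ℝ) := by
            rw [Real.rpow_natCast]; gcongr; linarith
          calc t ^ k * Real.exp (-((K * T)⁻¹ * t)) * (C * (1 + t) ^ (-a))
              ≤ (1 + t) ^ (k : ℝ) * 1 * (C * (1 + t) ^ (-a)) := by gcongr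
            _ = C * (1 + t) ^ ((k : ℝ) - a) := by
              rw [sub_eq_add_neg, Real.rpow_add (by positivity)]; ring
            _ ≤ C * (2 * T) ^ ((k : ℝ) - a) := by
              have := Real.rpow_le_rpow (by positivity) (show 1 + t ≤ 2 * T by linarith [ht.2])
                (sub_nonneg.2 hk)
              gcongr
            _ = _ := by rw [Real.mul_rpow two_pos.le hT0.le, hC']; ring
      _ = _ := by
          rw [setLIntegral_const, Real.volume_Ioc, ← ENNReal.ofReal_mul (by positivity), sub_zero]
          congr 1
          rw [mul_assoc, ← Real.rpow_add_one hT0.ne']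
          congr 2; ring
  have hbig : ENNReal.ofReal (C' * T ^ ((k : ℝ) + 1 - a)) +
      ENNReal.ofReal (C' * T ^ ((k : ℝ) + 1 - a)) ≤
      ENNReal.ofReal (c * (K * T) ^ ((k : ℝ) + 1 - a)) := by
    rw [← ENNReal.ofReal_add (by positivity) (by positivity)]
    refine ENNReal.ofReal_le_ofReal ?_
    have h1 : K ≤ K ^ ((k : ℝ) + 1 - a) := by
      conv_lhs => rw [← Real.rpow_one K]
      exact Real.rpow_le_rpow_of_exponent_le hK1 (by linarith)
    have h2 : 2 * C' ≤ c * K := by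
      have := le_max_right 1 (2 * C' / c)
      rw [← hK, div_le_iff₀ hc] at this
      linarith
    rw [Real.mul_rpow hK0.le hT0.le]
    calc _ = 2 * C' * T ^ ((k : ℝ) + 1 - a) := by ring
      _ ≤ c * K ^ ((k : ℝ) + 1 - a) * T ^ ((k : ℝ) + 1 - a) := by
        have := mul_le_mul_of_nonneg_left h1 hc.le
        exact mul_le_mul_of_nonneg_right (by linarith) (by positivity)
      _ = _ := by ring
  exact (ENNReal.add_le_add_iff_left ENNReal.ofReal_ne_top).1
    (hbig.trans (htot.trans (add_le_add hsmall le_rfl)))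

/-- After time `t` the diagonal is at most its value at `t`, so the tail of the Laplace integral
bounds that value from below. -/
theorem heat_self_lower (h : PowerBounds P ρ a) (hℓ : Reversible P ℓ) :
    ∃ c : ℝ, 0 < c ∧ ∀ (t : ℝ) (x : V), 1 ≤ t →
      ENNReal.ofReal (c * t ^ (-a)) ≤ heat (lazy ℓ P) t x x := by
  obtain ⟨k, hk⟩ := exists_nat_ge a
  obtain ⟨K, c, hK, hc, hl⟩ := h.laplace_tail_lower hℓ k hk
  refine ⟨c / (k.factorial * K ^ (k + 1)), by positivity, fun t x ht => ?_⟩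
  have ht0 : 0 < t := by linarith
  have hK0 : 0 < K := by linarith
  have h1 : ENNReal.ofReal (c * t ^ ((k : ℝ) + 1 - a)) ≤
      ENNReal.ofReal (k.factorial * (1 / (K * t)⁻¹) ^ (k + 1)) * heat (lazy ℓ P) t x x := by
    refine (hl t x x ht (by rw [h.rho_self]; exact ht0.le)).trans ?_
    calc _ ≤ ∫⁻ s in Set.Ioi t, ENNReal.ofReal (s ^ k * Real.exp (-((K * t)⁻¹ * s))) *
            heat (lazy ℓ P) t x x := by
          refine setLIntegral_mono' measurableSet_Ioi fun s hs => ?_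
          gcongr
          exact heat_self_antitone (h.lazy_stochastic hℓ) hℓ.symm ht0.le (le_of_lt hs) x
      _ ≤ ∫⁻ s in Set.Ioi 0, ENNReal.ofReal (s ^ k * Real.exp (-((K * t)⁻¹ * s))) *
            heat (lazy ℓ P) t x x := lintegral_mono_set (Set.Ioi_subset_Ioi ht0.le)
      _ = _ := by
          rw [lintegral_mul_const _ (by fun_prop), Real.lintegral_pow_mul_exp_neg_mul_Ioi _
            (by positivity)]
  refine le_trans (le_of_eq (congrArg _ ?_))
    (ENNReal.ofReal_div_le_of_le_mul (by positivity) h1)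
  have e2 : t ^ ((k : ℝ) + 1 - a) = t ^ (-a) * t ^ (k + 1) := by
    rw [← Real.rpow_natCast t (k + 1), ← Real.rpow_add ht0]
    congr 1; push_cast; ring
  rw [e2, one_div, inv_inv, mul_pow]
  field_simp

/-- The Laplace weight `t ^ k e ^ (-t / (K T))` is at most a constant times `(K T) ^ (k + b) t ^
(-b)`, so the tail bound passes to the weight `t ^ (-b)`. -/
theorem lintegral_rpow_mul_heat_lower (h : PowerBounds P ρ a) (hℓ : Reversible P ℓ) {b : ℝ}
    (hb : 0 ≤ b) : ∃ c : ℝ, 0 < c ∧ ∀ (T : ℝ) (x y : V), 1 ≤ T → ρ x y ≤ T →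
      ENNReal.ofReal (c * T ^ (1 - a - b)) ≤
      ∫⁻ t in Set.Ioi T, ENNReal.ofReal (t ^ (-b)) * heat (lazy ℓ P) t x y := by
  obtain ⟨k, hk⟩ := exists_nat_ge a
  obtain ⟨K, c, hK, hc, hl⟩ := h.laplace_tail_lower hℓ k hk
  have hkb : 0 < (k : ℝ) + b := by linarith [h.pos]
  set p : ℝ := (k : ℝ) + b with hp
  refine ⟨c / (p ^ p * K ^ p), by positivity, fun T x y hT hxy => ?_⟩
  have hT0 : 0 < T := by linarith
  have hK0 : 0 < K := by linarith
  have h1 : ENNReal.ofReal (c * T ^ ((k : ℝ) + 1 - a)) ≤ ENNReal.ofReal (p ^ p * (K * T) ^ p) *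
      ∫⁻ t in Set.Ioi T, ENNReal.ofReal (t ^ (-b)) * heat (lazy ℓ P) t x y := by
    refine (hl T x y hT hxy).trans ?_
    rw [← lintegral_const_mul _ (by
      exact Measurable.mul (by fun_prop) (measurable_heat _ x y))]
    refine setLIntegral_mono' measurableSet_Ioi fun t ht => ?_
    have ht : T < t := ht
    have ht0 : 0 < t := hT0.trans ht
    rw [← mul_assoc, ← ENNReal.ofReal_mul (by positivity)]
    refine mul_le_mul' (ENNReal.ofReal_le_ofReal ?_) le_rfl
    have h2 := Real.rpow_le_rpow_mul_exp hkb (x := (K * T)⁻¹ * t) (by positivity)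
    rw [Real.mul_rpow (by positivity) ht0.le, Real.inv_rpow (by positivity),
      inv_mul_le_iff₀ (by positivity)] at h2
    have e1 : t ^ k = t ^ p * t ^ (-b) := by
      rw [← Real.rpow_natCast t k, ← Real.rpow_add ht0, hp]
      congr 1; ring
    rw [e1, Real.exp_neg, ← div_eq_mul_inv, div_le_iff₀ (Real.exp_pos _)]
    calc t ^ p * t ^ (-b) ≤ ((K * T) ^ p * (p ^ p * Real.exp ((K * T)⁻¹ * t))) * t ^ (-b) := by
          gcongr
      _ = _ := by ring
  refine le_trans (le_of_eq (congrArg _ ?_))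
    (ENNReal.ofReal_div_le_of_le_mul (by positivity) h1)
  have e2 : T ^ ((k : ℝ) + 1 - a) = T ^ (1 - a - b) * T ^ p := by
    rw [← Real.rpow_add hT0, hp]
    congr 1; ring
  rw [e2, Real.mul_rpow hK0.le hT0.le]
  field_simp

/-- A Gamma integral writes `(1 + t) ^ (-b)` as a mixture of `e ^ (-(1 + t) s)`. For fixed `s` the
time integral is a lazy resolvent, comparable to that of `P`; integrating back over `s` gives
coefficients of order `(n + 1) ^ (-b)`. -/
theorem lintegral_rpow_mul_heat_le_tsum (hℓ : Reversible P ℓ) {b : ℝ}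
    (hb : 0 < b) : ∃ C : ℝ, 0 < C ∧ ∀ x y : V,
      ∫⁻ t in Set.Ioi (0 : ℝ), ENNReal.ofReal ((1 + t) ^ (-b)) * heat (lazy ℓ P) t x y ≤
        ENNReal.ofReal C * ∑' n : ℕ, ENNReal.ofReal (((n : ℝ) + 1) ^ (-b)) * (P ^ n) x y := by
  obtain ⟨c, hc, hcl⟩ := hℓ.exists_le
  have hΓ := Real.Gamma_pos_of_pos hb
  refine ⟨c⁻¹ * (2 ^ b + (2 * b) ^ b * Real.exp 1), by positivity, fun x y => ?_⟩
  have hmel : ∀ t : ℝ, 0 < t → ENNReal.ofReal (Real.Gamma b) * ENNReal.ofReal ((1 + t) ^ (-b)) =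
      ∫⁻ s in Set.Ioi (0 : ℝ), ENNReal.ofReal (s ^ (b - 1) * Real.exp (-((1 + t) * s))) := by
    intro t ht
    rw [Real.lintegral_rpow_mul_exp_neg_mul_Ioi hb (by positivity),
      ← ENNReal.ofReal_mul hΓ.le, one_div, Real.inv_rpow (by positivity),
      Real.rpow_neg (by positivity), mul_comm]
  have hswap : ENNReal.ofReal (Real.Gamma b) *
      ∫⁻ t in Set.Ioi (0 : ℝ), ENNReal.ofReal ((1 + t) ^ (-b)) * heat (lazy ℓ P) t x y =
      ∫⁻ s in Set.Ioi (0 : ℝ), ENNReal.ofReal (s ^ (b - 1) * Real.exp (-s)) *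
        ∫⁻ t in Set.Ioi (0 : ℝ), ENNReal.ofReal (t ^ 0 * Real.exp (-(s * t))) *
          heat (lazy ℓ P) t x y := by
    rw [← lintegral_const_mul _ (by
      exact Measurable.mul (by fun_prop) (measurable_heat _ x y))]
    calc _ = ∫⁻ t in Set.Ioi (0 : ℝ), ∫⁻ s in Set.Ioi (0 : ℝ),
          ENNReal.ofReal (s ^ (b - 1) * Real.exp (-((1 + t) * s))) * heat (lazy ℓ P) t x y := by
          refine setLIntegral_congr_fun measurableSet_Ioi fun t ht => ?_
          rw [← mul_assoc, hmel t ht, lintegral_mul_const _ (by fun_prop)]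
      _ = ∫⁻ s in Set.Ioi (0 : ℝ), ∫⁻ t in Set.Ioi (0 : ℝ),
          ENNReal.ofReal (s ^ (b - 1) * Real.exp (-((1 + t) * s))) * heat (lazy ℓ P) t x y := by
          refine MeasureTheory.lintegral_lintegral_swap (Measurable.aemeasurable ?_)
          exact Measurable.mul (by fun_prop) ((measurable_heat _ x y).comp measurable_fst)
      _ = _ := by
          refine setLIntegral_congr_fun measurableSet_Ioi fun s hs => ?_
          have hs : 0 < s := hs
          rw [← lintegral_const_mul _ (by
      exact Measurable.mul (by fun_prop) (measurable_heat _ x y))]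
          refine setLIntegral_congr_fun measurableSet_Ioi fun t ht => ?_
          rw [← mul_assoc, ← ENNReal.ofReal_mul (by positivity), pow_zero, one_mul, mul_assoc,
            ← Real.exp_add]
          congr 4
          ring
  have hsum : ENNReal.ofReal (Real.Gamma b) *
      ∫⁻ t in Set.Ioi (0 : ℝ), ENNReal.ofReal ((1 + t) ^ (-b)) * heat (lazy ℓ P) t x y ≤
      ∑' n : ℕ, (∫⁻ s in Set.Ioi (0 : ℝ), ENNReal.ofReal (c⁻¹ * (s ^ (b - 1) * Real.exp (-s) *
        (1 / (1 + s)) ^ n))) * (P ^ n) x y := by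
    rw [hswap]
    calc _ ≤ ∫⁻ s in Set.Ioi (0 : ℝ), ∑' n : ℕ, ENNReal.ofReal (c⁻¹ * (s ^ (b - 1) * Real.exp (-s) *
        (1 / (1 + s)) ^ n)) * (P ^ n) x y := by
          refine setLIntegral_mono' measurableSet_Ioi fun s hs => ?_
          have hs : 0 < s := hs
          have hθ : 1 / (1 + s) ≤ 1 := by rw [div_le_one (by positivity)]; linarith
          rw [lintegral_pow_mul_exp_mul_heat _ 0 hs.le, zero_add, pow_one, pow_one]
          calc _ ≤ ENNReal.ofReal (s ^ (b - 1) * Real.exp (-s)) * (1 *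
                (ENNReal.ofReal c⁻¹ * geom (ENNReal.ofReal (1 / (1 + s))) P x y)) := by
                gcongr
                · rw [ENNReal.ofReal_le_one]
                  simpa using hθ
                · exact geom_lazy_le hc hcl hℓ.le_one (ENNReal.ofReal_le_one.2 hθ) x y
            _ = _ := by
                rw [one_mul, geom_apply, ← mul_assoc, ← ENNReal.tsum_mul_left]
                refine tsum_congr fun n => ?_
                rw [← ENNReal.ofReal_pow (by positivity), ← mul_assoc,
                  ← ENNReal.ofReal_mul (by positivity), ← ENNReal.ofReal_mul (by positivity)]
                congr 2
                ring
      _ = _ := by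
          rw [lintegral_tsum (fun n => by fun_prop)]
          exact tsum_congr fun n => lintegral_mul_const _ (by fun_prop)
  have hcoef : ∀ n : ℕ, ∫⁻ s in Set.Ioi (0 : ℝ),
      ENNReal.ofReal (c⁻¹ * (s ^ (b - 1) * Real.exp (-s) *
        (1 / (1 + s)) ^ n)) ≤ ENNReal.ofReal (Real.Gamma b * (c⁻¹ * (2 ^ b +
          (2 * b) ^ b * Real.exp 1)) * ((n : ℝ) + 1) ^ (-b)) := by
    intro n
    -- Here `1 / (1 + s)` is at most `e ^ (-s / 2)` for `s ≤ 1` and at most `e ^ (-1 / 2)` for `s ≥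
    -- 1`, so both resulting integrals are Gamma integrals.
    have hdec : ∀ s : ℝ, 0 < s → Real.exp (-s) * (1 / (1 + s)) ^ n ≤
        Real.exp (-((1 + n / 2) * s)) + Real.exp (-(n / 2)) * Real.exp (-(1 * s)) := by
      intro s hs
      rcases le_total s 1 with hs1 | hs1
      · refine le_add_of_le_of_nonneg ?_ (by positivity)
        have h1 : 1 / (1 + s) ≤ Real.exp (-(s / 2)) := by
          have h2 : 1 - s / 2 ≤ Real.exp (-(s / 2)) := by
            linarith [Real.add_one_le_exp (-(s / 2))]
          refine le_trans ?_ h2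
          rw [div_le_iff₀ (by positivity)]
          nlinarith
        calc Real.exp (-s) * (1 / (1 + s)) ^ n ≤ Real.exp (-s) * Real.exp (-(s / 2)) ^ n := by
              gcongr
          _ = _ := by
              rw [← Real.exp_nat_mul, ← Real.exp_add]
              congr 1; ring
      · refine le_add_of_nonneg_of_le (by positivity) ?_
        have h1 : 1 / (1 + s) ≤ Real.exp (-(1 / 2)) := by
          have h2 : 1 - 1 / 2 ≤ Real.exp (-(1 / 2)) := by
            linarith [Real.add_one_le_exp (-(1 / 2) : ℝ)]
          refine le_trans ?_ h2
          rw [div_le_iff₀ (by positivity)]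
          linarith
        calc Real.exp (-s) * (1 / (1 + s)) ^ n ≤ Real.exp (-s) * Real.exp (-(1 / 2)) ^ n := by
              gcongr
          _ = _ := by
              rw [← Real.exp_nat_mul, one_mul, mul_comm]
              congr 2; ring
    have hn0 : (0 : ℝ) ≤ n := Nat.cast_nonneg n
    calc _ ≤ ∫⁻ s in Set.Ioi (0 : ℝ), (ENNReal.ofReal c⁻¹ *
            ENNReal.ofReal (s ^ (b - 1) * Real.exp (-((1 + n / 2) * s))) +
            ENNReal.ofReal (c⁻¹ * Real.exp (-(n / 2))) *
              ENNReal.ofReal (s ^ (b - 1) * Real.exp (-(1 * s)))) := by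
          refine setLIntegral_mono' measurableSet_Ioi fun s hs => ?_
          have hs : 0 < s := hs
          rw [← ENNReal.ofReal_mul (by positivity), ← ENNReal.ofReal_mul (by positivity),
            ← ENNReal.ofReal_add (by positivity) (by positivity)]
          refine ENNReal.ofReal_le_ofReal ?_
          have h1 := hdec s hs
          calc c⁻¹ * (s ^ (b - 1) * Real.exp (-s) * (1 / (1 + s)) ^ n)
              = c⁻¹ * s ^ (b - 1) * (Real.exp (-s) * (1 / (1 + s)) ^ n) := by ring
            _ ≤ c⁻¹ * s ^ (b - 1) * (Real.exp (-((1 + n / 2) * s)) +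
                Real.exp (-(n / 2)) * Real.exp (-(1 * s))) := by gcongr
            _ = _ := by ring
      _ = ENNReal.ofReal (c⁻¹ * ((1 / (1 + n / 2)) ^ b * Real.Gamma b) +
            c⁻¹ * Real.exp (-(n / 2)) * ((1 / 1) ^ b * Real.Gamma b)) := by
          rw [lintegral_add_left (by fun_prop), lintegral_const_mul _ (by fun_prop),
            lintegral_const_mul _ (by fun_prop),
            Real.lintegral_rpow_mul_exp_neg_mul_Ioi hb (by positivity),
            Real.lintegral_rpow_mul_exp_neg_mul_Ioi hb one_pos,
            ← ENNReal.ofReal_mul (by positivity), ← ENNReal.ofReal_mul (by positivity),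
            ← ENNReal.ofReal_add (by positivity) (by positivity)]
      _ ≤ _ := by
          refine ENNReal.ofReal_le_ofReal ?_
          have h1 : (1 / (1 + (n : ℝ) / 2)) ^ b ≤ 2 ^ b * ((n : ℝ) + 1) ^ (-b) := by
            rw [Real.rpow_neg (by positivity), ← Real.inv_rpow (by positivity),
              ← Real.mul_rpow (by positivity) (by positivity)]
            refine Real.rpow_le_rpow (by positivity) ?_ hb.le
            rw [← div_eq_mul_inv, div_le_div_iff₀ (by positivity) (by positivity)]
            linarith
          have h2 : Real.exp (-((n : ℝ) / 2)) ≤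
              (2 * b) ^ b * Real.exp 1 * ((n : ℝ) + 1) ^ (-b) := by
            have h3 := Real.rpow_le_rpow_mul_exp hb (x := ((n : ℝ) + 1) / 2) (by positivity)
            rw [Real.div_rpow (by positivity) two_pos.le, div_le_iff₀ (by positivity)] at h3
            rw [Real.rpow_neg (by positivity), ← div_eq_mul_inv, le_div_iff₀ (by positivity),
              Real.exp_neg, inv_mul_le_iff₀ (Real.exp_pos _)]
            refine h3.trans ?_
            rw [Real.mul_rpow two_pos.le hb.le]
            have h4 : Real.exp (((n : ℝ) + 1) / 2) ≤ Real.exp ((n : ℝ) / 2) * Real.exp 1 := by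
              rw [← Real.exp_add]
              refine Real.exp_le_exp.2 ?_
              linarith
            calc b ^ b * Real.exp (((n : ℝ) + 1) / 2) * 2 ^ b
                ≤ b ^ b * (Real.exp ((n : ℝ) / 2) * Real.exp 1) * 2 ^ b := by gcongr
              _ = _ := by ring
          rw [div_one, Real.one_rpow, one_mul]
          calc _ = Real.Gamma b * c⁻¹ * ((1 / (1 + (n : ℝ) / 2)) ^ b +
                Real.exp (-((n : ℝ) / 2))) := by
                ring
            _ ≤ Real.Gamma b * c⁻¹ * (2 ^ b * ((n : ℝ) + 1) ^ (-b) +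
                (2 * b) ^ b * Real.exp 1 * ((n : ℝ) + 1) ^ (-b)) := by gcongr
            _ = _ := by ring
  have hfin : ENNReal.ofReal (Real.Gamma b) *
      ∫⁻ t in Set.Ioi (0 : ℝ), ENNReal.ofReal ((1 + t) ^ (-b)) * heat (lazy ℓ P) t x y ≤
      ENNReal.ofReal (Real.Gamma b) * (ENNReal.ofReal (c⁻¹ * (2 ^ b + (2 * b) ^ b * Real.exp 1)) *
      ∑' n : ℕ, ENNReal.ofReal (((n : ℝ) + 1) ^ (-b)) * (P ^ n) x y) := by
    refine hsum.trans ?_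
    rw [← mul_assoc, ← ENNReal.ofReal_mul hΓ.le, ← ENNReal.tsum_mul_left]
    refine ENNReal.tsum_le_tsum fun n => ?_
    rw [← mul_assoc, ← ENNReal.ofReal_mul (by positivity)]
    exact mul_le_mul' (hcoef n) le_rfl
  exact (ENNReal.mul_le_mul_iff_right (by simpa using hΓ) ENNReal.ofReal_ne_top).1 hfin

theorem _root_.ENNReal.tsum_rpow_add_le {p D : ℝ} (hp : 1 < p) (hD : 1 ≤ D) :
    ∑' n : ℕ, ENNReal.ofReal ((D + ((n + 1 : ℕ) : ℝ)) ^ (-p)) ≤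
      ENNReal.ofReal (D ^ (1 - p) / (p - 1)) := by
  have hD0 : 0 < D := by linarith
  rw [ENNReal.tsum_eq_iSup_nat]
  refine iSup_le fun N => ?_
  rw [← ENNReal.ofReal_sum_of_nonneg (fun n _ => by positivity)]
  refine ENNReal.ofReal_le_ofReal ?_
  have hanti : AntitoneOn (fun u : ℝ => u ^ (-p)) (Set.Icc D (D + N)) := by
    intro u hu v hv huv
    exact Real.rpow_le_rpow_of_nonpos (hD0.trans_le hu.1) huv (by linarith)
  refine hanti.sum_le_integral.trans ?_
  rw [integral_rpow (Or.inr ⟨by linarith, fun h => ?_⟩)]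
  · rw [show -p + 1 = 1 - p by ring, ← neg_div_neg_eq, neg_sub, neg_sub]
    have : 0 ≤ (D + N) ^ (1 - p) := by positivity
    have : 0 < p - 1 := by linarith
    gcongr
    linarith
  · rw [Set.uIcc_of_le (by linarith [(Nat.cast_nonneg N : (0 : ℝ) ≤ N)])] at h
    linarith [h.1]

/-- Every term of the discrete series is bounded by a constant times `(D + n + 1) ^ (-(a + b))`: by
the uniform decay of `P ^ n` once `n` is of order `D`, and by the moment of order `a + b` before.
The alternative `D = 1` serves coinciding points. -/
theorem lintegral_rpow_mul_heat_upper (h : PowerBounds P ρ a) (hℓ : Reversible P ℓ) {b : ℝ}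
    (hb : 0 < b) (hab : 1 < a + b) : ∃ C : ℝ, 0 < C ∧ ∀ (D : ℝ) (x y : V), 1 ≤ D →
      D = 1 ∨ D ≤ ρ x y →
      ∫⁻ t in Set.Ioi (0 : ℝ), ENNReal.ofReal ((1 + t) ^ (-b)) * heat (lazy ℓ P) t x y ≤
        ENNReal.ofReal (C * D ^ (1 - a - b)) := by
  obtain ⟨C₁, hC₁, h₁⟩ := lintegral_rpow_mul_heat_le_tsum hℓ hb
  obtain ⟨C₂, hC₂, h₂⟩ := h.exists_pow_le
  obtain ⟨C₃, hC₃, h₃⟩ := h.upper (a + b) (by linarith)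
  set p := a + b with hp
  set C₄ : ℝ := (C₂ + C₃) * 4 ^ p with hC₄
  have hp1 : 0 < p - 1 := by linarith
  refine ⟨C₁ * C₄ * (1 / (p - 1)), by positivity, fun D x y hD hDxy => ?_⟩
  have hD0 : 0 < D := by linarith
  have hterm : ∀ n : ℕ, ENNReal.ofReal (((n : ℝ) + 1) ^ (-b)) * (P ^ n) x y ≤
      ENNReal.ofReal C₄ * ENNReal.ofReal ((D + ((n + 1 : ℕ) : ℝ)) ^ (-p)) := by
    intro n
    have hn0 : (0 : ℝ) ≤ n := Nat.cast_nonneg n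
    have hA : ENNReal.ofReal (((n : ℝ) + 1) ^ (-b)) * (P ^ n) x y ≤
        ENNReal.ofReal (C₂ * ((n : ℝ) + 1) ^ (-p)) := by
      refine (mul_le_mul' le_rfl (h₂ n x y)).trans ?_
      rw [← ENNReal.ofReal_mul (by positivity)]
      refine le_of_eq (congrArg _ ?_)
      rw [hp, neg_add, Real.rpow_add (by positivity)]
      ring
    have hpow4 : ∀ u : ℝ, 0 < u → D + ((n + 1 : ℕ) : ℝ) ≤ 4 * u →
        u ^ (-p) ≤ 4 ^ p * (D + ((n + 1 : ℕ) : ℝ)) ^ (-p) := by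
      intro u hu hle
      have := Real.rpow_le_rpow_of_nonpos (by positivity) hle (show -p ≤ 0 by linarith)
      rw [Real.mul_rpow (by norm_num) hu.le, Real.rpow_neg (by norm_num),
        inv_mul_le_iff₀ (by positivity)] at this
      exact this
    have hfin : ∀ u : ℝ, 0 < u → D + ((n + 1 : ℕ) : ℝ) ≤ 4 * u → ∀ C, 0 ≤ C → C ≤ C₂ + C₃ →
        ENNReal.ofReal (C * u ^ (-p)) ≤
        ENNReal.ofReal C₄ * ENNReal.ofReal ((D + ((n + 1 : ℕ) : ℝ)) ^ (-p)) := by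
      intro u hu hle C hC0 hC
      rw [← ENNReal.ofReal_mul (by positivity)]
      refine ENNReal.ofReal_le_ofReal ?_
      rw [hC₄, mul_assoc]
      have := hpow4 u hu hle
      gcongr
    by_cases hcase : D ≤ 2 * ((n : ℝ) + 1)
    · refine hA.trans (hfin _ (by positivity) ?_ _ hC₂.le (by linarith))
      push_cast
      linarith
    · have hρ : D ≤ ρ x y := by
        rcases hDxy with rfl | hDxy
        · exact absurd (by linarith) hcase
        · exact hDxy
      rcases Nat.eq_zero_or_pos n with rfl | hn
      · have hne : x ≠ y := by
          rintro rfl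
          rw [h.rho_self] at hρ
          linarith
        simp [one_apply_ne hne]
      · have h4 := h₃ n x y hn
        have hρ0 : 0 < ρ x y := hD0.trans_le hρ
        have hn' : (0 : ℝ) < n := by exact_mod_cast hn
        rw [show p - a = b by rw [hp]; ring] at h4
        have h5 := ENNReal.le_ofReal_div_of_mul_le (by positivity) h4
        refine le_trans ?_ (hfin D hD0 (by push_cast; linarith) C₃ hC₃.le (by linarith))
        refine (mul_le_mul' le_rfl h5).trans ?_
        rw [← ENNReal.ofReal_mul (by positivity)]
        refine ENNReal.ofReal_le_ofReal ?_
        have h6 : ((n : ℝ) + 1) ^ (-b) * (n : ℝ) ^ b ≤ 1 := by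
          rw [Real.rpow_neg (by positivity), inv_mul_le_one₀ (by positivity)]
          exact Real.rpow_le_rpow hn'.le (by linarith) hb.le
        have h7 : (ρ x y ^ p)⁻¹ ≤ D ^ (-p) := by
          rw [← Real.rpow_neg hρ0.le]
          exact Real.rpow_le_rpow_of_nonpos hD0 hρ (by linarith)
        calc ((n : ℝ) + 1) ^ (-b) * (C₃ * (n : ℝ) ^ b / ρ x y ^ p)
            = C₃ * (((n : ℝ) + 1) ^ (-b) * (n : ℝ) ^ b) * (ρ x y ^ p)⁻¹ := by ring
          _ ≤ C₃ * 1 * D ^ (-p) := by gcongr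
          _ = _ := by ring
  refine (h₁ x y).trans ?_
  calc _ ≤ ENNReal.ofReal C₁ * ∑' n : ℕ, ENNReal.ofReal C₄ *
        ENNReal.ofReal ((D + ((n + 1 : ℕ) : ℝ)) ^ (-p)) := by
        exact mul_le_mul' le_rfl (ENNReal.tsum_le_tsum hterm)
    _ ≤ ENNReal.ofReal C₁ * (ENNReal.ofReal C₄ * ENNReal.ofReal (D ^ (1 - p) / (p - 1))) := by
        rw [ENNReal.tsum_mul_left]
        gcongr
        exact ENNReal.tsum_rpow_add_le hab hD
    _ = _ := by
        rw [← ENNReal.ofReal_mul (by positivity), ← ENNReal.ofReal_mul (by positivity)]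
        congr 1
        rw [show 1 - a - b = 1 - p by rw [hp]; ring]
        ring

end PowerBounds

end

end InfMatrix

/-! ### Oscillation and the near-diagonal lower bound -/

namespace InfMatrix

noncomputable section

variable {V V₁ V₂ : Type*}

/-- The transition matrix of the continuous-time chain observed at an independent exponential time
of mean `T`. -/
def resolvent (A : InfMatrix V) (T : ℝ) : InfMatrix V :=
  scale (ENNReal.ofReal (1 / (1 + T))) (geom (ENNReal.ofReal (T / (1 + T))) A)

theorem resolvent_apply (A : InfMatrix V) (T : ℝ) (x y : V) : resolvent A T x y =
    ENNReal.ofReal (1 / (1 + T)) * geom (ENNReal.ofReal (T / (1 + T))) A x y := rfl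

theorem resolvent_eq {T : ℝ} (hT : 0 < T) (A : InfMatrix V) (x y : V) : resolvent A T x y =
    ENNReal.ofReal T⁻¹ * (ENNReal.ofReal (1 / (1 + T⁻¹)) *
      geom (ENNReal.ofReal (1 / (1 + T⁻¹))) A x y) := by
  have hθ : 1 / (1 + T⁻¹) = T / (1 + T) := by field_simp; ring
  rw [resolvent_apply, hθ, ← mul_assoc, ← ENNReal.ofReal_mul (by positivity)]
  congr 2
  field_simp

theorem tsum_geometric_ofReal {T : ℝ} (hT : 0 < T) :
    ∑' n : ℕ, ENNReal.ofReal (T / (1 + T)) ^ n = ENNReal.ofReal (1 + T) := by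
  have := PowerBounds.tsum_choose_mul_pow hT 0
  simp only [add_zero, Nat.choose_zero_right, Nat.cast_one, one_mul, zero_add, pow_one] at this
  rw [← this]
  exact tsum_congr fun n => (ENNReal.ofReal_pow (by positivity) n).symm

theorem IsStochastic.resolvent {A : InfMatrix V} (hA : A.IsStochastic) {T : ℝ} (hT : 0 < T) :
    (resolvent A T).IsStochastic := by
  intro x
  simp only [resolvent_apply, ENNReal.tsum_mul_left]
  rw [geom, hA.tsum_series, tsum_geometric_ofReal hT, ← ENNReal.ofReal_mul (by positivity),
    one_div_mul_cancel (by positivity), ENNReal.ofReal_one]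

theorem IsSymm.resolvent {A : InfMatrix V} (hA : A.IsSymm) (T : ℝ) : (resolvent A T).IsSymm :=
  fun x y => by rw [resolvent_apply, resolvent_apply, geom, hA.symm_series _ x y]

/-- Running the chain for an additional independent exponential time averages the kernel over later
times. -/
theorem resolvent_heat_eq [Countable V] {A : InfMatrix V} (hs : A.IsSymm) {t T : ℝ} (ht : 0 ≤ t)
    (hT : 0 < T) (x y : V) : ∑' z, resolvent A T y z * heat A t x z =
      ∫⁻ u in Set.Ioi (0 : ℝ), ENNReal.ofReal (T⁻¹ * Real.exp (-(T⁻¹ * u))) *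
        heat A (t + u) x y := by
  have h := lintegral_exp_mul_heat_add A ht (inv_nonneg.2 hT.le) x y
  have hm : Measurable fun u => heat A (t + u) x y :=
    (measurable_heat A x y).comp (measurable_const_add t)
  simp_rw [ENNReal.ofReal_mul (inv_nonneg.2 hT.le), mul_assoc]
  rw [lintegral_const_mul _ (by exact Measurable.mul (by fun_prop) hm), h, ← ENNReal.tsum_mul_left]
  refine tsum_congr fun z => ?_
  rw [hs.resolvent T y z, resolvent_eq hT]
  ring

namespace PowerBounds

variable {P : InfMatrix V} {ρ : V → V → ℝ} {a : ℝ} {ℓ : V → ℝ}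

theorem resolvent_lower (h : PowerBounds P ρ a) (hℓ : Reversible P ℓ) {κ : ℝ} (hκ : 1 ≤ κ) :
    ∃ c : ℝ, 0 < c ∧ ∀ (T : ℝ) (x y : V), 1 ≤ T → ρ x y ≤ κ * T →
      ENNReal.ofReal (c * T ^ (-a)) ≤ resolvent (lazy ℓ P) T x y := by
  obtain ⟨c, hc, hl⟩ := h.laplace_lower hℓ 0 hκ
  refine ⟨c, hc, fun T x y hT hxy => ?_⟩
  have hT0 : 0 < T := by linarith
  have h1 := hl T x y hT hxy
  rw [lintegral_pow_mul_exp_mul_heat _ _ (by positivity)] at h1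
  simp only [Nat.factorial_zero, Nat.cast_one, zero_add, pow_one, one_mul, Nat.cast_zero] at h1
  rw [resolvent_eq hT0]
  refine le_trans (le_of_eq ?_) (mul_le_mul' le_rfl h1)
  rw [← ENNReal.ofReal_mul (by positivity), sub_eq_add_neg, Real.rpow_add hT0, Real.rpow_one]
  congr 1
  field_simp

/-- The discrete tail is linear in `n`, and the geometric time behind the resolvent has mean of
order `T`. -/
theorem resolvent_tail [Countable V] (h : PowerBounds P ρ a) (hℓ : Reversible P ℓ) :
    ∃ C : ℝ, 0 < C ∧ ∀ (T R : ℝ) (x : V), 1 ≤ T → 1 ≤ R →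
      ∑' y, Set.indicator {y | R < ρ x y} (fun y => resolvent (lazy ℓ P) T x y) y ≤
        ENNReal.ofReal (C * T / R) := by
  obtain ⟨C, hC, ht⟩ := h.tail_le
  obtain ⟨c, hc, hcl⟩ := hℓ.exists_le
  refine ⟨2 * c⁻¹ * C, by positivity, fun T R x hT hR => ?_⟩
  have hT0 : 0 < T := by linarith
  have hR0 : 0 < R := by linarith
  have hθ1 : T / (1 + T) ≤ 1 := by rw [div_le_one (by positivity)]; linarith
  set E : Set V := {y | R < ρ x y} with hE
  calc ∑' y, Set.indicator E (fun y => resolvent (lazy ℓ P) T x y) y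
      ≤ ∑' y, ∑' n : ℕ, ENNReal.ofReal (1 / (1 + T) * c⁻¹ * (T / (1 + T)) ^ n) *
          Set.indicator E (fun y => (P ^ n) x y) y := by
        refine ENNReal.tsum_le_tsum fun y => ?_
        by_cases hy : y ∈ E
        · simp only [hy, Set.indicator_of_mem]
          rw [resolvent_apply]
          refine (mul_le_mul' le_rfl (geom_lazy_le hc hcl hℓ.le_one
            (ENNReal.ofReal_le_one.2 hθ1) x y)).trans (le_of_eq ?_)
          rw [geom_apply, ← mul_assoc, ← ENNReal.tsum_mul_left]
          refine tsum_congr fun n => ?_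
          rw [← ENNReal.ofReal_pow (by positivity), ← mul_assoc,
            ← ENNReal.ofReal_mul (by positivity), ← ENNReal.ofReal_mul (by positivity)]
        · simp [hy]
    _ = ∑' n : ℕ, ENNReal.ofReal (1 / (1 + T) * c⁻¹ * (T / (1 + T)) ^ n) *
          ∑' y, Set.indicator E (fun y => (P ^ n) x y) y := by
        rw [ENNReal.tsum_comm]
        exact tsum_congr fun n => ENNReal.tsum_mul_left
    _ ≤ ∑' n : ℕ, ENNReal.ofReal (1 / (1 + T) * c⁻¹ * C / R) *
          ENNReal.ofReal (((n + 1).choose 1 : ℝ) * (T / (1 + T)) ^ n) := by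
        refine ENNReal.tsum_le_tsum fun n => ?_
        refine (mul_le_mul' le_rfl (ht n x R hR)).trans ?_
        rw [← ENNReal.ofReal_mul (by positivity), ← ENNReal.ofReal_mul (by positivity)]
        refine ENNReal.ofReal_le_ofReal ?_
        rw [Nat.choose_one_right]
        have : (n : ℝ) ≤ ((n + 1 : ℕ) : ℝ) := by push_cast; linarith
        calc _ = 1 / (1 + T) * c⁻¹ * C / R * (n * (T / (1 + T)) ^ n) := by ring
          _ ≤ _ := by gcongr
    _ = ENNReal.ofReal (1 / (1 + T) * c⁻¹ * C / R * (1 + T) ^ 2) := by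
        rw [ENNReal.tsum_mul_left, tsum_choose_mul_pow hT0, ← ENNReal.ofReal_mul (by positivity)]
    _ ≤ _ := by
        refine ENNReal.ofReal_le_ofReal ?_
        calc _ = (1 + T) * (c⁻¹ * C / R) := by field_simp
          _ ≤ (2 * T) * (c⁻¹ * C / R) := by gcongr; linarith
          _ = _ := by ring

/-- The heat kernel is almost harmonic for the resolvent when `T` is small compared with `t`: the
time increment over `u` is at most of order `(u / t) t ^ (-a)`, and the exponential average of `u`
is `T`. -/
theorem heat_sub_resolvent [Countable V] (h : PowerBounds P ρ a) (hℓ : Reversible P ℓ) :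
    ∃ C : ℝ, 0 < C ∧ ∀ (T t : ℝ) (x y : V), 0 < T → 2 ≤ t →
      heat (lazy ℓ P) t x y ≤ ∑' z, resolvent (lazy ℓ P) T y z * heat (lazy ℓ P) t x z +
        ENNReal.ofReal (C * (T / t) * t ^ (-a)) ∧
      ∑' z, resolvent (lazy ℓ P) T y z * heat (lazy ℓ P) t x z ≤ heat (lazy ℓ P) t x y +
        ENNReal.ofReal (C * (T / t) * t ^ (-a)) := by
  obtain ⟨C, hC, hb⟩ := h.heat_self_upper hℓ
  have hQ := h.lazy_stochastic hℓ
  refine ⟨8 * C * 2 ^ a, by positivity, fun T t x y hT ht => ?_⟩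
  have ht0 : 0 < t := by linarith
  have hdiff : ∀ u : ℝ, 0 < u → heat (lazy ℓ P) t x y ≤ heat (lazy ℓ P) (t + u) x y +
        ENNReal.ofReal (8 * C * 2 ^ a * (u / t) * t ^ (-a)) ∧
      heat (lazy ℓ P) (t + u) x y ≤ heat (lazy ℓ P) t x y +
        ENNReal.ofReal (8 * C * 2 ^ a * (u / t) * t ^ (-a)) := by
    intro u hu
    have h1 := abs_toReal_heat_sub_le hQ hℓ.symm ht0 hu.le x y
    have hx := ENNReal.toReal_le_of_le_ofReal (by positivity) (hb (t / 2) x (by linarith))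
    have hy := ENNReal.toReal_le_of_le_ofReal (by positivity) (hb (t / 2) y (by linarith))
    have e : (t / 2) ^ (-a) = 2 ^ a * t ^ (-a) := by
      rw [Real.div_rpow ht0.le two_pos.le, Real.rpow_neg two_pos.le, div_inv_eq_mul, mul_comm]
    rw [e] at hx hy
    have h2 : 4 * (u / t) * ((heat (lazy ℓ P) (t / 2) x x).toReal +
        (heat (lazy ℓ P) (t / 2) y y).toReal) ≤ 8 * C * 2 ^ a * (u / t) * t ^ (-a) := by
      calc _ ≤ 4 * (u / t) * (C * (2 ^ a * t ^ (-a)) + C * (2 ^ a * t ^ (-a))) := by gcongr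
        _ = _ := by ring
    have h3 := abs_le.1 (h1.trans h2)
    have hf := heat_ne_top hQ ht0.le x y
    have hf' := heat_ne_top hQ (by positivity : 0 ≤ t + u) x y
    have hw : 0 ≤ 8 * C * 2 ^ a * (u / t) * t ^ (-a) := by positivity
    rw [← ENNReal.ofReal_toReal hf, ← ENNReal.ofReal_toReal hf',
      ← ENNReal.ofReal_add ENNReal.toReal_nonneg hw, ← ENNReal.ofReal_add ENNReal.toReal_nonneg hw]
    exact ⟨ENNReal.ofReal_le_ofReal (by linarith), ENNReal.ofReal_le_ofReal (by linarith)⟩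
  have hm : Measurable fun u => heat (lazy ℓ P) (t + u) x y :=
    (measurable_heat _ x y).comp (measurable_const_add t)
  have hmass : ∀ w : ℝ≥0∞, ∫⁻ u in Set.Ioi (0 : ℝ),
      ENNReal.ofReal (T⁻¹ * Real.exp (-(T⁻¹ * u))) * w = w := by
    intro w
    have := Real.lintegral_pow_mul_exp_neg_mul_Ioi 0 (inv_pos.2 hT)
    simp only [pow_zero, one_mul, Nat.factorial_zero, Nat.cast_one, zero_add, pow_one] at this
    simp_rw [ENNReal.ofReal_mul (inv_nonneg.2 hT.le)]
    rw [lintegral_mul_const _ (by fun_prop), lintegral_const_mul _ (by fun_prop), this,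
      ← ENNReal.ofReal_mul (by positivity)]
    have : T⁻¹ * (1 / T⁻¹) = 1 := by field_simp
    rw [this, ENNReal.ofReal_one, one_mul]
  have herr : ∫⁻ u in Set.Ioi (0 : ℝ), ENNReal.ofReal (T⁻¹ * Real.exp (-(T⁻¹ * u))) *
      ENNReal.ofReal (8 * C * 2 ^ a * (u / t) * t ^ (-a)) =
      ENNReal.ofReal (8 * C * 2 ^ a * (T / t) * t ^ (-a)) := by
    have h1 := Real.lintegral_pow_mul_exp_neg_mul_Ioi 1 (inv_pos.2 hT)
    have h2 : ∀ u ∈ Set.Ioi (0 : ℝ), ENNReal.ofReal (T⁻¹ * Real.exp (-(T⁻¹ * u))) *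
        ENNReal.ofReal (8 * C * 2 ^ a * (u / t) * t ^ (-a)) =
        ENNReal.ofReal (T⁻¹ * (8 * C * 2 ^ a * (1 / t) * t ^ (-a))) *
          ENNReal.ofReal (u ^ 1 * Real.exp (-(T⁻¹ * u))) := by
      intro u hu
      have hu : 0 < u := hu
      rw [← ENNReal.ofReal_mul (by positivity), ← ENNReal.ofReal_mul (by positivity)]
      congr 1
      ring
    rw [setLIntegral_congr_fun measurableSet_Ioi h2, lintegral_const_mul _ (by fun_prop), h1,
      ← ENNReal.ofReal_mul (by positivity)]
    congr 1
    simp only [Nat.factorial_one, Nat.cast_one, one_mul, one_div, inv_inv]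
    field_simp
  rw [resolvent_heat_eq hℓ.symm ht0.le hT]
  constructor
  · rw [← herr, ← lintegral_add_left (by exact Measurable.mul (by fun_prop) hm)]
    calc _ = _ := (hmass _).symm
      _ ≤ _ := by
        refine setLIntegral_mono' measurableSet_Ioi fun u hu => ?_
        rw [← mul_add]
        exact mul_le_mul' le_rfl (hdiff u hu).1
  · rw [← herr]
    conv_rhs => rw [← hmass (heat (lazy ℓ P) t x y)]
    rw [← lintegral_add_left (by fun_prop)]
    refine setLIntegral_mono' measurableSet_Ioi fun u hu => ?_
    rw [← mul_add]
    exact mul_le_mul' le_rfl (hdiff u hu).2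

/-- The oscillation of an almost harmonic function decreases when passing to a smaller scale. -/
theorem oscillation_step [Countable V] (h : PowerBounds P ρ a) (hℓ : Reversible P ℓ) :
    ∃ c C M₀ : ℝ, 0 < c ∧ c ≤ 1 ∧ 0 < C ∧ 1 ≤ M₀ ∧ ∀ (T M : ℝ) (φ : V → ℝ≥0∞) (B ω η : ℝ≥0∞),
      1 ≤ T → M₀ ≤ M → (∀ z, φ z ≤ B) → (∀ z z', ρ z z' ≤ M * T → φ z ≤ φ z' + ω) →
      (∀ z, φ z ≤ ∑' w, resolvent (lazy ℓ P) T z w * φ w + η) →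
      (∀ z, ∑' w, resolvent (lazy ℓ P) T z w * φ w ≤ φ z + η) →
      ∀ x y, ρ x y ≤ T →
        φ x ≤ φ y + (ENNReal.ofReal (1 - c) * ω + ENNReal.ofReal (C / M) * B + 2 * η) := by
  obtain ⟨K, hK, hquasi⟩ := h.quasi
  obtain ⟨c₁, hc₁, hlow⟩ := h.resolvent_lower hℓ (κ := 2 * K) (by linarith)
  obtain ⟨c₂, hc₂, hball⟩ := h.ballCard_lower
  obtain ⟨C, hC, htail⟩ := h.resolvent_tail hℓ
  have hQ := h.lazy_stochastic hℓ
  have hK0 : 0 < K := by linarith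
  refine ⟨min (c₁ * c₂) 1, 8 * K ^ 2 * C, 4 * K ^ 2, by positivity, min_le_right _ _,
    by positivity, by nlinarith, ?_⟩
  intro T M φ B ω η hT hM hφB hω hη₁ hη₂ x y hxy
  have hT0 : 0 < T := by linarith
  have hM0 : 0 < M := by nlinarith
  set Q := resolvent (lazy ℓ P) T with hQdef
  have hQs : Q.IsStochastic := hQ.resolvent hT0
  -- Doeblin minorisation: rows of the resolvent started within `T` of `x` dominate the same measure
  -- `ν`, whose mass is at least a fixed constant. The factor `2 K` in the lower bound comes from
  -- the quasi-triangle inequality.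
  set ν : V → ℝ≥0∞ := fun z => ENNReal.ofReal (c₁ * T ^ (-a)) *
    Set.indicator {z | ρ x z ≤ T} 1 z with hν
  have hνle : ∀ w, ρ x w ≤ T → ∀ z, ν z ≤ Q w z := by
    intro w hw z
    by_cases hz : ρ x z ≤ T
    · simp only [hν, Set.mem_ofPred_eq, hz, Set.indicator_of_mem, Pi.one_apply, mul_one]
      refine hlow T w z hT ?_
      have := hquasi w x z
      rw [h.rho_symm w x] at this
      nlinarith
    · simp [hν, hz]
  have hνx := hνle x (by rw [h.rho_self]; exact hT0.le)
  have hνy := hνle y hxy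
  have hνmass : ENNReal.ofReal (min (c₁ * c₂) 1) ≤ ∑' z, ν z := by
    calc ENNReal.ofReal (min (c₁ * c₂) 1)
        ≤ ENNReal.ofReal (c₁ * T ^ (-a)) * ENNReal.ofReal (c₂ * T ^ a) := by
          rw [← ENNReal.ofReal_mul (by positivity)]
          refine ENNReal.ofReal_le_ofReal ((min_le_left _ _).trans (le_of_eq ?_))
          rw [Real.rpow_neg hT0.le]
          field_simp
      _ ≤ ENNReal.ofReal (c₁ * T ^ (-a)) * ballCard ρ x T := by
          gcongr
          exact hball x T hT
      _ = ∑' z, ν z := by rw [ballCard, ENNReal.tsum_mul_left]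
  have hνtop : ∑' z, ν z ≠ ∞ := by
    refine ((ENNReal.tsum_le_tsum hνx).trans_lt ?_).ne
    rw [hQs x]
    exact ENNReal.one_lt_top
  have hrest : ∀ w, (∀ z, ν z ≤ Q w z) → ∑' z, (Q w z - ν z) = 1 - ∑' z, ν z := by
    intro w hw
    refine ENNReal.eq_sub_of_add_eq hνtop ?_
    rw [← ENNReal.tsum_add, ← hQs w]
    exact tsum_congr fun z => tsub_add_cancel_of_le (hw z)
  have hsplit : ∀ w, (∀ z, ν z ≤ Q w z) →
      ∑' z, Q w z * φ z = ∑' z, (Q w z - ν z) * φ z + ∑' z, ν z * φ z := by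
    intro w hw
    rw [← ENNReal.tsum_add]
    exact tsum_congr fun z => by rw [← add_mul, tsub_add_cancel_of_le (hw z)]
  set m : ℝ≥0∞ := 1 - ∑' z, ν z with hm
  have hmle : m ≤ ENNReal.ofReal (1 - min (c₁ * c₂) 1) := by
    rw [ENNReal.ofReal_sub _ (by positivity), ENNReal.ofReal_one]
    exact tsub_le_tsub_left hνmass 1
  set R : ℝ := M * T / (2 * K) with hR
  set R' : ℝ := M * T / (4 * K ^ 2) with hR'
  have hR'1 : 1 ≤ R' := by
    rw [hR', one_le_div (by positivity)]
    nlinarith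
  have hRR' : R = 2 * K * R' := by rw [hR, hR']; field_simp; ring
  have hTR' : T ≤ R' := by
    rw [hR', le_div_iff₀ (by positivity)]
    nlinarith
  have hR'R : R' ≤ R := by rw [hRR']; nlinarith
  set ε : ℝ≥0∞ := ENNReal.ofReal (C * T / R') with hε
  have htx : ∑' z, Set.indicator {z | R < ρ x z} (fun z => Q x z) z ≤ ε := by
    refine (ENNReal.tsum_le_tsum fun z => ?_).trans (htail T R' x hT hR'1)
    refine Set.indicator_le_indicator_of_subset (fun z hz => ?_) (fun _ => zero_le) z
    exact hR'R.trans_lt hz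
  have hty : ∑' z, Set.indicator {z | R < ρ x z} (fun z => Q y z) z ≤ ε := by
    refine (ENNReal.tsum_le_tsum fun z => ?_).trans (htail T R' y hT hR'1)
    refine Set.indicator_le_indicator_of_subset (fun z hz => ?_) (fun _ => zero_le) z
    have hz : R < ρ x z := hz
    have h1 := hquasi x y z
    rw [Set.mem_ofPred_eq]
    by_contra hcon
    push Not at hcon
    have : K * (ρ x y + ρ y z) ≤ K * (R' + R') := by gcongr; linarith
    linarith
  set lo : ℝ≥0∞ := ⨅ z : {z | ρ x z ≤ R}, φ z with hlo
  have hloB : lo ≤ B := (iInf_le _ ⟨x, by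
    rw [Set.mem_ofPred_eq, h.rho_self]; linarith⟩).trans (hφB x)
  have hup : ∀ z, ρ x z ≤ R → φ z ≤ lo + ω := by
    intro z hz
    rw [hlo, ENNReal.iInf_add]
    refine le_iInf fun z' => hω z z' ?_
    have h1 := hquasi z x z'
    rw [h.rho_symm z x] at h1
    have h2 : ρ x z' ≤ R := z'.2
    have h3 : M * T = K * (R + R) := by rw [hR]; field_simp; norm_num
    rw [h3]
    refine h1.trans ?_
    gcongr
  have hA : ∑' z, (Q x z - ν z) * φ z ≤ m * (lo + ω) + ε * B := by
    calc _ ≤ ∑' z, ((Q x z - ν z) * (lo + ω) +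
          Set.indicator {z | R < ρ x z} (fun z => Q x z) z * B) := by
          refine ENNReal.tsum_le_tsum fun z => ?_
          by_cases hz : R < ρ x z
          · refine le_add_of_nonneg_of_le zero_le ?_
            simp only [Set.mem_ofPred_eq, hz, Set.indicator_of_mem]
            exact mul_le_mul' tsub_le_self (hφB z)
          · exact le_add_of_le_of_nonneg (mul_le_mul' le_rfl (hup z (not_lt.1 hz))) zero_le
      _ ≤ _ := by
          rw [ENNReal.tsum_add, ENNReal.tsum_mul_right, ENNReal.tsum_mul_right, hrest x hνx]
          gcongr
  have hB : m * lo ≤ ∑' z, (Q y z - ν z) * φ z + ε * B := by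
    calc m * lo = ∑' z, (Q y z - ν z) * lo := by rw [ENNReal.tsum_mul_right, hrest y hνy]
      _ ≤ ∑' z, ((Q y z - ν z) * φ z +
          Set.indicator {z | R < ρ x z} (fun z => Q y z) z * B) := by
          refine ENNReal.tsum_le_tsum fun z => ?_
          by_cases hz : R < ρ x z
          · refine le_add_of_nonneg_of_le zero_le ?_
            simp only [Set.mem_ofPred_eq, hz, Set.indicator_of_mem]
            exact mul_le_mul' tsub_le_self hloB
          · refine le_add_of_le_of_nonneg (mul_le_mul' le_rfl ?_) zero_le
            exact iInf_le (fun z : {z | ρ x z ≤ R} => φ z) ⟨z, not_lt.1 hz⟩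
      _ ≤ _ := by
          rw [ENNReal.tsum_add, ENNReal.tsum_mul_right]
          gcongr
  have h2ε : ε + ε = ENNReal.ofReal (8 * K ^ 2 * C / M) := by
    rw [hε, ← ENNReal.ofReal_add (by positivity) (by positivity)]
    congr 1
    rw [hR']
    field_simp
    ring
  -- The integral of `φ` against `ν` is common to both points and is never estimated; only the
  -- remaining mass `m` sees the oscillation `ω`. Arranging the terms additively avoids subtraction
  -- in `[0, ∞]`.
  calc φ x ≤ ∑' z, Q x z * φ z + η := hη₁ x
    _ ≤ m * (lo + ω) + ε * B + ∑' z, ν z * φ z + η := by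
        rw [hsplit x hνx]
        gcongr
    _ = m * lo + (m * ω + ε * B + ∑' z, ν z * φ z + η) := by ring
    _ ≤ ∑' z, (Q y z - ν z) * φ z + ε * B + (m * ω + ε * B + ∑' z, ν z * φ z + η) := by gcongr
    _ = ∑' z, Q y z * φ z + (m * ω + (ε + ε) * B + η) := by rw [hsplit y hνy]; ring
    _ ≤ φ y + η + (ENNReal.ofReal (1 - min (c₁ * c₂) 1) * ω +
        ENNReal.ofReal (8 * K ^ 2 * C / M) * B + η) := by
        rw [h2ε]
        gcongr
        exact hη₂ y
    _ = _ := by ring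

/-- Descend through the scales `M ^ j T, …, M T, T`. Each step contracts the oscillation by `1 - c`
and adds at most `c ε / 2` in units of `t ^ (-a)`, a recursion with fixed point `ε / 2`. Large `M`
controls the spatial tail, large `L` the failure of harmonicity. -/
theorem heat_equicontinuous [Countable V] (h : PowerBounds P ρ a) (hℓ : Reversible P ℓ) {ε : ℝ}
    (hε : 0 < ε) : ∃ Λ : ℝ, 1 ≤ Λ ∧ ∀ (T t : ℝ) (o x y : V), 1 ≤ T → Λ * T ≤ t → ρ x y ≤ T →
      heat (lazy ℓ P) t o x ≤ heat (lazy ℓ P) t o y + ENNReal.ofReal (ε * t ^ (-a)) := by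
  obtain ⟨c, C, M₀, hc, hc1, hC, hM₀, hstep⟩ := h.oscillation_step hℓ
  obtain ⟨C₁, hC₁, hup⟩ := h.heat_upper hℓ
  obtain ⟨C₂, hC₂, hres⟩ := h.heat_sub_resolvent hℓ
  set M : ℝ := max M₀ (4 * C * C₁ / (c * ε)) with hM
  set L : ℝ := max 2 (8 * C₂ / (c * ε)) with hL
  have hMM₀ : M₀ ≤ M := le_max_left _ _
  have hM1 : 1 ≤ M := hM₀.trans hMM₀
  have hL2 : 2 ≤ L := le_max_left _ _
  have hMle : C * C₁ / M ≤ c * ε / 4 := by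
    have : 4 * C * C₁ / (c * ε) ≤ M := le_max_right _ _
    rw [div_le_iff₀ (by positivity)] at this
    rw [div_le_div_iff₀ (by positivity) (by norm_num)]
    linarith
  have hLle : 2 * C₂ / L ≤ c * ε / 4 := by
    have : 8 * C₂ / (c * ε) ≤ L := le_max_right _ _
    rw [div_le_iff₀ (by positivity)] at this
    rw [div_le_div_iff₀ (by positivity) (by norm_num)]
    linarith
  have key : ∀ j : ℕ, ∀ (T t : ℝ) (o x y : V), 1 ≤ T → M ^ j * L * T ≤ t → ρ x y ≤ T →
      heat (lazy ℓ P) t o x ≤ heat (lazy ℓ P) t o y +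
        ENNReal.ofReal (((1 - c) ^ j * C₁ + ε / 2) * t ^ (-a)) := by
    have hbound : ∀ (t : ℝ) (o x : V), 0 < t →
        heat (lazy ℓ P) t o x ≤ ENNReal.ofReal (C₁ * t ^ (-a)) := by
      intro t o x ht
      refine (hup t o x ht.le).trans (ENNReal.ofReal_le_ofReal ?_)
      have := Real.rpow_le_rpow_of_nonpos ht (show t ≤ 1 + t by linarith)
        (neg_nonpos.2 h.pos.le)
      gcongr
    intro j
    induction j with
    | zero =>
      intro T t o x y hT ht hxy
      have ht0 : 0 < t := by
        rw [pow_zero, one_mul] at ht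
        nlinarith
      refine le_add_of_nonneg_of_le zero_le ((hbound t o x ht0).trans
        (ENNReal.ofReal_le_ofReal ?_))
      rw [pow_zero, one_mul]
      gcongr
      linarith
    | succ j ih =>
      intro T t o x y hT ht hxy
      have hMj : 1 ≤ M ^ (j + 1) := one_le_pow₀ hM1
      have hLT : L * T ≤ t := by
        refine le_trans ?_ ht
        rw [mul_assoc]
        exact le_mul_of_one_le_left (by positivity) hMj
      have ht0 : 2 ≤ t := by nlinarith
      have hTt : T / t ≤ 1 / L := by
        rw [div_le_div_iff₀ (by positivity) (by positivity)]
        linarith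
      have h1c : 0 ≤ 1 - c := by linarith
      have h1 := hstep T M (fun z => heat (lazy ℓ P) t o z) (ENNReal.ofReal (C₁ * t ^ (-a)))
        (ENNReal.ofReal (((1 - c) ^ j * C₁ + ε / 2) * t ^ (-a)))
        (ENNReal.ofReal (C₂ * (T / t) * t ^ (-a))) hT hMM₀ (fun z => hbound t o z (by linarith))
        (fun z z' hzz' => ih (M * T) t o z z' (by nlinarith) (by
          refine le_trans (le_of_eq ?_) ht
          ring) hzz')
        (fun z => (hres T t o z (by linarith) ht0).1)
        (fun z => (hres T t o z (by linarith) ht0).2) x y hxy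
      refine h1.trans ?_
      have e2 : (2 : ℝ≥0∞) = ENNReal.ofReal 2 := by norm_num
      rw [e2, ← ENNReal.ofReal_mul h1c, ← ENNReal.ofReal_mul (by positivity),
        ← ENNReal.ofReal_mul (by norm_num), ← ENNReal.ofReal_add (by positivity) (by positivity),
        ← ENNReal.ofReal_add (by positivity) (by positivity)]
      gcongr
      have hp : 0 ≤ t ^ (-a) := by positivity
      calc (1 - c) * (((1 - c) ^ j * C₁ + ε / 2) * t ^ (-a)) + C / M * (C₁ * t ^ (-a)) +
            2 * (C₂ * (T / t) * t ^ (-a))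
          = ((1 - c) ^ (j + 1) * C₁ + (1 - c) * (ε / 2) + C * C₁ / M + 2 * C₂ * (T / t)) *
            t ^ (-a) := by ring
        _ ≤ ((1 - c) ^ (j + 1) * C₁ + (1 - c) * (ε / 2) + c * ε / 4 + c * ε / 4) * t ^ (-a) := by
            have : 2 * C₂ * (T / t) ≤ c * ε / 4 := by
              refine le_trans ?_ hLle
              calc 2 * C₂ * (T / t) ≤ 2 * C₂ * (1 / L) := by gcongr
                _ = _ := by ring
            gcongr
        _ = _ := by ring
  have hlim : ∃ j : ℕ, (1 - c) ^ j * C₁ ≤ ε / 2 := by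
    obtain ⟨j, hj⟩ := exists_pow_lt_of_lt_one (show 0 < ε / 2 / C₁ by positivity)
      (show 1 - c < 1 by linarith)
    refine ⟨j, ?_⟩
    rw [lt_div_iff₀ hC₁] at hj
    exact hj.le
  obtain ⟨j, hj⟩ := hlim
  have hMj : 1 ≤ M ^ j := one_le_pow₀ hM1
  refine ⟨M ^ j * L, by nlinarith, fun T t o x y hT ht hxy => (key j T t o x y hT ht hxy).trans ?_⟩
  have ht0 : 0 < t := by
    have : 0 < M ^ j * L * T := by positivity
    linarith
  gcongr
  linarith

/-- The diagonal value survives up to a spatial variation of at most half its lower bound. -/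
theorem heat_lower [Countable V] (h : PowerBounds P ρ a) (hℓ : Reversible P ℓ) :
    ∃ Λ c : ℝ, 1 ≤ Λ ∧ 0 < c ∧ ∀ (T t : ℝ) (x y : V), 1 ≤ T → Λ * T ≤ t → ρ x y ≤ T →
      ENNReal.ofReal (c * t ^ (-a)) ≤ heat (lazy ℓ P) t x y := by
  obtain ⟨c, hc, hl⟩ := h.heat_self_lower hℓ
  obtain ⟨Λ, hΛ, he⟩ := h.heat_equicontinuous hℓ (half_pos hc)
  refine ⟨Λ, c / 2, hΛ, half_pos hc, fun T t x y hT ht hxy => ?_⟩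
  have ht1 : 1 ≤ t := by nlinarith
  have ht0 : 0 < t := by linarith
  have h1 := (hl t x ht1).trans (he T t x x y hT ht hxy)
  have h2 : ENNReal.ofReal (c * t ^ (-a)) =
      ENNReal.ofReal (c / 2 * t ^ (-a)) + ENNReal.ofReal (c / 2 * t ^ (-a)) := by
    rw [← ENNReal.ofReal_add (by positivity) (by positivity)]
    congr 1
    ring
  rw [h2] at h1
  exact (ENNReal.add_le_add_iff_right ENNReal.ofReal_ne_top).1 h1

end PowerBounds

end

end InfMatrix

/-! ### The law of the walk and powers of its transition matrix -/

theorem ProbabilityTheory.Kernel.trajMeasure_dirac {X : ℕ → Type*} [∀ n, MeasurableSpace (X n)]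
    (κ : (n : ℕ) → Kernel ((i : Finset.Iic n) → X i) (X (n + 1))) [∀ n, IsMarkovKernel (κ n)]
    (x : X 0) : Kernel.trajMeasure (Measure.dirac x) κ =
      Kernel.traj κ 0 ((MeasurableEquiv.piUnique (fun i : Finset.Iic 0 => X i)).symm x) := by
  have h : Measure.map (MeasurableEquiv.piUnique (fun i : Finset.Iic 0 => X i)).symm
      (Measure.dirac x) =
      Measure.dirac ((MeasurableEquiv.piUnique (fun i : Finset.Iic 0 => X i)).symm x) :=
    Measure.map_dirac' (MeasurableEquiv.measurable _) _
  exact (congrArg (fun μ => Measure.bind μ (Kernel.traj κ 0)) h).trans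
    (Measure.dirac_bind (Kernel.measurable _) _)

namespace WeightedGraph

noncomputable section

variable {V V₁ V₂ : Type*}

theorem mem_nbrs {W : WeightedGraph V} {x y : V} : y ∈ W.nbrs x ↔ W.graph.Adj x y := by
  simp [nbrs]

theorem weight_eq_zero {W : WeightedGraph V} {x y : V} (h : ¬ W.graph.Adj x y) :
    W.weight x y = 0 :=
  le_antisymm (not_lt.1 fun h' => h ((W.weight_pos_iff x y).1 h')) (W.weight_nonneg x y)

theorem weight_self (W : WeightedGraph V) (x : V) : W.weight x x = 0 :=
  weight_eq_zero (W.graph.irrefl)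

theorem ofReal_vertexWeight (W : WeightedGraph V) (x : V) :
    ENNReal.ofReal (W.vertexWeight x) = ∑' y, ENNReal.ofReal (W.weight x y) := by
  rw [vertexWeight, ENNReal.ofReal_sum_of_nonneg fun y _ => W.weight_nonneg x y,
    tsum_eq_sum fun y hy => ?_]
  rw [weight_eq_zero (mt mem_nbrs.2 hy), ENNReal.ofReal_zero]

theorem vertexWeight_nonneg (W : WeightedGraph V) (x : V) : 0 ≤ W.vertexWeight x :=
  Finset.sum_nonneg fun y _ => W.weight_nonneg x y

/-- The transition matrix of the walk. -/
def transMatrix (W : WeightedGraph V) : InfMatrix V := ⟨fun x y => ENNReal.ofReal (W.transProb x y)⟩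

theorem transMatrix_apply (W : WeightedGraph V) (x y : V) :
    W.transMatrix x y = ENNReal.ofReal (W.transProb x y) := rfl

theorem ofReal_vertexWeight_mul_transMatrix [Nontrivial V] (W : WeightedGraph V) (x y : V) :
    ENNReal.ofReal (W.vertexWeight x) * W.transMatrix x y = ENNReal.ofReal (W.weight x y) := by
  rw [transMatrix_apply, transProb, ← ENNReal.ofReal_mul (W.vertexWeight_nonneg x),
    mul_div_cancel₀ _ (W.vertexWeight_pos x).ne']

theorem isStochastic_transMatrix [Nontrivial V] (W : WeightedGraph V) :
    W.transMatrix.IsStochastic := by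
  intro x
  have h : ENNReal.ofReal (W.vertexWeight x) * ∑' y, W.transMatrix x y =
      ENNReal.ofReal (W.vertexWeight x) * 1 := by
    rw [← ENNReal.tsum_mul_left]
    simp_rw [ofReal_vertexWeight_mul_transMatrix]
    rw [mul_one, ofReal_vertexWeight]
  exact (ENNReal.mul_right_inj (by simpa using W.vertexWeight_pos x) ENNReal.ofReal_ne_top).1 h

section Walk

variable [MeasurableSpace V] [DiscreteMeasurableSpace V]

theorem stepKernel_singleton (W : WeightedGraph V) (x y : V) :
    W.stepKernel x {y} = W.transMatrix x y := by
  classical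
  change (∑ z ∈ W.nbrs x, ENNReal.ofReal (W.transProb x z) • Measure.dirac z : Measure V) {y} = _
  simp only [Measure.coe_finsetSum, Measure.coe_smul, Finset.sum_apply, Pi.smul_apply,
    smul_eq_mul, Measure.dirac_apply, Set.indicator_apply, Set.mem_singleton_iff, Pi.one_apply,
    mul_ite, mul_one, mul_zero, Finset.sum_ite_eq', mem_nbrs]
  split_ifs with h
  · rfl
  · rw [transMatrix_apply, transProb, weight_eq_zero h, zero_div, ENNReal.ofReal_zero]

theorem law_zero [Nontrivial V] (W : WeightedGraph V) (x y : V) :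
    W.law x {z | z 0 = y} = (1 : InfMatrix V) x y := by
  classical
  rw [law, Kernel.trajMeasure_dirac]
  have h := Kernel.traj_map_frestrictLe_apply (X := fun _ => V) (κ := W.historyKernel) 0 0
    ((MeasurableEquiv.piUnique (fun _ : Finset.Iic 0 => V)).symm x)
  rw [Kernel.partialTraj_self, Kernel.id_apply] at h
  have hset : {z : ℕ → V | z 0 = y} = (Preorder.frestrictLe 0) ⁻¹'
      {w : (_ : Finset.Iic 0) → V | w ⟨0, Finset.mem_Iic.2 le_rfl⟩ = y} := rfl
  have hms : MeasurableSet {w : (_ : Finset.Iic 0) → V | w ⟨0, Finset.mem_Iic.2 le_rfl⟩ = y} := by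
    change MeasurableSet ((fun w : (_ : Finset.Iic 0) → V => w ⟨0, Finset.mem_Iic.2 le_rfl⟩) ⁻¹'
      {y})
    exact measurable_pi_apply _ MeasurableSet.of_discrete
  rw [hset, ← Measure.map_apply (by fun_prop) hms]
  erw [h]
  rw [Measure.dirac_apply' _ hms]
  by_cases hxy : x = y
  · subst hxy
    rw [Set.indicator_of_mem]
    · simp
    · rfl
  · rw [InfMatrix.one_apply_ne hxy, Set.indicator_of_notMem]
    exact hxy

/-- Markov property: the joint law of history and next state is a composition product, and the
kernel depends on the history only through its last state. -/
theorem law_succ [Nontrivial V] [Countable V] (W : WeightedGraph V) (x y : V) (n : ℕ) :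
    W.law x {z | z (n + 1) = y} = ∑' v, W.law x {z | z n = v} * W.transMatrix v y := by
  have h := Kernel.map_frestrictLe_trajMeasure_compProd_eq_map_trajMeasure (X := fun _ => V)
    (μ₀ := Measure.dirac x) (κ := W.historyKernel) (a := n)
  have h2 := congrArg (fun μ => μ (Set.univ ×ˢ {y})) h
  have hms : MeasurableSet (({y} : Set V)) := MeasurableSet.of_discrete
  rw [Measure.compProd_apply_prod MeasurableSet.univ hms, Measure.map_apply (by fun_prop)
    (MeasurableSet.univ.prod hms), Measure.restrict_univ,
    lintegral_map (Kernel.measurable_coe _ hms) (by fun_prop)] at h2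
  have hset : (fun z : ℕ → V => (Preorder.frestrictLe n z, z (n + 1))) ⁻¹' (Set.univ ×ˢ {y}) =
      {z : ℕ → V | z (n + 1) = y} := by
    ext z; simp
  rw [hset] at h2
  rw [law, ← h2]
  have h3 : ∀ z : ℕ → V, W.historyKernel n (Preorder.frestrictLe n z) {y} =
      W.transMatrix (z n) y := fun z => stepKernel_singleton W (z n) y
  simp_rw [h3]
  have h4 := lintegral_map (μ := Kernel.trajMeasure (X := fun _ => V) (Measure.dirac x)
    W.historyKernel) (f := fun v => W.transMatrix v y) (g := fun z : ℕ → V => z n)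
    Measurable.of_discrete (by fun_prop)
  rw [← h4, lintegral_countable']
  refine tsum_congr fun v => ?_
  rw [Measure.map_apply (by fun_prop) MeasurableSet.of_discrete, mul_comm]
  rfl

theorem law_eq [Nontrivial V] [Countable V] (W : WeightedGraph V) (x y : V) (n : ℕ) :
    W.law x {z | z n = y} = (W.transMatrix ^ n) x y := by
  induction n generalizing y with
  | zero => rw [pow_zero, law_zero]
  | succ n ih => rw [law_succ, pow_succ, InfMatrix.mul_apply]; simp_rw [ih]

theorem ofReal_heatKernel [Nontrivial V] [Countable V] (W : WeightedGraph V) (n : ℕ) (x y : V) :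
    ENNReal.ofReal (W.vertexWeight y) * ENNReal.ofReal (W.heatKernel n x y) =
      (W.transMatrix ^ n) x y := by
  have hy := W.vertexWeight_pos y
  rw [← ENNReal.ofReal_mul hy.le, heatKernel, mul_div_cancel₀ _ hy.ne', Measure.real, law_eq,
    ENNReal.ofReal_toReal]
  exact (((W.isStochastic_transMatrix.pow n).apply_le_one x y).trans_lt ENNReal.one_lt_top).ne

theorem heatKernel_nonneg [Nontrivial V] (W : WeightedGraph V) (n : ℕ) (x y : V) :
    0 ≤ W.heatKernel n x y := div_nonneg measureReal_nonneg (W.vertexWeight_nonneg y)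

theorem green_eq [Nontrivial V] [Countable V] (W : WeightedGraph V) (x y : V) :
    W.green x y = (ENNReal.ofReal (W.vertexWeight y))⁻¹ * InfMatrix.geom 1 W.transMatrix x y := by
  rw [green, lintegral_tsum, InfMatrix.geom_apply]
  · congr 1
    refine tsum_congr fun n => ?_
    have hms : MeasurableSet {z : ℕ → V | z n = y} := by
      change MeasurableSet ((fun z : ℕ → V => z n) ⁻¹' {y})
      exact measurable_pi_apply n MeasurableSet.of_discrete
    have : (fun z : ℕ → V => Set.indicator {y} (fun _ => (1 : ℝ≥0∞)) (z n)) =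
        Set.indicator {z | z n = y} 1 := by
      funext z
      by_cases h : z n = y <;> simp [h]
    rw [this, lintegral_indicator_one hms, law_eq, one_pow, one_mul]
  · intro n
    exact ((Measurable.of_discrete (f := Set.indicator {y} (fun _ => (1 : ℝ≥0∞)))).comp
      (measurable_pi_apply n)).aemeasurable

end Walk

end

end WeightedGraph

/-! ### From heat kernel conditions to power bounds; the product walk -/

namespace WeightedGraph

noncomputable section

variable {V V₁ V₂ : Type*}

theorem graphDist_self (W : WeightedGraph V) (x : V) : W.graphDist x x = 0 := by
  simp [graphDist]

theorem graphDist_nonneg (W : WeightedGraph V) (x y : V) : 0 ≤ W.graphDist x y :=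
  Nat.cast_nonneg _

theorem graphDist_comm (W : WeightedGraph V) (x y : V) : W.graphDist x y = W.graphDist y x := by
  simp [graphDist, SimpleGraph.dist_comm]

theorem graphDist_triangle (W : WeightedGraph V) (x y z : V) :
    W.graphDist x z ≤ W.graphDist x y + W.graphDist y z := by
  simp only [graphDist]
  exact_mod_cast W.connected.dist_triangle

theorem one_le_graphDist {W : WeightedGraph V} {x y : V} (h : x ≠ y) : 1 ≤ W.graphDist x y := by
  simp only [graphDist]
  exact_mod_cast W.connected.pos_dist_of_ne h

theorem graphDist_eq_zero_iff {W : WeightedGraph V} {x y : V} : W.graphDist x y = 0 ↔ x = y := by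
  refine ⟨fun h => ?_, fun h => h ▸ W.graphDist_self x⟩
  by_contra hne
  have := one_le_graphDist (W := W) hne
  linarith

section Walk

variable [MeasurableSpace V] [DiscreteMeasurableSpace V] [Countable V] [Nontrivial V]

theorem heatKernel_le (W : WeightedGraph V) (n : ℕ) (x y : V) :
    W.heatKernel n x y ≤ 1 / W.vertexWeight y := by
  have hy := W.vertexWeight_pos y
  have h := W.ofReal_heatKernel n x y
  have h1 := (W.isStochastic_transMatrix.pow n).apply_le_one x y
  rw [← h, ← ENNReal.ofReal_mul hy.le, ENNReal.ofReal_le_one] at h1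
  rw [le_div_iff₀ hy]
  linarith

/-- At `n = 1` and `x = y` the exponential factor in LHK is one, while each heat kernel is at most
`1 / λ_x`. -/
theorem exists_vertexWeight_le {W : WeightedGraph V} {α β : ℝ} (hβ : 1 < β)
    (hL : W.LHK W.graphDist α β) : ∃ C : ℝ, 0 < C ∧ ∀ x, W.vertexWeight x ≤ C := by
  obtain ⟨c, hc, h⟩ := hL
  refine ⟨2 / c, by positivity, fun x => ?_⟩
  have h1 := h x x 1 le_rfl (by simp)
  have e : (1 / (β - 1)) ≠ 0 := by
    have : 0 < β - 1 := by linarith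
    positivity
  rw [graphDist_self, Real.zero_rpow (by linarith), zero_div, Real.zero_rpow e, neg_zero,
    Real.exp_zero, Nat.cast_one, Real.one_rpow, mul_one, mul_one] at h1
  have hx := W.vertexWeight_pos x
  have h2 := W.heatKernel_le 1 x x
  have h3 := W.heatKernel_le (1 + 1) x x
  have h4 : c ≤ 2 / W.vertexWeight x := by
    refine h1.trans ((add_le_add h2 h3).trans (le_of_eq ?_))
    ring
  rw [le_div_iff₀ hx] at h4
  rw [le_div_iff₀ hc]
  linarith

/-- Stepping to a neighbour and back has probability at least `c₀ ^ 2` by `(p₀)`, and at most `C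
λ_x` by UHK at time two. -/
theorem exists_le_vertexWeight {W : WeightedGraph V} {α β : ℝ} (hα : 0 ≤ α) (hβ : 0 ≤ β)
    (hp : W.ControlledWeights) (hU : W.UHK W.graphDist α β) :
    ∃ c : ℝ, 0 < c ∧ ∀ x, c ≤ W.vertexWeight x := by
  obtain ⟨C, hC, h⟩ := hU
  obtain ⟨c₀, hc₀, hc⟩ := hp
  refine ⟨c₀ ^ 2 / C, by positivity, fun x => ?_⟩
  have hx := W.vertexWeight_pos x
  obtain ⟨y, hy⟩ := W.connected.preconnected.exists_adj_of_nontrivial x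
  have h1 := h x x 2 (by norm_num)
  have h2 : W.heatKernel 2 x x ≤ C := by
    refine h1.trans ?_
    have e1 : ((2 : ℕ) : ℝ) ^ (-(α / β)) ≤ 1 :=
      Real.rpow_le_one_of_one_le_of_nonpos (by norm_num) (neg_nonpos.2 (by positivity))
    have e2 : Real.exp (-((W.graphDist x x ^ β / (C * (2 : ℕ))) ^ (1 / (β - 1)))) ≤ 1 := by
      rw [Real.exp_le_one_iff, neg_nonpos, graphDist_self]
      positivity
    calc _ ≤ C * 1 * 1 := by gcongr
      _ = C := by ring
  have h3 : ENNReal.ofReal (c₀ ^ 2) ≤ (W.transMatrix ^ 2) x x := by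
    rw [pow_two, pow_two, InfMatrix.mul_apply]
    refine le_trans ?_ (ENNReal.le_tsum y)
    rw [ENNReal.ofReal_mul hc₀.le]
    exact mul_le_mul' (ENNReal.ofReal_le_ofReal (hc x y hy))
      (ENNReal.ofReal_le_ofReal (hc y x hy.symm))
  rw [← W.ofReal_heatKernel, ← ENNReal.ofReal_mul hx.le, ENNReal.ofReal_le_ofReal_iff
    (mul_nonneg hx.le (W.heatKernel_nonneg _ _ _))] at h3
  rw [div_le_iff₀ hC]
  exact h3.trans (by gcongr)

/-- The sub-Gaussian factor is a function of `ρ / n` with `ρ = d ^ β`. It absorbs any power of `ρ /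
n` in the upper bound and is bounded below when `ρ ≤ n`. -/
theorem powerBounds {W : WeightedGraph V} {α β : ℝ} (hα : 0 < α) (hβ : 1 < β)
    (hp : W.ControlledWeights) (hU : W.UHK W.graphDist α β) (hL : W.LHK W.graphDist α β) :
    InfMatrix.PowerBounds W.transMatrix (fun x y => W.graphDist x y ^ β) (α / β) := by
  obtain ⟨Λ, hΛ, hΛle⟩ := exists_vertexWeight_le hβ hL
  obtain ⟨μ, hμ, hμle⟩ := exists_le_vertexWeight hα.le (by linarith) hp hU
  have hβ0 : 0 < β := by linarith
  have hβ1 : 0 < β - 1 := by linarith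
  refine ⟨by positivity, W.isStochastic_transMatrix, fun x => ?_, fun x y => ?_, fun x y => ?_,
    ⟨2 ^ β, Real.one_le_rpow (by norm_num) hβ0.le, fun x y z => ?_⟩, fun b hb => ?_, ?_⟩
  · simp only [graphDist_self, Real.zero_rpow hβ0.ne']
  · exact Real.rpow_nonneg (W.graphDist_nonneg x y) β
  · simp only [W.graphDist_comm x y]
  · have h1 := W.graphDist_triangle x y z
    have hxy := W.graphDist_nonneg x y
    have hyz := W.graphDist_nonneg y z
    have h2 : W.graphDist x z ≤ 2 * max (W.graphDist x y) (W.graphDist y z) := by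
      linarith [le_max_left (W.graphDist x y) (W.graphDist y z),
        le_max_right (W.graphDist x y) (W.graphDist y z)]
    have h3 := Real.rpow_le_rpow (W.graphDist_nonneg x z) h2 hβ0.le
    rw [Real.mul_rpow two_pos.le (le_max_of_le_left hxy)] at h3
    refine h3.trans ?_
    gcongr
    have := Real.rpow_nonneg hxy β
    have := Real.rpow_nonneg hyz β
    rcases max_cases (W.graphDist x y) (W.graphDist y z) with ⟨h, _⟩ | ⟨h, _⟩ <;> rw [h] <;>
      linarith
  · obtain ⟨C, hC, h⟩ := hU
    -- With this exponent, `u ^ p = (r / (C n)) ^ b` below. The case `b = 0`, where `p = 0`, is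
    -- treated separately.
    set p : ℝ := b * (β - 1) with hp
    have hp0 : 0 ≤ p := by positivity
    refine ⟨Λ * (C * (C ^ b * p ^ p)), ?_, fun n x y hn => ?_⟩
    · have : 0 < p ^ p := by
        rcases hp0.eq_or_lt with hp0 | hp0
        · rw [← hp0, Real.rpow_zero]; exact one_pos
        · positivity
      positivity
    have hn0 : (0 : ℝ) < n := by exact_mod_cast hn
    have hy := W.vertexWeight_pos y
    set r : ℝ := W.graphDist x y ^ β with hr
    have hr0 : 0 ≤ r := Real.rpow_nonneg (W.graphDist_nonneg x y) β
    rw [← W.ofReal_heatKernel, ← ENNReal.ofReal_mul hy.le, ← ENNReal.ofReal_mul (by positivity)]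
    refine ENNReal.ofReal_le_ofReal ?_
    have h1 := h x y n hn
    rw [← hr] at h1
    set u : ℝ := (r / (C * n)) ^ (1 / (β - 1)) with hu
    have hu0 : 0 ≤ u := by positivity
    have h2 : r ^ b * Real.exp (-u) ≤ (C * n) ^ b * p ^ p := by
      have h3 : u ^ p ≤ p ^ p * Real.exp u := by
        rcases hp0.eq_or_lt with hp0 | hp0
        · rw [← hp0, Real.rpow_zero, Real.rpow_zero, one_mul]
          exact Real.one_le_exp hu0
        · exact Real.rpow_le_rpow_mul_exp hp0 hu0
      have h4 : u ^ p = r ^ b / (C * n) ^ b := by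
        have : 1 / (β - 1) * (b * (β - 1)) = b := by field_simp
        rw [hu, ← Real.rpow_mul (by positivity), hp, this, Real.div_rpow hr0 (by positivity)]
      rw [h4, div_le_iff₀ (by positivity)] at h3
      rw [Real.exp_neg, ← div_eq_mul_inv, div_le_iff₀ (Real.exp_pos _)]
      linarith
    calc r ^ b * (W.vertexWeight y * W.heatKernel n x y)
        ≤ r ^ b * (Λ * (C * (n : ℝ) ^ (-(α / β)) * Real.exp (-u))) := by
          have := hΛle y
          have := W.heatKernel_nonneg n x y
          gcongr
      _ = Λ * (C * (n : ℝ) ^ (-(α / β)) * (r ^ b * Real.exp (-u))) := by ring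
      _ ≤ Λ * (C * (n : ℝ) ^ (-(α / β)) * ((C * n) ^ b * p ^ p)) := by gcongr
      _ = _ := by
          rw [sub_eq_add_neg, Real.rpow_add hn0, Real.mul_rpow hC.le hn0.le]
          ring
  · obtain ⟨c, hc, h⟩ := hL
    refine ⟨μ * (c * Real.exp (-((1 / c) ^ (1 / (β - 1))))), by positivity, fun n x y hn hxy => ?_⟩
    have hn0 : (0 : ℝ) < n := by exact_mod_cast hn
    have hy := W.vertexWeight_pos y
    -- LHK is available only for `n` at least the graph distance; this follows from `d ^ β ≤ n`, as
    -- `d` is zero or at least one.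
    have hdist : W.graph.dist x y ≤ n := by
      rcases Nat.eq_zero_or_pos (W.graph.dist x y) with h0 | h0
      · rw [h0]; exact Nat.zero_le n
      · have h1 : (1 : ℝ) ≤ W.graphDist x y := by
          simp only [graphDist]; exact_mod_cast h0
        have h2 := Real.rpow_le_rpow_of_exponent_le h1 hβ.le
        rw [Real.rpow_one] at h2
        have h3 : W.graphDist x y ≤ n := h2.trans hxy
        simp only [graphDist] at h3
        exact_mod_cast h3
    have h1 := h x y n hn hdist
    rw [← W.ofReal_heatKernel, ← W.ofReal_heatKernel, ← mul_add, ← ENNReal.ofReal_add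
      (W.heatKernel_nonneg _ _ _) (W.heatKernel_nonneg _ _ _), ← ENNReal.ofReal_mul hy.le]
    refine ENNReal.ofReal_le_ofReal ?_
    have h2 : Real.exp (-((1 / c) ^ (1 / (β - 1)))) ≤
        Real.exp (-((W.graphDist x y ^ β / (c * n)) ^ (1 / (β - 1)))) := by
      refine Real.exp_le_exp.2 (neg_le_neg (Real.rpow_le_rpow ?_ ?_ (by positivity)))
      · exact div_nonneg (Real.rpow_nonneg (W.graphDist_nonneg x y) β) (by positivity)
      · rw [div_le_div_iff₀ (by positivity) hc]
        nlinarith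
    calc μ * (c * Real.exp (-((1 / c) ^ (1 / (β - 1))))) * (n : ℝ) ^ (-(α / β))
        = μ * (c * (n : ℝ) ^ (-(α / β)) * Real.exp (-((1 / c) ^ (1 / (β - 1))))) := by ring
      _ ≤ W.vertexWeight y * (W.heatKernel n x y + W.heatKernel (n + 1) x y) := by
          have h3 := hμle y
          gcongr
          refine le_trans ?_ h1
          gcongr

end Walk

theorem lazy_apply [Nontrivial V] (W : WeightedGraph V) {Λ : ℝ} (hΛ : 0 < Λ) (x y : V) :
    InfMatrix.lazy (fun x => W.vertexWeight x / Λ) W.transMatrix x y =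
      ENNReal.ofReal (1 - W.vertexWeight x / Λ) * (1 : InfMatrix V) x y +
        ENNReal.ofReal (W.weight x y / Λ) := by
  have hx := W.vertexWeight_pos x
  change _ + ENNReal.ofReal (W.vertexWeight x / Λ) * ENNReal.ofReal (W.transProb x y) = _
  rw [transProb, ← ENNReal.ofReal_mul (by positivity)]
  congr 2
  field_simp

/-- Moving with probability `λ_x / Λ` makes the off-diagonal entries `λ_{x,y} / Λ`, so reversibility
becomes symmetry. -/
theorem reversible [Nontrivial V] {W : WeightedGraph V} {c Λ : ℝ} (hc : 0 < c) (hΛ : 0 < Λ)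
    (hcW : ∀ x, c ≤ W.vertexWeight x) (hWΛ : ∀ x, W.vertexWeight x ≤ Λ) :
    InfMatrix.Reversible W.transMatrix (fun x => W.vertexWeight x / Λ) := by
  refine ⟨⟨c / Λ, by positivity, fun x => ?_⟩, fun x => ?_, fun x y => ?_⟩
  · have := hcW x
    gcongr
  · rw [div_le_one hΛ]; exact hWΛ x
  · rw [lazy_apply W hΛ, lazy_apply W hΛ, W.weight_symm x y]
    congr 1
    by_cases h : x = y
    · rw [h]
    · rw [InfMatrix.one_apply_ne h, InfMatrix.one_apply_ne (Ne.symm h), mul_zero, mul_zero]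

theorem ofReal_weight_prod (W₁ : WeightedGraph V₁) (W₂ : WeightedGraph V₂) (x y : V₁ × V₂) :
    ENNReal.ofReal ((W₁.prod W₂).weight x y) =
      ENNReal.ofReal (W₁.weight x.1 y.1) * (1 : InfMatrix V₂) x.2 y.2 +
        (1 : InfMatrix V₁) x.1 y.1 * ENNReal.ofReal (W₂.weight x.2 y.2) := by
  simp only [prod]
  by_cases h₁ : x.1 = y.1 <;> by_cases h₂ : x.2 = y.2 <;>
    simp [h₁, h₂, weight_self, InfMatrix.one_apply]

theorem vertexWeight_prod (W₁ : WeightedGraph V₁) (W₂ : WeightedGraph V₂) (x : V₁ × V₂) :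
    (W₁.prod W₂).vertexWeight x = W₁.vertexWeight x.1 + W₂.vertexWeight x.2 := by
  have h₁ := W₁.vertexWeight_nonneg x.1
  have h₂ := W₂.vertexWeight_nonneg x.2
  rw [← ENNReal.ofReal_eq_ofReal_iff ((W₁.prod W₂).vertexWeight_nonneg x) (add_nonneg h₁ h₂),
    ENNReal.ofReal_add h₁ h₂, ofReal_vertexWeight, ofReal_vertexWeight, ofReal_vertexWeight]
  simp_rw [ofReal_weight_prod]
  rw [ENNReal.tsum_add]
  congr 1
  · rw [ENNReal.tsum_prod']
    refine tsum_congr fun z => ?_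
    simp only
    rw [ENNReal.tsum_mul_left, InfMatrix.isStochastic_one, mul_one]
  · rw [ENNReal.tsum_prod', ENNReal.tsum_comm]
    refine tsum_congr fun z => ?_
    simp only
    rw [ENNReal.tsum_mul_right, InfMatrix.isStochastic_one, one_mul]

/-- Vertex weights add in the product, so a common `Λ` makes this identity exact. It is the reason
for introducing laziness. -/
theorem lazy_prod [Nontrivial V₁] [Nontrivial V₂] (W₁ : WeightedGraph V₁) (W₂ : WeightedGraph V₂)
    {Λ : ℝ} (hΛ : 0 < Λ) (h₁ : ∀ x, W₁.vertexWeight x ≤ Λ) (h₂ : ∀ x, W₂.vertexWeight x ≤ Λ) :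
    InfMatrix.lazy (fun x => (W₁.prod W₂).vertexWeight x / (2 * Λ)) (W₁.prod W₂).transMatrix =
      InfMatrix.scale (ENNReal.ofReal (1 / 2))
        (InfMatrix.kron (InfMatrix.lazy (fun x => W₁.vertexWeight x / Λ) W₁.transMatrix) 1 +
          InfMatrix.kron 1 (InfMatrix.lazy (fun x => W₂.vertexWeight x / Λ) W₂.transMatrix)) := by
  ext x y
  rw [lazy_apply _ (by positivity), InfMatrix.scale_apply, InfMatrix.add_apply,
    InfMatrix.kron_apply, InfMatrix.kron_apply, lazy_apply _ hΛ, lazy_apply _ hΛ,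
    vertexWeight_prod, ← InfMatrix.kron_one_one, InfMatrix.kron_apply,
    ENNReal.ofReal_div_of_pos (by positivity), ofReal_weight_prod]
  have h1 : 0 ≤ 1 - W₁.vertexWeight x.1 / Λ := by
    rw [sub_nonneg, div_le_one hΛ]; exact h₁ x.1
  have h2 : 0 ≤ 1 - W₂.vertexWeight x.2 / Λ := by
    rw [sub_nonneg, div_le_one hΛ]; exact h₂ x.2
  have e1 : ENNReal.ofReal (1 - (W₁.vertexWeight x.1 + W₂.vertexWeight x.2) / (2 * Λ)) =
      ENNReal.ofReal (1 / 2) * (ENNReal.ofReal (1 - W₁.vertexWeight x.1 / Λ) +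
        ENNReal.ofReal (1 - W₂.vertexWeight x.2 / Λ)) := by
    rw [← ENNReal.ofReal_add h1 h2, ← ENNReal.ofReal_mul (by norm_num)]
    congr 1
    field_simp
    ring
  have e2 : ∀ w : ℝ≥0∞, w / ENNReal.ofReal (2 * Λ) =
      ENNReal.ofReal (1 / 2) * (w / ENNReal.ofReal Λ) := by
    intro w
    rw [div_eq_mul_inv w (ENNReal.ofReal (2 * Λ)), div_eq_mul_inv w (ENNReal.ofReal Λ),
      ← ENNReal.ofReal_inv_of_pos (by positivity),
      ← ENNReal.ofReal_inv_of_pos hΛ, mul_inv, ENNReal.ofReal_mul (by positivity), one_div]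
    ring
  rw [e1, e2, ENNReal.ofReal_div_of_pos hΛ, ENNReal.ofReal_div_of_pos hΛ]
  simp only [div_eq_mul_inv]
  ring

section Green

variable [MeasurableSpace V₁] [DiscreteMeasurableSpace V₁] [Countable V₁] [Nontrivial V₁]
variable [MeasurableSpace V₂] [DiscreteMeasurableSpace V₂] [Countable V₂] [Nontrivial V₂]

/-- The integral is half the Green sum of the lazy product chain. Both comparisons of geometric
series apply at `θ = 1` with laziness between `c / Λ` and `1`; the division by `λ_y` costs only
constants. -/
theorem green_prod_bounds {W₁ : WeightedGraph V₁} {W₂ : WeightedGraph V₂} {c Λ : ℝ} (hc : 0 < c)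
    (hΛ : 0 < Λ) (hc₁ : ∀ x, c ≤ W₁.vertexWeight x) (hc₂ : ∀ x, c ≤ W₂.vertexWeight x)
    (h₁ : ∀ x, W₁.vertexWeight x ≤ Λ) (h₂ : ∀ x, W₂.vertexWeight x ≤ Λ) (x y : V₁ × V₂) :
    ENNReal.ofReal (c / Λ ^ 2) * ∫⁻ t in Set.Ioi (0 : ℝ),
        InfMatrix.heat (InfMatrix.lazy (fun x => W₁.vertexWeight x / Λ) W₁.transMatrix) t x.1 y.1 *
        InfMatrix.heat (InfMatrix.lazy (fun x => W₂.vertexWeight x / Λ) W₂.transMatrix) t x.2 y.2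
      ≤ (W₁.prod W₂).green x y ∧
    (W₁.prod W₂).green x y ≤ ENNReal.ofReal (1 / c) * ∫⁻ t in Set.Ioi (0 : ℝ),
        InfMatrix.heat (InfMatrix.lazy (fun x => W₁.vertexWeight x / Λ) W₁.transMatrix) t x.1 y.1 *
        InfMatrix.heat (InfMatrix.lazy (fun x => W₂.vertexWeight x / Λ) W₂.transMatrix) t x.2 y.2
      := by
  have hlow : ∀ x, c / Λ ≤ (W₁.prod W₂).vertexWeight x / (2 * Λ) := fun x => by
    rw [vertexWeight_prod, div_le_div_iff₀ hΛ (by positivity)]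
    nlinarith [hc₁ x.1, hc₂ x.2]
  have hup : ∀ x, (W₁.prod W₂).vertexWeight x / (2 * Λ) ≤ 1 := fun x => by
    rw [vertexWeight_prod, div_le_one (by positivity)]
    linarith [h₁ x.1, h₂ x.2]
  have hpos : ∀ x, 0 < (W₁.prod W₂).vertexWeight x := fun x => (W₁.prod W₂).vertexWeight_pos x
  rw [InfMatrix.lintegral_heat_mul_heat, ← lazy_prod W₁ W₂ hΛ h₁ h₂, green_eq,
    ← ENNReal.ofReal_inv_of_pos (hpos y)]
  constructor
  · have h := InfMatrix.geom_lazy_le (P := (W₁.prod W₂).transMatrix)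
      (div_pos hc hΛ) hlow hup (θ := 1) le_rfl x y
    calc _ ≤ ENNReal.ofReal (c / Λ ^ 2) * (ENNReal.ofReal (1 / 2) *
          (ENNReal.ofReal (c / Λ)⁻¹ * InfMatrix.geom 1 (W₁.prod W₂).transMatrix x y)) := by gcongr
      _ = ENNReal.ofReal (2 * Λ)⁻¹ * InfMatrix.geom 1 (W₁.prod W₂).transMatrix x y := by
          rw [← mul_assoc, ← mul_assoc, ← ENNReal.ofReal_mul (by positivity),
            ← ENNReal.ofReal_mul (by positivity)]
          congr 2
          field_simp
      _ ≤ _ := by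
          have h3 : (W₁.prod W₂).vertexWeight y ≤ 2 * Λ := by
            rw [vertexWeight_prod]; linarith [h₁ y.1, h₂ y.2]
          have := hpos y
          gcongr
  · have h := InfMatrix.geom_le_geom_lazy (P := (W₁.prod W₂).transMatrix)
      (div_pos hc hΛ) hlow hup (θ := 1) one_pos le_rfl x y
    have e : 1 * (c / Λ) / (1 - 1 + 1 * (c / Λ)) = 1 := by field_simp; ring
    rw [e, ENNReal.ofReal_one] at h
    calc _ ≤ ENNReal.ofReal (2 * c)⁻¹ * InfMatrix.geom 1 (InfMatrix.lazy
          (fun x => (W₁.prod W₂).vertexWeight x / (2 * Λ)) (W₁.prod W₂).transMatrix) x y := by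
          have h3 : 2 * c ≤ (W₁.prod W₂).vertexWeight y := by
            rw [vertexWeight_prod]; linarith [hc₁ y.1, hc₂ y.2]
          gcongr
      _ = _ := by
          rw [← mul_assoc, ← ENNReal.ofReal_mul (by positivity)]
          congr 2
          field_simp

end Green

end

end WeightedGraph

/-! ### Time integrals of products of heat kernels -/

namespace InfMatrix

namespace PowerBounds

variable {V₁ V₂ : Type*} {P₁ : InfMatrix V₁} {P₂ : InfMatrix V₂} {ρ₁ : V₁ → V₁ → ℝ}
  {ρ₂ : V₂ → V₂ → ℝ} {a₁ a₂ : ℝ} {ℓ₁ : V₁ → ℝ} {ℓ₂ : V₂ → ℝ}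

theorem lintegral_heat_mul_heat_le_of_left (h₁ : PowerBounds P₁ ρ₁ a₁)
    (h₂ : PowerBounds P₂ ρ₂ a₂) (hℓ₁ : Reversible P₁ ℓ₁) (hℓ₂ : Reversible P₂ ℓ₂)
    (ha : 1 < a₁ + a₂) : ∃ C : ℝ, 0 < C ∧ ∀ (D : ℝ) (x y : V₁) (x' y' : V₂), 1 ≤ D →
      D = 1 ∨ D ≤ ρ₁ x y →
      ∫⁻ t in Set.Ioi (0 : ℝ), heat (lazy ℓ₁ P₁) t x y * heat (lazy ℓ₂ P₂) t x' y' ≤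
        ENNReal.ofReal (C * D ^ (1 - (a₁ + a₂))) := by
  obtain ⟨C₁, hC₁, hb₁⟩ := h₁.lintegral_rpow_mul_heat_upper hℓ₁ h₂.pos ha
  obtain ⟨C₂, hC₂, hb₂⟩ := h₂.heat_upper hℓ₂
  refine ⟨C₂ * C₁, by positivity, fun D x y x' y' hD hxy => ?_⟩
  calc ∫⁻ t in Set.Ioi (0 : ℝ), heat (lazy ℓ₁ P₁) t x y * heat (lazy ℓ₂ P₂) t x' y'
      ≤ ∫⁻ t in Set.Ioi (0 : ℝ), ENNReal.ofReal C₂ *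
          (ENNReal.ofReal ((1 + t) ^ (-a₂)) * heat (lazy ℓ₁ P₁) t x y) := by
        refine setLIntegral_mono' measurableSet_Ioi fun t ht => ?_
        have := hb₂ t x' y' (le_of_lt ht)
        rw [ENNReal.ofReal_mul hC₂.le] at this
        rw [← mul_assoc, mul_comm]
        gcongr
    _ = ENNReal.ofReal C₂ * ∫⁻ t in Set.Ioi (0 : ℝ),
          ENNReal.ofReal ((1 + t) ^ (-a₂)) * heat (lazy ℓ₁ P₁) t x y :=
        lintegral_const_mul' _ _ ENNReal.ofReal_ne_top
    _ ≤ ENNReal.ofReal C₂ * ENNReal.ofReal (C₁ * D ^ (1 - a₁ - a₂)) := by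
        gcongr
        exact hb₁ D x y hD hxy
    _ = ENNReal.ofReal (C₂ * C₁ * D ^ (1 - (a₁ + a₂))) := by
        rw [← ENNReal.ofReal_mul hC₂.le, ← mul_assoc, sub_sub]

/-- The factor whose `ρ` reaches `D` keeps its kernel; the other is replaced by its uniform decay.
-/
theorem lintegral_heat_mul_heat_upper (h₁ : PowerBounds P₁ ρ₁ a₁)
    (h₂ : PowerBounds P₂ ρ₂ a₂) (hℓ₁ : Reversible P₁ ℓ₁) (hℓ₂ : Reversible P₂ ℓ₂)
    (ha : 1 < a₁ + a₂) : ∃ C : ℝ, 0 < C ∧ ∀ (D : ℝ) (x y : V₁) (x' y' : V₂), 1 ≤ D →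
      D = 1 ∨ D ≤ ρ₁ x y ∨ D ≤ ρ₂ x' y' →
      ∫⁻ t in Set.Ioi (0 : ℝ), heat (lazy ℓ₁ P₁) t x y * heat (lazy ℓ₂ P₂) t x' y' ≤
        ENNReal.ofReal (C * D ^ (1 - (a₁ + a₂))) := by
  obtain ⟨C₁, hC₁, hb₁⟩ := h₁.lintegral_heat_mul_heat_le_of_left h₂ hℓ₁ hℓ₂ ha
  obtain ⟨C₂, hC₂, hb₂⟩ := h₂.lintegral_heat_mul_heat_le_of_left h₁ hℓ₂ hℓ₁
    (by rwa [add_comm])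
  refine ⟨max C₁ C₂, by positivity, fun D x y x' y' hD hxy => ?_⟩
  have hD0 : 0 < D := by linarith
  have hleft : D = 1 ∨ D ≤ ρ₁ x y →
      ∫⁻ t in Set.Ioi (0 : ℝ), heat (lazy ℓ₁ P₁) t x y * heat (lazy ℓ₂ P₂) t x' y' ≤
        ENNReal.ofReal (max C₁ C₂ * D ^ (1 - (a₁ + a₂))) := fun h =>
    (hb₁ D x y x' y' hD h).trans (by gcongr; exact le_max_left _ _)
  rcases hxy with h | h | h
  · exact hleft (Or.inl h)
  · exact hleft (Or.inr h)
  · simp_rw [mul_comm (heat (lazy ℓ₁ P₁) _ x y)]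
    refine (hb₂ D x' y' x y hD (Or.inr h)).trans ?_
    rw [add_comm a₂]
    gcongr
    exact le_max_right _ _

/-- Beyond time `Λ D` the first kernel has a pointwise lower bound; for the second, an integrated
one suffices. -/
theorem lintegral_heat_mul_heat_lower [Countable V₁] (h₁ : PowerBounds P₁ ρ₁ a₁)
    (h₂ : PowerBounds P₂ ρ₂ a₂) (hℓ₁ : Reversible P₁ ℓ₁) (hℓ₂ : Reversible P₂ ℓ₂) :
    ∃ c : ℝ, 0 < c ∧ ∀ (D : ℝ) (x y : V₁) (x' y' : V₂), 1 ≤ D → ρ₁ x y ≤ D → ρ₂ x' y' ≤ D →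
      ENNReal.ofReal (c * D ^ (1 - (a₁ + a₂))) ≤
        ∫⁻ t in Set.Ioi (0 : ℝ), heat (lazy ℓ₁ P₁) t x y * heat (lazy ℓ₂ P₂) t x' y' := by
  obtain ⟨Λ, c₁, hΛ, hc₁, hb₁⟩ := h₁.heat_lower hℓ₁
  obtain ⟨c₂, hc₂, hb₂⟩ := h₂.lintegral_rpow_mul_heat_lower hℓ₂ h₁.pos.le
  have hΛ0 : 0 < Λ := by linarith
  refine ⟨c₁ * c₂ * Λ ^ (1 - (a₁ + a₂)), by positivity, fun D x y x' y' hD hxy hxy' => ?_⟩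
  have hDΛ : D ≤ Λ * D := by nlinarith
  calc ENNReal.ofReal (c₁ * c₂ * Λ ^ (1 - (a₁ + a₂)) * D ^ (1 - (a₁ + a₂)))
      = ENNReal.ofReal c₁ * ENNReal.ofReal (c₂ * (Λ * D) ^ (1 - a₂ - a₁)) := by
        rw [← ENNReal.ofReal_mul hc₁.le, Real.mul_rpow hΛ0.le (by linarith)]
        rw [show 1 - a₂ - a₁ = 1 - (a₁ + a₂) by ring]
        congr 1
        ring
    _ ≤ ENNReal.ofReal c₁ * ∫⁻ t in Set.Ioi (Λ * D),
          ENNReal.ofReal (t ^ (-a₁)) * heat (lazy ℓ₂ P₂) t x' y' := by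
        gcongr
        exact hb₂ _ x' y' (hD.trans hDΛ) (hxy'.trans hDΛ)
    _ = ∫⁻ t in Set.Ioi (Λ * D), ENNReal.ofReal c₁ *
          (ENNReal.ofReal (t ^ (-a₁)) * heat (lazy ℓ₂ P₂) t x' y') :=
        (lintegral_const_mul' _ _ ENNReal.ofReal_ne_top).symm
    _ ≤ ∫⁻ t in Set.Ioi (Λ * D), heat (lazy ℓ₁ P₁) t x y * heat (lazy ℓ₂ P₂) t x' y' := by
        refine setLIntegral_mono' measurableSet_Ioi fun t ht => ?_
        have := hb₁ D t x y hD (le_of_lt ht) hxy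
        rw [ENNReal.ofReal_mul hc₁.le] at this
        rw [← mul_assoc]
        gcongr
    _ ≤ _ := lintegral_mono_set (Set.Ioi_subset_Ioi (by positivity))

end PowerBounds

end InfMatrix

/-! ### The distance, volume growth and Green decay on the product -/

theorem IsDistance.rpow {X : Type*} {d : X → X → ℝ} (hd : IsDistance d) (h0 : ∀ x y, 0 ≤ d x y)
    {p : ℝ} (hp : 0 < p) (hp1 : p ≤ 1) : IsDistance fun x y => d x y ^ p where
  eq_zero_iff x y := by rw [Real.rpow_eq_zero (h0 x y) hp.ne', hd.eq_zero_iff]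
  symm x y := by rw [hd.symm]
  triangle x y z := (Real.rpow_le_rpow (h0 x z) (hd.triangle x y z) hp.le).trans
    (Real.rpow_add_le_add_rpow (h0 x y) (h0 y z) hp.le hp1)

theorem IsDistance.sup {X Y : Type*} {d : X → X → ℝ} {d' : Y → Y → ℝ} (hd : IsDistance d)
    (hd' : IsDistance d') (h0 : ∀ x y, 0 ≤ d x y) (h0' : ∀ x y, 0 ≤ d' x y) :
    IsDistance fun x y : X × Y => max (d x.1 y.1) (d' x.2 y.2) where
  eq_zero_iff x y := by
    rw [Prod.ext_iff, ← hd.eq_zero_iff, ← hd'.eq_zero_iff]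
    constructor
    · intro h
      exact ⟨le_antisymm (h ▸ le_max_left _ _) (h0 _ _),
        le_antisymm (h ▸ le_max_right _ _) (h0' _ _)⟩
    · rintro ⟨h, h'⟩
      rw [h, h', max_self]
  symm x y := by rw [hd.symm, hd'.symm]
  triangle x y z := max_le
    ((hd.triangle _ y.1 _).trans (add_le_add (le_max_left _ _) (le_max_left _ _)))
    ((hd'.triangle _ y.2 _).trans (add_le_add (le_max_right _ _) (le_max_right _ _)))

namespace WeightedGraph

variable {V V₁ V₂ : Type*}

theorem isDistance_graphDist (W : WeightedGraph V) : IsDistance W.graphDist :=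
  ⟨fun _ _ => W.graphDist_eq_zero_iff, W.graphDist_comm, W.graphDist_triangle⟩

theorem isDistance_productDist (W₁ : WeightedGraph V₁) (W₂ : WeightedGraph V₂) {β₁ β₂ : ℝ}
    (hβ₁ : 0 < β₁) (hβ : β₁ ≤ β₂) : IsDistance (productDist W₁ W₂ β₁ β₂) :=
  (W₁.isDistance_graphDist.rpow W₁.graphDist_nonneg (div_pos hβ₁ (hβ₁.trans_le hβ))
    ((div_le_one (hβ₁.trans_le hβ)).2 hβ)).sup W₂.isDistance_graphDist
    (fun x y => Real.rpow_nonneg (W₁.graphDist_nonneg x y) _) W₂.graphDist_nonneg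

theorem productDist_nonneg (W₁ : WeightedGraph V₁) (W₂ : WeightedGraph V₂) (β₁ β₂ : ℝ)
    (x y : V₁ × V₂) : 0 ≤ productDist W₁ W₂ β₁ β₂ x y :=
  le_max_of_le_right (W₂.graphDist_nonneg _ _)

/-- The distance is built so that its power `β₂` is the larger of the time scales of the two
factors. -/
theorem productDist_rpow (W₁ : WeightedGraph V₁) (W₂ : WeightedGraph V₂) {β₁ β₂ : ℝ}
    (hβ₂ : 0 < β₂) (x y : V₁ × V₂) : productDist W₁ W₂ β₁ β₂ x y ^ β₂ =
      max (W₁.graphDist x.1 y.1 ^ β₁) (W₂.graphDist x.2 y.2 ^ β₂) := by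
  have h₁ := W₁.graphDist_nonneg x.1 y.1
  have h₂ := W₂.graphDist_nonneg x.2 y.2
  rw [productDist, (Real.monotoneOn_rpow_Ici_of_exponent_nonneg hβ₂.le).map_max
    (Real.rpow_nonneg h₁ _) h₂, ← Real.rpow_mul h₁, div_mul_cancel₀ _ hβ₂.ne']

theorem one_le_productDist (W₁ : WeightedGraph V₁) (W₂ : WeightedGraph V₂) {β₁ β₂ : ℝ}
    (hβ₁ : 0 < β₁) (hβ₂ : 0 < β₂) {x y : V₁ × V₂} (h : x ≠ y) :
    1 ≤ productDist W₁ W₂ β₁ β₂ x y := by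
  by_cases h₁ : x.1 = y.1
  · exact le_max_of_le_right (W₂.one_le_graphDist fun h₂ => h (Prod.ext h₁ h₂))
  · exact le_max_of_le_left (Real.one_le_rpow (W₁.one_le_graphDist h₁) (by positivity))

theorem exists_vertexWeight_bounds [MeasurableSpace V] [DiscreteMeasurableSpace V] [Countable V]
    [Nontrivial V] {W : WeightedGraph V} {α β : ℝ} (hα : 0 ≤ α) (hβ : 1 < β)
    (hp : W.ControlledWeights) (hU : W.UHK W.graphDist α β) (hL : W.LHK W.graphDist α β) :
    ∃ c Λ : ℝ, 0 < c ∧ 0 < Λ ∧ (∀ x, c ≤ W.vertexWeight x) ∧ ∀ x, W.vertexWeight x ≤ Λ := by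
  obtain ⟨Λ, hΛ, hle⟩ := exists_vertexWeight_le hβ hL
  obtain ⟨c, hc, hge⟩ := exists_le_vertexWeight hα (by linarith) hp hU
  exact ⟨c, Λ, hc, hΛ, hge, hle⟩

open InfMatrix.PowerBounds in
/-- If the vertex weights are bounded from above and below, then the volume of a set is comparable
to its cardinality; for the balls of a product, the latter is the product of the cardinalities. -/
theorem volume_prod_bounds {W₁ : WeightedGraph V₁} {W₂ : WeightedGraph V₂} {c Λ : ℝ}
    (hc₁ : ∀ x, c ≤ W₁.vertexWeight x) (hc₂ : ∀ x, c ≤ W₂.vertexWeight x)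
    (h₁ : ∀ x, W₁.vertexWeight x ≤ Λ) (h₂ : ∀ x, W₂.vertexWeight x ≤ Λ)
    (ρ₁ : V₁ → V₁ → ℝ) (ρ₂ : V₂ → V₂ → ℝ) (x : V₁ × V₂) (R : ℝ) :
    ENNReal.ofReal (2 * c) * (ballCard ρ₁ x.1 R * ballCard ρ₂ x.2 R) ≤
        (W₁.prod W₂).volume {y | max (ρ₁ x.1 y.1) (ρ₂ x.2 y.2) ≤ R} ∧
      (W₁.prod W₂).volume {y | max (ρ₁ x.1 y.1) (ρ₂ x.2 y.2) ≤ R} ≤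
        ENNReal.ofReal (2 * Λ) * (ballCard ρ₁ x.1 R * ballCard ρ₂ x.2 R) := by
  have hcard : ∀ w : ℝ≥0∞, w * (ballCard ρ₁ x.1 R * ballCard ρ₂ x.2 R) =
      ∑' y : V₁ × V₂, Set.indicator {y | max (ρ₁ x.1 y.1) (ρ₂ x.2 y.2) ≤ R} (fun _ => w) y := by
    intro w
    rw [ballCard, ballCard, ← ENNReal.tsum_mul_right, ← ENNReal.tsum_mul_left, ENNReal.tsum_prod']
    refine tsum_congr fun y => ?_
    rw [← ENNReal.tsum_mul_left, ← ENNReal.tsum_mul_left]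
    refine tsum_congr fun z => ?_
    by_cases hy : ρ₁ x.1 y ≤ R <;> by_cases hz : ρ₂ x.2 z ≤ R <;>
      simp [Set.indicator, hy, hz]
  rw [hcard, hcard, volume, tsum_subtype _ fun y => ENNReal.ofReal ((W₁.prod W₂).vertexWeight y)]
  constructor <;>
  · refine ENNReal.tsum_le_tsum fun y => Set.indicator_le_indicator ?_
    refine ENNReal.ofReal_le_ofReal ?_
    rw [vertexWeight_prod]
    linarith [hc₁ y.1, hc₂ y.2, h₁ y.1, h₂ y.2]

theorem volumeGrowth_prod [MeasurableSpace V₁] [DiscreteMeasurableSpace V₁] [Countable V₁]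
    [Nontrivial V₁] [MeasurableSpace V₂] [DiscreteMeasurableSpace V₂] [Countable V₂]
    [Nontrivial V₂] {W₁ : WeightedGraph V₁} {W₂ : WeightedGraph V₂} {α₁ α₂ β₁ β₂ : ℝ}
    (hp₁ : W₁.ControlledWeights) (hp₂ : W₂.ControlledWeights)
    (hU₁ : W₁.UHK W₁.graphDist α₁ β₁) (hL₁ : W₁.LHK W₁.graphDist α₁ β₁)
    (hU₂ : W₂.UHK W₂.graphDist α₂ β₂) (hL₂ : W₂.LHK W₂.graphDist α₂ β₂)
    (hα₁ : 0 < α₁) (hα₂ : 0 < α₂) (hβ₁ : 1 < β₁) (hβ₂ : 1 < β₂)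
    (hα : 2 < α₁ * (β₂ / β₁) + α₂) :
    (W₁.prod W₂).VolumeGrowth (productDist W₁ W₂ β₁ β₂) (α₁ * (β₂ / β₁) + α₂) := by
  obtain ⟨c₁, Λ₁, hc₁, hΛ₁, hge₁, hle₁⟩ := exists_vertexWeight_bounds hα₁.le hβ₁ hp₁ hU₁ hL₁
  obtain ⟨c₂, Λ₂, hc₂, hΛ₂, hge₂, hle₂⟩ := exists_vertexWeight_bounds hα₂.le hβ₂ hp₂ hU₂ hL₂
  have hb₁ := powerBounds hα₁ hβ₁ hp₁ hU₁ hL₁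
  have hb₂ := powerBounds hα₂ hβ₂ hp₂ hU₂ hL₂
  obtain ⟨u₁, hu₁, hup₁⟩ := hb₁.ballCard_upper
  obtain ⟨u₂, hu₂, hup₂⟩ := hb₂.ballCard_upper
  obtain ⟨l₁, hl₁, hlow₁⟩ := hb₁.ballCard_lower
  obtain ⟨l₂, hl₂, hlow₂⟩ := hb₂.ballCard_lower
  have hβ₂0 : 0 < β₂ := by linarith
  set c := min c₁ c₂ with hc
  set Λ := max Λ₁ Λ₂ with hΛ
  have hc0 : 0 < c := lt_min hc₁ hc₂
  have hΛ0 : 0 < Λ := lt_max_of_lt_left hΛ₁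
  refine ⟨hα, 2 * c * (l₁ * l₂), max (2 * c * (l₁ * l₂)) (2 * Λ * (u₁ * u₂)), by positivity,
    le_max_left _ _, fun x L hL => ?_⟩
  have hL0 : 0 < L := by linarith
  have hR : 1 ≤ L ^ β₂ := Real.one_le_rpow hL hβ₂0.le
  have hpow : ∀ s t : ℝ, s * (L ^ β₂) ^ (α₁ / β₁) * (t * (L ^ β₂) ^ (α₂ / β₂)) =
      s * t * L ^ (α₁ * (β₂ / β₁) + α₂) := by
    intro s t
    have e₁ : β₂ * (α₁ / β₁) = α₁ * (β₂ / β₁) := by ring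
    have e₂ : β₂ * (α₂ / β₂) = α₂ := by field_simp
    rw [← Real.rpow_mul hL0.le, ← Real.rpow_mul hL0.le, e₁, e₂, Real.rpow_add hL0]
    ring
  have hball : {y | productDist W₁ W₂ β₁ β₂ x y ≤ L} =
      {y | max (W₁.graphDist x.1 y.1 ^ β₁) (W₂.graphDist x.2 y.2 ^ β₂) ≤ L ^ β₂} := by
    ext y
    rw [Set.mem_ofPred_eq, Set.mem_ofPred_eq, ← productDist_rpow W₁ W₂ hβ₂0,
      Real.rpow_le_rpow_iff (productDist_nonneg W₁ W₂ β₁ β₂ x y) hL0.le hβ₂0]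
  obtain ⟨hlo, hhi⟩ := volume_prod_bounds (W₁ := W₁) (W₂ := W₂)
    (fun x => (min_le_left _ _).trans (hge₁ x)) (fun x => (min_le_right _ _).trans (hge₂ x))
    (fun x => (hle₁ x).trans (le_max_left _ _)) (fun x => (hle₂ x).trans (le_max_right _ _))
    (fun x y => W₁.graphDist x y ^ β₁) (fun x y => W₂.graphDist x y ^ β₂) x (L ^ β₂)
  rw [hball]
  constructor
  · refine le_trans ?_ hlo
    rw [mul_assoc (2 * c), ← hpow, ENNReal.ofReal_mul (p := 2 * c) (by positivity),
      ENNReal.ofReal_mul (p := l₁ * _) (by positivity)]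
    gcongr
    exacts [hlow₁ x.1 _ hR, hlow₂ x.2 _ hR]
  · refine hhi.trans ?_
    calc _ ≤ ENNReal.ofReal (2 * Λ) * (ENNReal.ofReal (u₁ * (L ^ β₂) ^ (α₁ / β₁)) *
          ENNReal.ofReal (u₂ * (L ^ β₂) ^ (α₂ / β₂))) := by
          gcongr
          exacts [hup₁ x.1 _ hR, hup₂ x.2 _ hR]
      _ = ENNReal.ofReal (2 * Λ * (u₁ * u₂) * L ^ (α₁ * (β₂ / β₁) + α₂)) := by
          rw [mul_assoc (2 * Λ), ← hpow, ENNReal.ofReal_mul (p := 2 * Λ) (by positivity),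
            ENNReal.ofReal_mul (p := u₁ * _) (by positivity)]
      _ ≤ _ := by
          gcongr
          exact le_max_right _ _

theorem greenDecay_prod [MeasurableSpace V₁] [DiscreteMeasurableSpace V₁] [Countable V₁]
    [Nontrivial V₁] [MeasurableSpace V₂] [DiscreteMeasurableSpace V₂] [Countable V₂]
    [Nontrivial V₂] {W₁ : WeightedGraph V₁} {W₂ : WeightedGraph V₂} {α₁ α₂ β₁ β₂ : ℝ}
    (hp₁ : W₁.ControlledWeights) (hp₂ : W₂.ControlledWeights)
    (hU₁ : W₁.UHK W₁.graphDist α₁ β₁) (hL₁ : W₁.LHK W₁.graphDist α₁ β₁)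
    (hU₂ : W₂.UHK W₂.graphDist α₂ β₂) (hL₂ : W₂.LHK W₂.graphDist α₂ β₂)
    (hα₁ : 0 < α₁) (hα₂ : 0 < α₂) (hβ₁ : 1 < β₁) (hβ₂ : 2 ≤ β₂)
    (ha : 1 < α₁ / β₁ + α₂ / β₂) :
    (W₁.prod W₂).GreenDecay (productDist W₁ W₂ β₁ β₂) (α₁ * (β₂ / β₁) + α₂) β₂ := by
  have hβ₂1 : 1 < β₂ := by linarith
  have hβ₂0 : 0 < β₂ := by linarith
  obtain ⟨c₁, Λ₁, hc₁, hΛ₁, hge₁, hle₁⟩ := exists_vertexWeight_bounds hα₁.le hβ₁ hp₁ hU₁ hL₁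
  obtain ⟨c₂, Λ₂, hc₂, hΛ₂, hge₂, hle₂⟩ := exists_vertexWeight_bounds hα₂.le hβ₂1 hp₂ hU₂ hL₂
  have hb₁ := powerBounds hα₁ hβ₁ hp₁ hU₁ hL₁
  have hb₂ := powerBounds hα₂ hβ₂1 hp₂ hU₂ hL₂
  set c := min c₁ c₂ with hc
  set Λ := max Λ₁ Λ₂ with hΛ
  have hc0 : 0 < c := lt_min hc₁ hc₂
  have hΛ0 : 0 < Λ := lt_max_of_lt_left hΛ₁
  have hg₁ : ∀ x, c ≤ W₁.vertexWeight x := fun x => (min_le_left _ _).trans (hge₁ x)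
  have hg₂ : ∀ x, c ≤ W₂.vertexWeight x := fun x => (min_le_right _ _).trans (hge₂ x)
  have hu₁ : ∀ x, W₁.vertexWeight x ≤ Λ := fun x => (hle₁ x).trans (le_max_left _ _)
  have hu₂ : ∀ x, W₂.vertexWeight x ≤ Λ := fun x => (hle₂ x).trans (le_max_right _ _)
  obtain ⟨C', hC', hup⟩ := hb₁.lintegral_heat_mul_heat_upper hb₂
    (reversible hc0 hΛ0 hg₁ hu₁) (reversible hc0 hΛ0 hg₂ hu₂) ha
  obtain ⟨c', hc', hlow⟩ := hb₁.lintegral_heat_mul_heat_lower hb₂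
    (reversible hc0 hΛ0 hg₁ hu₁) (reversible hc0 hΛ0 hg₂ hu₂)
  set lo : ℝ := c / Λ ^ 2 * c' with hlo
  set hi : ℝ := max lo (1 / c * C') with hhi
  have hlo0 : 0 < lo := by positivity
  -- Taking `D = 1` gives the diagonal, and `D = d ^ β₂` gives distinct points, where `d ≥ 1`.
  have key : ∀ (x y : V₁ × V₂) (D : ℝ), 1 ≤ D → productDist W₁ W₂ β₁ β₂ x y ^ β₂ ≤ D →
      D = 1 ∨ D = productDist W₁ W₂ β₁ β₂ x y ^ β₂ →
      ENNReal.ofReal (lo * D ^ (1 - (α₁ / β₁ + α₂ / β₂))) ≤ (W₁.prod W₂).green x y ∧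
      (W₁.prod W₂).green x y ≤ ENNReal.ofReal (hi * D ^ (1 - (α₁ / β₁ + α₂ / β₂))) := by
    intro x y D hD hle hD'
    rw [productDist_rpow W₁ W₂ hβ₂0] at hle hD'
    obtain ⟨hgl, hgu⟩ := green_prod_bounds hc0 hΛ0 hg₁ hg₂ hu₁ hu₂ x y
    constructor
    · refine le_trans ?_ hgl
      rw [hlo, mul_assoc, ENNReal.ofReal_mul (by positivity)]
      gcongr
      exact hlow D _ _ _ _ hD ((le_max_left _ _).trans hle) ((le_max_right _ _).trans hle)
    · refine hgu.trans ?_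
      calc _ ≤ ENNReal.ofReal (1 / c) *
            ENNReal.ofReal (C' * D ^ (1 - (α₁ / β₁ + α₂ / β₂))) := by
            gcongr
            exact hup D _ _ _ _ hD (hD'.imp_right fun h => le_max_iff.1 h.le)
        _ = ENNReal.ofReal (1 / c * C' * D ^ (1 - (α₁ / β₁ + α₂ / β₂))) := by
            rw [← ENNReal.ofReal_mul (by positivity), mul_assoc]
        _ ≤ _ := by
            gcongr
            exact le_max_right _ _
  have hαβ : α₁ * (β₂ / β₁) + α₂ = β₂ * (α₁ / β₁ + α₂ / β₂) := by field_simp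
  refine ⟨hβ₂, ?_, lo, hi, hlo0, le_max_left _ _, fun x => ?_, fun x y hxy => ?_⟩
  · rw [hαβ]
    exact lt_mul_of_one_lt_right hβ₂0 ha
  · have h := key x x 1 le_rfl (by
      rw [productDist_rpow W₁ W₂ hβ₂0, graphDist_self, graphDist_self,
        Real.zero_rpow (by linarith), Real.zero_rpow (by linarith), max_self]
      exact zero_le_one) (Or.inl rfl)
    simpa only [Real.one_rpow, mul_one] using h
  · have h1 : 1 ≤ productDist W₁ W₂ β₁ β₂ x y :=
      one_le_productDist W₁ W₂ (by linarith) hβ₂0 hxy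
    have h := key x y _ (Real.one_le_rpow h1 hβ₂0.le) le_rfl (Or.inr rfl)
    rwa [← Real.rpow_mul (by linarith), show β₂ * (1 - (α₁ / β₁ + α₂ / β₂)) =
      -(α₁ * (β₂ / β₁) + α₂ - β₂) by rw [hαβ]; ring] at h

end WeightedGraph

theorem proposition3p5 {V₁ V₂ : Type*}
    [Countable V₁] [Infinite V₁] [MeasurableSpace V₁] [DiscreteMeasurableSpace V₁]
    [Countable V₂] [Infinite V₂] [MeasurableSpace V₂] [DiscreteMeasurableSpace V₂]
    (W₁ : WeightedGraph V₁) (W₂ : WeightedGraph V₂) (α₁ α₂ β₁ β₂ : ℝ)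
    (hp₁ : W₁.ControlledWeights) (hp₂ : W₂.ControlledWeights)
    (hU₁ : W₁.UHK W₁.graphDist α₁ β₁) (hL₁ : W₁.LHK W₁.graphDist α₁ β₁)
    (hU₂ : W₂.UHK W₂.graphDist α₂ β₂) (hL₂ : W₂.LHK W₂.graphDist α₂ β₂)
    (hα₁ : 1 ≤ α₁) (hα₂ : 1 ≤ α₂)
    (hβ₁ : 2 ≤ β₁) (hβα₁ : β₁ ≤ 1 + α₁) (hβ₂ : 2 ≤ β₂) (hβα₂ : β₂ ≤ 1 + α₂)
    (hj : (1 < α₁ ∨ 2 < β₁) ∨ (1 < α₂ ∨ 2 < β₂))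
    (hβ : β₁ ≤ β₂) :
    IsDistance (productDist W₁ W₂ β₁ β₂) ∧
    (W₁.prod W₂).VolumeGrowth (productDist W₁ W₂ β₁ β₂) (α₁ * (β₂ / β₁) + α₂) ∧
    (W₁.prod W₂).GreenDecay (productDist W₁ W₂ β₁ β₂) (α₁ * (β₂ / β₁) + α₂) β₂ := by
  -- If `β_j > 2`, then `β_j ≤ 1 + α_j` forces `α_j > 1`.
  have hα : 2 < α₁ + α₂ := by
    rcases hj with (h | h) | h | h <;> linarith
  refine ⟨W₁.isDistance_productDist W₂ (by linarith) hβ,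
    WeightedGraph.volumeGrowth_prod hp₁ hp₂ hU₁ hL₁ hU₂ hL₂ (by linarith) (by linarith)
      (by linarith) (by linarith) ?_,
    WeightedGraph.greenDecay_prod hp₁ hp₂ hU₁ hL₁ hU₂ hL₂ (by linarith) (by linarith)
      (by linarith) hβ₂ ?_⟩
  · have h1 : 1 ≤ β₂ / β₁ := (one_le_div (by linarith)).2 hβ
    nlinarith
  -- From `βᵢ ≤ 1 + αᵢ ≤ 2 αᵢ` each quotient is at least `1 / 2`, strictly when `αᵢ > 1`, which `hα`
  -- forces for some `i`.
  · rw [div_add_div _ _ (by linarith) (by linarith), one_lt_div (by nlinarith)]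
    nlinarith
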